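/- Let $(X,d,\mu)$ be a space of homogeneous type: $d$ is a quasi-metric with $d(x,y)\le\kappa(d(x,z)+d(z,y))$, $\kappa\ge 1$; balls are measurable with positive finite measure; $\mu(B(x,2r))\le D_\mu\,\mu(B(x,r))$ for all $x\in X$, $r>0$; and continuous functions are dense in $L^1(X,\mu)$. Let $Mf(x)=\sup_{B\ni x}\mu(B)^{-1}\int_B|f|\,d\mu$. A weight is an a.e. positive function integrable on balls. For $1<r<\infty$ let $[w]_{A_r}=\sup_B\big(\frac1{\mu(B)}\int_B w\,d\mu\big)\big(\frac1{\mu(B)}\int_B w^{1-r'}d\mu\big)^{r-1}$, let $[w]_{A_1}$ be the best constant $c$ in $Mw\le c\,w$ a.e., and let $A_r$ be the class of weights with $[w]_{A_r}<\infty$. Put $$\overline c=32\,\kappa^{D_\mu}(2\theta)^{D_\mu}(1+\tau),\qquad \theta=4\kappa^2+\kappa,\qquad \tau=6\big(32\kappa^4(4\kappa+1)\big)^{D_\mu}.$$ A Banach function space (BFS) is a Banach space $E$ of (classes of) measurable functions such that $\|f\|_E=0$ iff $f=0$ a.e.; $|g|\le|f|$ a.e. implies $\|g\|_E\le\|f\|_E$;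 $0\le f_j\uparrow f$ a.e. implies $\|f_j\|_E\uparrow\|f\|_E$; and for every $F$ with $\mu(F)<\infty$ one has $\chi_F\in E$ and $\int_F|f|\,d\mu\le C_F\|f\|_E$. Let $\|f\|_{E'}=\sup\{\int_X|fg|\,d\mu:\|g\|_E\le1\}$ and, for $0<s<\infty$, $\|f\|_{E^s}=\||f|^s\|_E^{1/s}$. **Theorem.** Let $\mathcal F$ be a family of pairs $(f,g)$ of non-negative measurable functions on $X$, let $1\le p_0,q_0<\infty$, $C>0$, and let $N:[1,\infty)\to(0,\infty)$ be non-decreasing. Put $1/(p_0)'=1-1/p_0$ and $\gamma=\frac1{q_0}+\frac1{(p_0)'}$. Suppose that for every $w\in A_{1+q_0/(p_0)'}$ and every $(f,g)\in\mathcal F$ $$\Big(\int_X g^{q_0}w\,d\mu\Big)^{1/q_0}\le C\,N\big([w]_{A_{1+q_0/(p_0)'}}\big)\Big(\int_X f^{p_0}w^{p_0/q_0}\,d\mu\Big)^{1/p_0}.$$ Let $E$ and $\overline E$ be BFSs and let $1<\widetilde p_0,\widetilde q_0<\infty$ satisfy $\frac1{\widetilde p_0}-\frac1{\widetilde q_0}=\frac1{p_0}-\frac1{q_0}$.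 Suppose that $\overline E^{1/\widetilde q_0}$ and $E^{1/\widetilde p_0}$ are BFSs, and that $$\big(\overline E^{1/\widetilde q_0}\big)'=\Big[\big(E^{1/\widetilde p_0}\big)'\Big]^{\widetilde p_0/\widetilde q_0}$$ with equality of norms. Suppose that $M$ is bounded on $(\overline E^{1/\widetilde q_0})'$ (in particular, it maps this space to measurable functions), with norm $\|M\|$. Then for every $(f,g)\in\mathcal F$ with $\|g\|_{\overline E}<\infty$, $$\|g\|_{\overline E}\le 4\,\overline K\,\|f\|_E,$$ where $$\overline K=C\cdot\begin{cases} N\Big[\Big(2\overline c\big(1+\tfrac{\widetilde q_0}{(\widetilde p_0)'}\big)\Big)^{\gamma(q_0-\widetilde q_0)}\,\big(2\|M\|\big)^{1+\frac{\gamma(\widetilde p_0)'(q_0-\widetilde q_0)}{\widetilde q_0}}\Big], & \widetilde q_0<q_0,\\[2mm] N\Big[\Big(2\overline c\big(1+\tfrac{\widetilde q_0}{(\widetilde p_0)'}\big)\Big)^{\frac{\gamma(\widetilde q_0-q_0)}{\gamma\widetilde q_0-1}}\;2\|M\|\Big], & \widetilde q_0\ge q_0.\end{cases}$$ -/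

import Mathlib

open MeasureTheory
open scoped ENNReal NNReal

/-- The ball `B(x, r) = {y | d x y < r}`. -/
def quasiBall {X : Type*} (d : X → X → ℝ) (x : X) (r : ℝ) : Set X := {y | d x y < r}

/-- A space of homogeneous type `(X, d, μ)`: `d` is a quasi-metric with constant `κ`, balls are
measurable with positive finite measure, `μ` is doubling with constant `D`, and the (integrable)
`d`-continuous functions are dense in `L¹`. As soon as `X` has two points, `1 ≤ κ` follows from
the quasi-triangle inequality. -/
structure HomogeneousSpace (X : Type*) [MeasurableSpace X] where
  d : X → X → ℝ
  μ : Measure X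
  κ : ℝ
  D : ℝ
  d_nonneg : ∀ x y, 0 ≤ d x y
  d_eq_zero_iff : ∀ x y, d x y = 0 ↔ x = y
  d_symm : ∀ x y, d x y = d y x
  one_le_κ : 1 ≤ κ
  d_triangle : ∀ x y z, d x y ≤ κ * (d x z + d z y)
  measurableSet_ball : ∀ x r, MeasurableSet (quasiBall d x r)
  measure_ball_pos : ∀ x r, 0 < r → 0 < μ (quasiBall d x r)
  measure_ball_lt_top : ∀ x r, μ (quasiBall d x r) < ∞
  D_pos : 0 < D
  doubling : ∀ x r, 0 < r → μ (quasiBall d x (2 * r)) ≤ ENNReal.ofReal D * μ (quasiBall d x r)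
  dense_continuous : ∀ f : X → ℝ, Integrable f μ → ∀ ε : ℝ, 0 < ε →
    ∃ g : X → ℝ, (∀ x, ∀ η : ℝ, 0 < η → ∃ δ : ℝ, 0 < δ ∧ ∀ y, d x y < δ → |g y - g x| < η) ∧
      Integrable g μ ∧ ∫ x, |f x - g x| ∂μ < ε

namespace HomogeneousSpace

variable {X : Type*} [MeasurableSpace X]

/-- The ball with centre `x` and radius `r`. -/
def ball (S : HomogeneousSpace X) (x : X) (r : ℝ) : Set X := quasiBall S.d x r

/-- The mean value of `f` over the ball `B(c, r)`. -/
noncomputable def avg (S : HomogeneousSpace X) (f : X → ℝ≥0∞) (c : X) (r : ℝ) : ℝ≥0∞ :=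
  (S.μ (S.ball c r))⁻¹ * ∫⁻ y in S.ball c r, f y ∂S.μ

/-- The (non-centred) Hardy--Littlewood maximal function of a non-negative function. -/
noncomputable def maximal (S : HomogeneousSpace X) (f : X → ℝ≥0∞) (x : X) : ℝ≥0∞ :=
  ⨆ (c : X) (r : ℝ) (_ : 0 < r) (_ : x ∈ S.ball c r), S.avg f c r

/-- Weights: a.e. positive functions that are integrable on balls (hence a.e. finite). -/
structure IsWeight (S : HomogeneousSpace X) (w : X → ℝ≥0∞) : Prop where
  aemeasurable : AEMeasurable w S.μ
  pos : ∀ᵐ x ∂S.μ, 0 < w x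
  locallyIntegrable : ∀ x r, ∫⁻ y in S.ball x r, w y ∂S.μ < ∞

/-- The Muckenhoupt characteristic `[w]_{A_p}`, `1 ≤ p < ∞`: for `p = 1` the best constant in
`M w ≤ C w` a.e., and for `p > 1` the usual supremum over balls; note `1 - p' = -1 / (p - 1)`. -/
noncomputable def apConst (S : HomogeneousSpace X) (p : ℝ) (w : X → ℝ≥0∞) : ℝ≥0∞ :=
  open Classical in
  if p = 1 then sInf {C : ℝ≥0∞ | ∀ᵐ x ∂S.μ, S.maximal w x ≤ C * w x}
  else ⨆ (c : X) (r : ℝ) (_ : 0 < r),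
    S.avg w c r * (S.avg (fun x => w x ^ (-1 / (p - 1))) c r) ^ (p - 1)

/-- The Muckenhoupt class `A_p`, `1 ≤ p < ∞`. -/
def Ap (S : HomogeneousSpace X) (p : ℝ) : Set (X → ℝ≥0∞) :=
  {w | S.IsWeight w ∧ S.apConst p w < ∞}

/-- `ρ` is the norm of a Banach function space over `(X, μ)`. Since such a norm depends only on
the modulus of a function, `ρ` is recorded by its values on non-negative measurable functions
(the space is `{f | ρ |f| < ∞}`). Completeness follows from the Fatou property `iSup_eq`, and
functions that are infinite on a set of positive measure automatically have infinite norm. -/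
structure IsBFS (S : HomogeneousSpace X) (ρ : (X → ℝ≥0∞) → ℝ≥0∞) : Prop where
  smul_eq : ∀ (c : ℝ≥0) f, AEMeasurable f S.μ → ρ (fun x => c * f x) = c * ρ f
  triangle : ∀ f g, AEMeasurable f S.μ → AEMeasurable g S.μ →
    ρ (fun x => f x + g x) ≤ ρ f + ρ g
  eq_zero_iff : ∀ f, AEMeasurable f S.μ → (ρ f = 0 ↔ ∀ᵐ x ∂S.μ, f x = 0)
  mono : ∀ f g, AEMeasurable f S.μ → AEMeasurable g S.μ → (∀ᵐ x ∂S.μ, g x ≤ f x) → ρ g ≤ ρ f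
  iSup_eq : ∀ f : ℕ → X → ℝ≥0∞, (∀ n, AEMeasurable (f n) S.μ) →
    (∀ᵐ x ∂S.μ, Monotone fun n => f n x) → ρ (fun x => ⨆ n, f n x) = ⨆ n, ρ (f n)
  indicator_lt_top : ∀ F : Set X, MeasurableSet F → S.μ F < ∞ →
    ρ (F.indicator fun _ => 1) < ∞
  setLIntegral_le : ∀ F : Set X, MeasurableSet F → S.μ F < ∞ →
    ∃ C : ℝ≥0, ∀ f, AEMeasurable f S.μ → ∫⁻ x in F, f x ∂S.μ ≤ C * ρ f

/-- The norm of the Köthe dual `E'`. -/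
noncomputable def dual (S : HomogeneousSpace X) (ρ : (X → ℝ≥0∞) → ℝ≥0∞) (f : X → ℝ≥0∞) : ℝ≥0∞ :=
  ⨆ (g : X → ℝ≥0∞) (_ : AEMeasurable g S.μ) (_ : ρ g ≤ 1), ∫⁻ x, f x * g x ∂S.μ

/-- The operator norm of the maximal operator on the space with norm `ρ`. -/
noncomputable def maximalNorm (S : HomogeneousSpace X) (ρ : (X → ℝ≥0∞) → ℝ≥0∞) : ℝ≥0∞ :=
  sInf {c : ℝ≥0∞ | ∀ f, AEMeasurable f S.μ → ρ f < ∞ → ρ (S.maximal f) ≤ c * ρ f}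

/-- The maximal operator maps the space with norm `ρ` boundedly into itself (in particular it
maps elements of the space to measurable functions). -/
def MaximalBounded (S : HomogeneousSpace X) (ρ : (X → ℝ≥0∞) → ℝ≥0∞) : Prop :=
  (∀ f, AEMeasurable f S.μ → ρ f < ∞ → AEMeasurable (S.maximal f) S.μ) ∧ S.maximalNorm ρ < ∞

/-- The structural constant
`c̄ = 32 κ^D (2θ)^D (1 + τ)`, `θ = 4κ² + κ`, `τ = 6 (32 κ⁴ (4κ + 1))^D`. -/
noncomputable def cbar (S : HomogeneousSpace X) : ℝ :=
  32 * S.κ ^ S.D * (2 * (4 * S.κ ^ 2 + S.κ)) ^ S.D *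
    (1 + 6 * (32 * S.κ ^ 4 * (4 * S.κ + 1)) ^ S.D)

end HomogeneousSpace

/-- The norm `‖f‖_{E^p} = ‖|f|^p‖_E^{1/p}` of the `p`-convexification, `0 < p < ∞`. -/
noncomputable def convexify {X : Type*} (ρ : (X → ℝ≥0∞) → ℝ≥0∞) (p : ℝ) (f : X → ℝ≥0∞) : ℝ≥0∞ :=
  ρ (fun x => f x ^ p) ^ (1 / p)

/-- `γ = 1 / q₀ + 1 / p₀'`, where `1 / p₀' = 1 - 1 / p₀` (which is `0` for `p₀ = 1`). -/
noncomputable def gammaExponent (p₀ q₀ : ℝ) : ℝ := 1 / q₀ + (1 - 1 / p₀)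

/-- The constant `K̄ = C N[…]`; here `p, q` stand for the exponents `p̃₀, q̃₀`, `c` for the
structural constant and `m` for the norm of the maximal operator. Both branches would give
`C N(2m)` for `q = q₀`. -/
noncomputable def Kbar (C : ℝ) (N : ℝ → ℝ) (c p₀ q₀ p q m : ℝ) : ℝ :=
  open Classical in
  C * if q < q₀ then
    N ((2 * c * (1 + q / p.conjExponent)) ^ (gammaExponent p₀ q₀ * (q₀ - q)) *
      (2 * m) ^ (1 + gammaExponent p₀ q₀ * p.conjExponent * (q₀ - q) / q))
  else
    N ((2 * c * (1 + q / p.conjExponent)) ^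
        (gammaExponent p₀ q₀ * (q - q₀) / (gammaExponent p₀ q₀ * q - 1)) * (2 * m))

/-! The target norm is linearised by duality. With `Z = Ē^{1/q}` one has `‖g‖_Ē^q = ‖g^q‖_Z`, and
the Lorentz–Luxemburg theorem (`IsBFS.le_of_forall_lintegral_le`) reduces the claim to bounding `∫
g^q h` by a multiple of `‖h‖_{Z'}` for each `h`. The Rubio de Francia series of `M` on `Z'`
(`exists_A1_majorant_dual`) replaces `h` by a weight `w ≥ h` with `‖w‖_{Z'} ≤ 2‖h‖_{Z'}` and `M w ≤
2‖M‖ w`. What is then needed is a single inequality from `L^p(w^{p/q})` to `L^q(w)` for this `A₁`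
weight. Afterwards Hölder's inequality between `E^{1/p}` and its dual, together with the assumed
identity of the dual norms, turns `∫ f^p w^{p/q}` into `‖f‖_E^p` times a power of `‖w‖_{Z'}`. The
factor 4 is 2 from the extrapolation times 2 from the majorant in `Z'`.

The weighted inequality is off-diagonal extrapolation from `(p₀, q₀)` to `(p, q)`, needed only for
`A₁` weights (`extrapolate`). Put `r = γq = 1 + q/p'`. If `q < q₀`, an `A₁` majorant `u` of a power
of `f`, built by iterating `M` on `L^r(w)`, gives the test weight `w u^{-e}`, which lies in the
required class by the easy half of the factorisation theorem (`extrapolate_down`). If `q > q₀`,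
iterating `φ ↦ M(φw)/w` on `L^{r'}(w)` gives a majorant `v` of a power of `g` with `vw ∈ A₁`, and
the test weight is `v^s w`, a geometric mean of `vw` and `w` (`extrapolate_up`). In both cases
Hölder's inequality transfers the hypothesis at `(p₀, q₀)` to `(p, q)`.

The explicit constants come from two operator bounds. For `w ∈ A₁` with constant `a`, `M` on
`L^r(w)` costs `c̄ r a^{1/(r-1)}` when `a ≥ 2`; this follows from the weighted weak type inequality
by dyadic interpolation. The operator `φ ↦ M(φw)/w` on `L^{r'}(w)` costs `c̄ r a`; this linear bound
rests on the quantitative self-improvement `w^{1+ε} ∈ A₁` with `ε` of order `1/a` (`A1With.rpow`).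
Since `M f` need not be measurable in general, both bounds are stated for measurable majorants of
the maximal function. -/

namespace HomogeneousSpace

variable {X : Type*} [MeasurableSpace X] (S : HomogeneousSpace X)

/-! ### Quasi-metric balls and the growth of their measure. -/

section Balls

lemma mem_ball {x y : X} {r : ℝ} : y ∈ S.ball x r ↔ S.d x y < r := Iff.rfl

lemma d_self (x : X) : S.d x x = 0 := (S.d_eq_zero_iff x x).2 rfl

lemma mem_ball_self {x : X} {r : ℝ} (hr : 0 < r) : x ∈ S.ball x r := by
  rw [mem_ball, d_self]; exact hr

lemma measurableSet_ball' (x : X) (r : ℝ) : MeasurableSet (S.ball x r) := S.measurableSet_ball x r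

lemma measure_ball_ne_top (x : X) (r : ℝ) : S.μ (S.ball x r) ≠ ∞ := (S.measure_ball_lt_top x r).ne

lemma measure_ball_ne_zero (x : X) {r : ℝ} (hr : 0 < r) : S.μ (S.ball x r) ≠ 0 :=
  (S.measure_ball_pos x r hr).ne'

lemma ball_mono (x : X) {r s : ℝ} (h : r ≤ s) : S.ball x r ⊆ S.ball x s :=
  fun _ hy => lt_of_lt_of_le hy h

lemma κ_pos : 0 < S.κ := zero_lt_one.trans_le S.one_le_κ

lemma ball_subset_of_d_le {x y : X} {r s : ℝ} (h : S.d y x ≤ s) :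
    S.ball x r ⊆ S.ball y (S.κ * (s + r)) := by
  intro z hz
  have hz' : S.d x z < r := hz
  refine (S.d_triangle y z x).trans_lt ?_
  exact mul_lt_mul_of_pos_left (by linarith) S.κ_pos

/-- The enlargement factor of the covering lemma. -/
noncomputable def enlarge : ℝ := 4 * S.κ ^ 2 + S.κ

lemma two_le_enlarge : 2 ≤ S.enlarge := by
  have := S.one_le_κ
  unfold enlarge; nlinarith

/-- Two meeting balls: the one with radius at most twice the other lies in its enlargement. -/
lemma ball_subset_enlarge {x y : X} {r s : ℝ} (hne : (S.ball x r ∩ S.ball y s).Nonempty)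
    (h : r ≤ 2 * s) : S.ball x r ⊆ S.ball y (S.enlarge * s) := by
  obtain ⟨z, hzx, hzy⟩ := hne
  intro t ht
  rw [mem_ball] at *
  have hκ := S.one_le_κ
  have h1 := S.d_triangle y t z
  have h2 := S.d_triangle z t x
  rw [S.d_symm z x] at h2
  have h3 : S.d z t < S.κ * (4 * s) := by
    refine h2.trans_lt ?_
    have := S.κ_pos
    gcongr
    linarith
  have h4 : S.κ * (S.d y z + S.d z t) < S.κ * (s + S.κ * (4 * s)) := by
    have := S.κ_pos
    gcongr
  unfold enlarge
  nlinarith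

lemma iUnion_ball_nat (x : X) : ⋃ n : ℕ, S.ball x n = Set.univ := by
  refine Set.eq_univ_of_forall fun y => ?_
  obtain ⟨n, hn⟩ := exists_nat_gt (S.d x y)
  exact Set.mem_iUnion.2 ⟨n, hn⟩

instance sigmaFinite : SigmaFinite S.μ := by
  rcases isEmpty_or_nonempty X with h | ⟨⟨x⟩⟩
  · have : S.μ = 0 := Measure.eq_zero_of_isEmpty _
    rw [this]; infer_instance
  · exact ⟨⟨⟨fun n => S.ball x n, fun _ => trivial, fun n => S.measure_ball_lt_top x n,
      S.iUnion_ball_nat x⟩⟩⟩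

/-- A bound for the measure of a ball dilated by `t`. -/
noncomputable def dil (t : ℝ) : ℝ≥0 := Real.toNNReal ((2 * t) ^ S.D)

/-- Doubling supplies `D` as a factor per doubling step, whereas `c̄` uses `D` as an exponent. This
comparison converts `D^k` into `(2^k)^D`, so that dilation by `t` costs `(2t)^D`. For `D ≥ 1` it is
Bernoulli's inequality. -/
lemma D_le : S.D ≤ 2 ^ S.D := by
  rcases le_total S.D 1 with h | h
  · exact h.trans (Real.one_le_rpow (by norm_num) S.D_pos.le)
  · have := one_add_mul_self_le_rpow_one_add (s := 1) (by norm_num) h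
    norm_num at this
    linarith

lemma measure_ball_two_pow_mul_le (x : X) {r : ℝ} (hr : 0 < r) (k : ℕ) :
    S.μ (S.ball x (2 ^ k * r)) ≤ ENNReal.ofReal S.D ^ k * S.μ (S.ball x r) := by
  induction k with
  | zero => simp
  | succ k ih =>
    have h := S.doubling x (2 ^ k * r) (by positivity)
    rw [pow_succ', pow_succ', mul_assoc, mul_assoc]
    exact h.trans (by gcongr; exact ih)

lemma measure_ball_mul_le (x : X) {r t : ℝ} (hr : 0 < r) (ht : 1 ≤ t) :
    S.μ (S.ball x (t * r)) ≤ S.dil t * S.μ (S.ball x r) := by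
  obtain ⟨n, hn1, hn2⟩ := exists_nat_pow_near ht (one_lt_two)
  calc S.μ (S.ball x (t * r)) ≤ S.μ (S.ball x (2 ^ (n + 1) * r)) :=
        measure_mono (S.ball_mono x (by gcongr))
    _ ≤ ENNReal.ofReal S.D ^ (n + 1) * S.μ (S.ball x r) :=
        S.measure_ball_two_pow_mul_le x hr _
    _ ≤ S.dil t * S.μ (S.ball x r) := by
        gcongr
        rw [← ENNReal.ofReal_pow S.D_pos.le]
        change _ ≤ ENNReal.ofReal _
        apply ENNReal.ofReal_le_ofReal
        calc S.D ^ (n + 1) ≤ (2 ^ S.D) ^ (n + 1) := by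
              have := S.D_pos; have := S.D_le; gcongr
          _ = ((2:ℝ) ^ (n + 1)) ^ S.D := by
              rw [← Real.rpow_natCast, ← Real.rpow_natCast, ← Real.rpow_mul (by norm_num),
                ← Real.rpow_mul (by norm_num), mul_comm]
          _ ≤ (2 * t) ^ S.D := by
              have := S.D_pos
              gcongr
              rw [pow_succ']; gcongr

lemma one_le_dil {t : ℝ} (ht : 1 ≤ t) : 1 ≤ S.dil t := by
  unfold dil
  rw [← NNReal.coe_le_coe, Real.coe_toNNReal _ (by positivity)]
  exact Real.one_le_rpow (by linarith) S.D_pos.le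

end Balls

/-! ### Averages over balls and the maximal function. -/

section Averages

/-- Normalised measure on a ball. -/
noncomputable def ballMeasure (c : X) (r : ℝ) : Measure X :=
  (S.μ (S.ball c r))⁻¹ • S.μ.restrict (S.ball c r)

lemma avg_eq (f : X → ℝ≥0∞) (c : X) (r : ℝ) : S.avg f c r = ∫⁻ x, f x ∂S.ballMeasure c r := by
  rw [ballMeasure, lintegral_smul_measure]; rfl

lemma isProbabilityMeasure_ballMeasure (c : X) {r : ℝ} (hr : 0 < r) :
    IsProbabilityMeasure (S.ballMeasure c r) := by
  constructor
  rw [ballMeasure, Measure.smul_apply, Measure.restrict_apply_univ, smul_eq_mul]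
  exact ENNReal.inv_mul_cancel (S.measure_ball_ne_zero c hr) (S.measure_ball_ne_top c r)

lemma ballMeasure_absolutelyContinuous (c : X) (r : ℝ) : S.ballMeasure c r ≪ S.μ :=
  (Measure.smul_absolutelyContinuous).trans Measure.restrict_le_self.absolutelyContinuous

lemma ae_ballMeasure_mem (c : X) (r : ℝ) : ∀ᵐ x ∂S.ballMeasure c r, x ∈ S.ball c r :=
  Measure.smul_absolutelyContinuous.ae_le (ae_restrict_mem (S.measurableSet_ball' c r))

lemma _root_.AEMeasurable.ballMeasure {S : HomogeneousSpace X} {f : X → ℝ≥0∞}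
    (hf : AEMeasurable f S.μ) (c : X) (r : ℝ) : AEMeasurable f (S.ballMeasure c r) :=
  hf.mono_ac (S.ballMeasure_absolutelyContinuous c r)

lemma measure_mul_avg (f : X → ℝ≥0∞) (c : X) {r : ℝ} (hr : 0 < r) :
    S.μ (S.ball c r) * S.avg f c r = ∫⁻ x in S.ball c r, f x ∂S.μ := by
  unfold avg
  rw [← mul_assoc, ENNReal.mul_inv_cancel (S.measure_ball_ne_zero c hr) (S.measure_ball_ne_top c r),
    one_mul]

lemma avg_le_maximal (f : X → ℝ≥0∞) {c x : X} {r : ℝ} (hr : 0 < r) (hx : x ∈ S.ball c r) :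
    S.avg f c r ≤ S.maximal f x :=
  le_iSup_of_le c <| le_iSup_of_le r <| le_iSup_of_le hr <| le_iSup_of_le hx le_rfl

variable {S} in
lemma maximal_le {f : X → ℝ≥0∞} {x : X} {b : ℝ≥0∞}
    (h : ∀ c r, 0 < r → x ∈ S.ball c r → S.avg f c r ≤ b) : S.maximal f x ≤ b :=
  iSup_le fun c => iSup_le fun r => iSup_le fun hr => iSup_le fun hx => h c r hr hx

variable {S} in
lemma lt_maximal_iff {f : X → ℝ≥0∞} {x : X} {b : ℝ≥0∞} :
    b < S.maximal f x ↔ ∃ c r, 0 < r ∧ x ∈ S.ball c r ∧ b < S.avg f c r := by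
  simp only [maximal, lt_iSup_iff, exists_prop]

lemma avg_mono_ae {f g : X → ℝ≥0∞} (h : ∀ᵐ x ∂S.μ, f x ≤ g x) (c : X) (r : ℝ) :
    S.avg f c r ≤ S.avg g c r := by
  simp only [avg_eq]
  exact lintegral_mono_ae ((S.ballMeasure_absolutelyContinuous c r).ae_le h)

lemma maximal_mono_ae {f g : X → ℝ≥0∞} (h : ∀ᵐ x ∂S.μ, f x ≤ g x) (x : X) :
    S.maximal f x ≤ S.maximal g x :=
  maximal_le fun c r hr hx => (S.avg_mono_ae h c r).trans (S.avg_le_maximal g hr hx)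

/-- Countable subadditivity, at every point, is what lets `M` be applied term by term to a Rubio de
Francia series. -/
lemma maximal_tsum_le {f : ℕ → X → ℝ≥0∞} (hf : ∀ k, AEMeasurable (f k) S.μ) (x : X) :
    S.maximal (fun y => ∑' k, f k y) x ≤ ∑' k, S.maximal (f k) x := by
  refine maximal_le fun c r hr hx => ?_
  rw [avg_eq, lintegral_tsum fun k => (hf k).ballMeasure c r]
  refine ENNReal.tsum_le_tsum fun k => ?_
  rw [← avg_eq]
  exact S.avg_le_maximal _ hr hx

lemma maximal_add_le {f g : X → ℝ≥0∞} (hf : AEMeasurable f S.μ) (x : X) :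
    S.maximal (fun y => f y + g y) x ≤ S.maximal f x + S.maximal g x := by
  refine maximal_le fun c r hr hx => ?_
  rw [avg_eq, lintegral_add_left' (hf.ballMeasure c r)]
  rw [← avg_eq, ← avg_eq]
  exact add_le_add (S.avg_le_maximal _ hr hx) (S.avg_le_maximal _ hr hx)

lemma avg_const (b : ℝ≥0∞) (c : X) {r : ℝ} (hr : 0 < r) : S.avg (fun _ => b) c r = b := by
  have := S.isProbabilityMeasure_ballMeasure c hr
  rw [avg_eq]; simp

lemma maximal_const_le (b : ℝ≥0∞) (x : X) : S.maximal (fun _ => b) x ≤ b :=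
  maximal_le fun c _ hr _ => (S.avg_const b c hr).le

lemma maximal_const_mul {f : X → ℝ≥0∞} (hf : AEMeasurable f S.μ) (b : ℝ≥0∞) (x : X) :
    S.maximal (fun y => b * f y) x = b * S.maximal f x := by
  simp only [maximal, avg_eq, ENNReal.mul_iSup]
  congr! 8 with c r hr hx
  exact lintegral_const_mul'' _ (hf.ballMeasure c r)

lemma avg_mul_le_rpow {f g : X → ℝ≥0∞} (hf : AEMeasurable f S.μ) (hg : AEMeasurable g S.μ)
    {p q : ℝ} (h : p.HolderConjugate q) (c : X) (r : ℝ) :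
    S.avg (fun x => f x * g x) c r ≤
      (S.avg (fun x => f x ^ p) c r) ^ (1 / p) * (S.avg (fun x => g x ^ q) c r) ^ (1 / q) := by
  simp only [avg_eq]
  exact ENNReal.lintegral_mul_le_Lp_mul_Lq _ h (hf.ballMeasure c r) (hg.ballMeasure c r)

/-- If `M f` vanished at `x`, all averages over balls centred at `x` would vanish, and countably
many of these balls cover the space. The purpose is to show that a non-null function satisfying an
`A₁` condition is positive almost everywhere. -/
lemma maximal_pos {f : X → ℝ≥0∞} (hf : AEMeasurable f S.μ) (h0 : ¬ ∀ᵐ x ∂S.μ, f x = 0) (x : X) :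
    0 < S.maximal f x := by
  by_contra hx
  apply h0
  have hx0 : S.maximal f x = 0 := by simpa using hx
  have h1 : ∀ n : ℕ, ∀ᵐ y ∂S.μ, y ∈ S.ball x n → f y = 0 := by
    intro n
    rcases Nat.eq_zero_or_pos n with rfl | hn
    · refine Filter.Eventually.of_forall fun y hy => ?_
      rw [mem_ball] at hy
      exact absurd hy (by simpa using S.d_nonneg x y)
    · have hn' : (0:ℝ) < n := by exact_mod_cast hn
      have h2 : S.avg f x n = 0 :=
        le_antisymm ((S.avg_le_maximal f hn' (S.mem_ball_self hn')).trans hx0.le) zero_le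
      have h3 := S.measure_mul_avg f x hn'
      rw [h2, mul_zero] at h3
      have h4 := (lintegral_eq_zero_iff' hf.restrict).1 h3.symm
      exact (ae_restrict_iff' (S.measurableSet_ball' x n)).1 h4
  filter_upwards [ae_all_iff.2 h1] with y hy
  have : y ∈ ⋃ n : ℕ, S.ball x n := by rw [iUnion_ball_nat]; trivial
  obtain ⟨n, hn⟩ := Set.mem_iUnion.1 this
  exact hy n hn

end Averages

/-- Jensen's inequality for powers and probability measures. -/
lemma _root_.MeasureTheory.rpow_lintegral_le_lintegral_rpow {α : Type*} [MeasurableSpace α]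
    (ν : Measure α) [IsProbabilityMeasure ν] {f : α → ℝ≥0∞} (hf : AEMeasurable f ν) {s : ℝ}
    (hs : 1 ≤ s) : (∫⁻ x, f x ∂ν) ^ s ≤ ∫⁻ x, f x ^ s ∂ν := by
  rcases hs.eq_or_lt with rfl | hs
  · simp
  have h := ENNReal.lintegral_mul_le_Lp_mul_Lq ν (Real.HolderConjugate.conjExponent hs) hf
    (aemeasurable_const (b := (1 : ℝ≥0∞)))
  simp only [Pi.mul_apply, mul_one, ENNReal.one_rpow, lintegral_const, measure_univ] at h
  calc (∫⁻ x, f x ∂ν) ^ s ≤ ((∫⁻ x, f x ^ s ∂ν) ^ (1 / s)) ^ s := by gcongr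
    _ = ∫⁻ x, f x ^ s ∂ν := by
      rw [← ENNReal.rpow_mul, one_div_mul_cancel (by linarith), ENNReal.rpow_one]

end HomogeneousSpace

/-! ### Vitali covering, weighted weak type and Lebesgue differentiation. -/

namespace HomogeneousSpace

variable {X : Type*} [MeasurableSpace X] (S : HomogeneousSpace X)

/-- Vitali's covering lemma for balls of bounded radii. -/
lemma exists_disjoint_balls (t : Set (X × ℝ)) (R : ℝ) (hpos : ∀ a ∈ t, 0 < a.2)
    (hR : ∀ a ∈ t, a.2 ≤ R) :
    ∃ u ⊆ t, u.Countable ∧ u.PairwiseDisjoint (fun a => S.ball a.1 a.2) ∧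
      ∀ a ∈ t, ∃ b ∈ u, S.ball a.1 a.2 ⊆ S.ball b.1 (S.enlarge * b.2) := by
  obtain ⟨u, hut, hdisj, hu⟩ := Vitali.exists_disjoint_subfamily_covering_enlargement
    (fun a : X × ℝ => S.ball a.1 a.2) t (fun a => a.2) 2 (by norm_num) (fun a ha => (hpos a ha).le)
    R hR (fun a ha => ⟨a.1, S.mem_ball_self (hpos a ha)⟩)
  refine ⟨u, hut, ?_, hdisj, fun a ha => ?_⟩
  -- Disjoint balls of positive measure in a σ-finite space are countable in number, so no
  -- separability of `X` is needed.
  · have hc := Measure.countable_meas_pos_of_disjoint_iUnion (μ := S.μ)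
      (As := fun a : u => S.ball a.1.1 a.1.2) (fun a => S.measurableSet_ball' _ _)
      (fun a b hab => hdisj a.2 b.2 (fun h => hab (Subtype.ext h)))
    have : {i : u | 0 < S.μ (S.ball i.1.1 i.1.2)} = Set.univ :=
      Set.eq_univ_of_forall fun a => S.measure_ball_pos _ _ (hpos _ (hut a.2))
    rw [this] at hc
    exact Set.countable_coe_iff.1 (Set.countable_univ_iff.1 hc)
  · obtain ⟨b, hb, hne, hle⟩ := hu a ha
    exact ⟨b, hb, S.ball_subset_enlarge hne hle⟩

/-- The doubling constant of the covering lemma. -/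
noncomputable def vitaliConst : ℝ≥0 := S.dil S.enlarge

lemma measure_enlarge_le (x : X) {r : ℝ} (hr : 0 < r) :
    S.μ (S.ball x (S.enlarge * r)) ≤ S.vitaliConst * S.μ (S.ball x r) :=
  S.measure_ball_mul_le x hr (by linarith [S.two_le_enlarge])

lemma enlarge_mul_pos {r : ℝ} (hr : 0 < r) : 0 < S.enlarge * r :=
  mul_pos (by linarith [S.two_le_enlarge]) hr

lemma ball_subset_ball_enlarge (x : X) {r : ℝ} (hr : 0 < r) :
    S.ball x r ⊆ S.ball x (S.enlarge * r) :=
  S.ball_mono x (by nlinarith [S.two_le_enlarge])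

/-- The `A₁` condition with constant `a`. -/
def A1With (w : X → ℝ≥0∞) (a : ℝ≥0∞) : Prop := ∀ᵐ x ∂S.μ, S.maximal w x ≤ a * w x

-- At almost every point of the smaller ball the average of `w` over the larger ball is at most `M w
-- ≤ a w`. This moves the weight under the integral of `f`.
variable {S} in
lemma A1With.avg_mul_le {w : X → ℝ≥0∞} {a : ℝ≥0∞} (hw : S.A1With w a) (f : X → ℝ≥0∞)
    {c c' : X} {r r' : ℝ} (hr' : 0 < r') (hsub : S.ball c r ⊆ S.ball c' r')
    (hfw : AEMeasurable (fun x => f x * w x) S.μ) (hf : AEMeasurable f S.μ) :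
    S.avg w c' r' * ∫⁻ x in S.ball c r, f x ∂S.μ ≤ a * ∫⁻ x in S.ball c r, f x * w x ∂S.μ := by
  rw [← lintegral_const_mul'' _ hf.restrict, ← lintegral_const_mul'' _ hfw.restrict]
  apply lintegral_mono_ae
  filter_upwards [ae_restrict_of_ae hw, ae_restrict_mem (S.measurableSet_ball' c r)] with x hx hxb
  calc S.avg w c' r' * f x ≤ (a * w x) * f x := by
        gcongr
        exact (S.avg_le_maximal w hr' (hsub hxb)).trans hx
    _ = a * (f x * w x) := by ring

/-- The weighted weak type `(1, 1)` inequality for `A₁` weights, for balls of bounded radii. -/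
lemma weak_type_aux {w : X → ℝ≥0∞} {a : ℝ≥0∞} (hw : S.A1With w a)
    (hwm : AEMeasurable w S.μ) {f : X → ℝ≥0∞} (hf : AEMeasurable f S.μ) (lam : ℝ≥0∞)
    (t : Set (X × ℝ)) (R : ℝ) (hpos : ∀ b ∈ t, 0 < b.2) (hR : ∀ b ∈ t, b.2 ≤ R)
    (ht : ∀ b ∈ t, lam ≤ S.avg f b.1 b.2) :
    lam * S.μ.withDensity w (⋃ b ∈ t, S.ball b.1 b.2) ≤
      S.vitaliConst * a * ∫⁻ x, f x * w x ∂S.μ := by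
  obtain ⟨u, hut, hc, hdisj, hcov⟩ := S.exists_disjoint_balls t R hpos hR
  -- The enlarged ball has `w`-mass equal to its measure times the mean of `w`. Doubling brings the
  -- measure back to the selected ball, the bound on `lam` brings in the mean of `f` there, and the
  -- `A₁` condition absorbs the mean of `w` into the integral.
  have key : ∀ b ∈ u, lam * S.μ.withDensity w (S.ball b.1 (S.enlarge * b.2)) ≤
      S.vitaliConst * a * ∫⁻ x in S.ball b.1 b.2, f x * w x ∂S.μ := by
    intro b hb
    have hb0 := hpos b (hut hb)
    rw [withDensity_apply _ (S.measurableSet_ball' _ _),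
      ← S.measure_mul_avg w b.1 (S.enlarge_mul_pos hb0)]
    calc lam * (S.μ (S.ball b.1 (S.enlarge * b.2)) * S.avg w b.1 (S.enlarge * b.2))
        ≤ S.avg f b.1 b.2 * ((S.vitaliConst * S.μ (S.ball b.1 b.2)) *
            S.avg w b.1 (S.enlarge * b.2)) := by
          gcongr
          · exact ht b (hut hb)
          · exact S.measure_enlarge_le _ hb0
      _ = S.vitaliConst * (S.avg w b.1 (S.enlarge * b.2) *
            (S.μ (S.ball b.1 b.2) * S.avg f b.1 b.2)) := by ring
      _ ≤ S.vitaliConst * (a * ∫⁻ x in S.ball b.1 b.2, f x * w x ∂S.μ) := by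
          rw [S.measure_mul_avg f b.1 hb0]
          exact mul_le_mul_right (hw.avg_mul_le f (S.enlarge_mul_pos hb0)
            (S.ball_subset_ball_enlarge _ hb0) (hf.mul hwm) hf) _
      _ = _ := by ring
  have : Countable u := hc
  calc lam * S.μ.withDensity w (⋃ b ∈ t, S.ball b.1 b.2)
      ≤ lam * S.μ.withDensity w (⋃ b : u, S.ball b.1.1 (S.enlarge * b.1.2)) := by
        gcongr
        refine Set.iUnion₂_subset fun b hb => ?_
        obtain ⟨b', hb', h⟩ := hcov b hb
        exact h.trans (Set.subset_iUnion (fun b : u => S.ball b.1.1 (S.enlarge * b.1.2)) ⟨b', hb'⟩)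
    _ ≤ lam * ∑' b : u, S.μ.withDensity w (S.ball b.1.1 (S.enlarge * b.1.2)) := by
        gcongr; exact measure_iUnion_le _
    _ = ∑' b : u, lam * S.μ.withDensity w (S.ball b.1.1 (S.enlarge * b.1.2)) :=
        ENNReal.tsum_mul_left.symm
    _ ≤ ∑' b : u, S.vitaliConst * a * ∫⁻ x in S.ball b.1.1 b.1.2, f x * w x ∂S.μ :=
        ENNReal.tsum_le_tsum fun b => key b.1 b.2
    _ = S.vitaliConst * a * ∫⁻ x in ⋃ b : u, S.ball b.1.1 b.1.2, f x * w x ∂S.μ := by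
        rw [ENNReal.tsum_mul_left, lintegral_iUnion (fun b : u => S.measurableSet_ball' _ _)
          (fun b c hbc => hdisj b.2 c.2 (fun h => hbc (Subtype.ext h)))]
    _ ≤ _ := mul_le_mul_right (setLIntegral_le_lintegral _ _) _

/-- The weighted weak type `(1, 1)` inequality for `A₁` weights. -/
lemma weak_type {w : X → ℝ≥0∞} {a : ℝ≥0∞} (hw : S.A1With w a)
    (hwm : AEMeasurable w S.μ) {f : X → ℝ≥0∞} (hf : AEMeasurable f S.μ) (lam : ℝ≥0∞) :
    lam * S.μ.withDensity w {x | lam < S.maximal f x} ≤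
      S.vitaliConst * a * ∫⁻ x, f x * w x ∂S.μ := by
  -- The covering lemma needs bounded radii, so the level set is exhausted by balls of radius at
  -- most `n`. Continuity of measure along an increasing union needs no measurability of these sets.
  let t : ℕ → Set (X × ℝ) := fun n => {b | 0 < b.2 ∧ b.2 ≤ n ∧ lam < S.avg f b.1 b.2}
  have hset : {x | lam < S.maximal f x} = ⋃ n, ⋃ b ∈ t n, S.ball b.1 b.2 := by
    ext x
    simp only [Set.mem_ofPred_eq, lt_maximal_iff, Set.mem_iUnion, t, exists_prop, Prod.exists]
    constructor
    · rintro ⟨c, r, hr, hx, h⟩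
      obtain ⟨n, hn⟩ := exists_nat_ge r
      exact ⟨n, c, r, ⟨hr, hn, h⟩, hx⟩
    · rintro ⟨n, c, r, ⟨hr, hn, h⟩, hx⟩
      exact ⟨c, r, hr, hx, h⟩
  have hmono : Monotone fun n => ⋃ b ∈ t n, S.ball b.1 b.2 := by
    intro n m hnm
    refine Set.biUnion_subset_biUnion_left fun b hb => ⟨hb.1, hb.2.1.trans ?_, hb.2.2⟩
    exact_mod_cast hnm
  rw [hset, hmono.measure_iUnion, ENNReal.mul_iSup]
  exact iSup_le fun n => S.weak_type_aux hw hwm hf lam (t n) n (fun b hb => hb.1)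
    (fun b hb => hb.2.1) (fun b hb => hb.2.2.le)

lemma A1With_one : S.A1With (fun _ => 1) 1 :=
  Filter.Eventually.of_forall fun x => by simpa using S.maximal_const_le 1 x

lemma weak_type_one {f : X → ℝ≥0∞} (hf : AEMeasurable f S.μ) (lam : ℝ≥0∞) :
    lam * S.μ {x | lam < S.maximal f x} ≤ S.vitaliConst * ∫⁻ x, f x ∂S.μ := by
  simpa using S.weak_type S.A1With_one aemeasurable_const hf lam

/-- Half of Lebesgue's differentiation theorem, for integrable functions. -/
lemma ae_le_iSup_avg_of_integrable {f : X → ℝ≥0∞} (hf : AEMeasurable f S.μ)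
    (hint : ∫⁻ x, f x ∂S.μ ≠ ∞) :
    ∀ᵐ x ∂S.μ, f x ≤ ⨆ (r : ℝ) (_ : 0 < r), S.avg f x r := by
  set m : X → ℝ≥0∞ := fun x => ⨆ (r : ℝ) (_ : 0 < r), S.avg f x r with hm
  have hfin : ∀ᵐ x ∂S.μ, f x < ∞ := ae_lt_top' hf hint
  have key : ∀ η : ℝ≥0, 0 < η → S.μ {x | f x < ∞ ∧ m x + 3 * η < f x} = 0 := by
    intro η hη
    have hη' : (0:ℝ) < η := hη
    have hηE : (η : ℝ≥0∞) ≠ 0 := by simpa using hη.ne'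
    have main : ∀ ε : ℝ≥0, 0 < ε →
        S.μ {x | f x < ∞ ∧ m x + 3 * η < f x} ≤ ε * ((1 + S.vitaliConst) / η) := by
      intro ε hε
      obtain ⟨g, hgc, hgi, hfg⟩ := S.dense_continuous (fun x => (f x).toReal)
        (integrable_toReal_of_lintegral_ne_top hf hint) ε hε
      set k : X → ℝ≥0∞ := fun x => ENNReal.ofReal |(f x).toReal - g x| with hk
      have hkm : AEMeasurable k S.μ :=
        ((hf.ennreal_toReal.sub hgi.aemeasurable).abs).ennreal_ofReal
      have hkint : ∫⁻ x, k x ∂S.μ ≤ ε := by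
        have h := ofReal_integral_eq_lintegral_ofReal
          (((integrable_toReal_of_lintegral_ne_top hf hint).sub hgi).abs)
          (Filter.Eventually.of_forall fun x => abs_nonneg _)
        exact h.symm.le.trans ((ENNReal.ofReal_le_ofReal hfg.le).trans (by simp))
      -- Off the two sets on the right, `f(x) ≤ g(x) + k(x)`, while continuity gives `g(x) ≤ f + k +
      -- η` on a small ball about `x`. Averaging the latter over this ball gives `f(x) ≤ m(x) + 3η`:
      -- one `η` comes from `k(x)`, one from the mean of `k`, one from continuity.
      have hsub : {x | f x < ∞ ∧ m x + 3 * η < f x} ⊆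
          {x | (η : ℝ≥0∞) ≤ k x} ∪ {x | (η : ℝ≥0∞) < S.maximal k x} := by
        rintro x ⟨hx, hmx⟩
        by_contra hcon
        simp only [Set.mem_union, Set.mem_ofPred_eq, not_or, not_le, not_lt] at hcon
        obtain ⟨h1, h2⟩ := hcon
        obtain ⟨δ, hδ, hδ'⟩ := hgc x η hη'
        have h3 : ∀ᵐ y ∂S.ballMeasure x δ, ENNReal.ofReal (g x) ≤ f y + k y + η := by
          filter_upwards [S.ae_ballMeasure_mem x δ,
            (S.ballMeasure_absolutelyContinuous x δ).ae_le hfin] with y hy hyf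
          have h4 := hδ' y hy
          have : g x ≤ (f y).toReal + |(f y).toReal - g y| + η := by
            have := abs_lt.1 h4
            have := neg_abs_le ((f y).toReal - g y)
            linarith
          calc ENNReal.ofReal (g x)
              ≤ ENNReal.ofReal ((f y).toReal + |(f y).toReal - g y| + η) :=
                ENNReal.ofReal_le_ofReal this
            _ = f y + k y + η := by
                rw [ENNReal.ofReal_add (by positivity) (by positivity),
                  ENNReal.ofReal_add (by positivity) (by positivity), ENNReal.ofReal_toReal hyf.ne]
                simp [hk]
        have hprob := S.isProbabilityMeasure_ballMeasure x hδ
        have h5 : ENNReal.ofReal (g x) ≤ m x + η + η := by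
          calc ENNReal.ofReal (g x) = ∫⁻ _, ENNReal.ofReal (g x) ∂S.ballMeasure x δ := by simp
            _ ≤ ∫⁻ y, (f y + k y + η) ∂S.ballMeasure x δ := lintegral_mono_ae h3
            _ = S.avg f x δ + S.avg k x δ + η := by
                rw [lintegral_add_right _ measurable_const,
                  lintegral_add_left' (hf.ballMeasure x δ), avg_eq, avg_eq]
                simp
            _ ≤ m x + η + η := by
                gcongr
                · exact le_iSup₂_of_le δ hδ le_rfl
                · exact (S.avg_le_maximal k hδ (S.mem_ball_self hδ)).trans h2
        have h6 : f x ≤ ENNReal.ofReal (g x) + k x := by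
          rw [← ENNReal.ofReal_toReal hx.ne, hk]
          refine (ENNReal.ofReal_le_ofReal ?_).trans ENNReal.ofReal_add_le
          linarith [le_abs_self ((f x).toReal - g x)]
        have h7 : f x ≤ m x + 3 * η := by
          calc f x ≤ ENNReal.ofReal (g x) + k x := h6
            _ ≤ m x + η + η + η := by gcongr
            _ = m x + 3 * η := by ring
        exact absurd hmx (not_lt.2 h7)
      have hA : S.μ {x | (η : ℝ≥0∞) ≤ k x} ≤ ε / η := by
        rw [ENNReal.le_div_iff_mul_le (Or.inl hηE) (Or.inl ENNReal.coe_ne_top), mul_comm]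
        exact (mul_meas_ge_le_lintegral₀ hkm _).trans hkint
      have hB : S.μ {x | (η : ℝ≥0∞) < S.maximal k x} ≤ S.vitaliConst * ε / η := by
        rw [ENNReal.le_div_iff_mul_le (Or.inl hηE) (Or.inl ENNReal.coe_ne_top), mul_comm]
        exact (S.weak_type_one hkm η).trans (by gcongr)
      calc _ ≤ _ := measure_mono hsub
        _ ≤ _ := measure_union_le _ _
        _ ≤ ε / η + S.vitaliConst * ε / η := add_le_add hA hB
        _ = _ := by simp only [div_eq_mul_inv]; ring
    by_contra h0
    set c : ℝ≥0∞ := (1 + S.vitaliConst) / η with hc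
    have hctop : c ≠ ∞ := ENNReal.div_ne_top (by simp) hηE
    -- The bad set is independent of the approximation, so its measure is bounded by `εc` for every
    -- `ε > 0` with the same `c`.
    have hlim : Filter.Tendsto (fun ε : ℝ≥0 => (ε : ℝ≥0∞) * c) (nhdsWithin 0 (Set.Ioi 0))
        (nhds (0 * c)) := by
      refine ENNReal.Tendsto.mul_const ?_ (Or.inr hctop)
      exact (ENNReal.continuous_coe.tendsto' 0 0 (by simp)).mono_left nhdsWithin_le_nhds
    rw [zero_mul] at hlim
    refine h0 (le_antisymm (ge_of_tendsto hlim ?_) zero_le)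
    filter_upwards [self_mem_nhdsWithin] with ε hε using main ε hε
  have hall : ∀ᵐ x ∂S.μ, ∀ n : ℕ, ¬ (f x < ∞ ∧ m x + 3 * ((1 / (n + 1) : ℝ≥0)) < f x) := by
    refine ae_all_iff.2 fun n => ?_
    rw [ae_iff]
    simpa using key (1 / (n + 1)) (by positivity)
  filter_upwards [hall, hfin] with x hx hxf
  refine ENNReal.le_of_forall_pos_le_add fun ε hε _ => ?_
  obtain ⟨n, hn⟩ := exists_nat_one_div_lt (show (0:ℝ≥0) < ε / 3 by positivity)
  have := hx n
  simp only [hxf, true_and, not_lt] at this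
  refine this.trans ?_
  gcongr
  have h3 : 3 * (1 / ((n:ℝ≥0) + 1)) ≤ ε := by
    calc 3 * (1 / ((n:ℝ≥0) + 1)) ≤ 3 * (ε / 3) := by gcongr
      _ = ε := by field_simp
  exact_mod_cast h3

/-- Half of Lebesgue's differentiation theorem, for locally integrable functions. -/
lemma ae_le_iSup_avg {f : X → ℝ≥0∞} (hf : AEMeasurable f S.μ)
    (hint : ∀ x r, ∫⁻ y in S.ball x r, f y ∂S.μ ≠ ∞) :
    ∀ᵐ x ∂S.μ, f x ≤ ⨆ (r : ℝ) (_ : 0 < r), S.avg f x r := by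
  rcases isEmpty_or_nonempty X with h | ⟨⟨o⟩⟩
  · exact Filter.Eventually.of_forall fun x => h.elim x
  have h1 : ∀ n : ℕ, ∀ᵐ x ∂S.μ, (S.ball o n).indicator f x ≤
      ⨆ (r : ℝ) (_ : 0 < r), S.avg ((S.ball o n).indicator f) x r := fun n =>
    S.ae_le_iSup_avg_of_integrable (hf.indicator (S.measurableSet_ball' o n))
      (by rw [lintegral_indicator (S.measurableSet_ball' o n)]; exact hint o n)
  filter_upwards [ae_all_iff.2 h1] with x hx
  have hxu : x ∈ ⋃ n : ℕ, S.ball o n := by rw [iUnion_ball_nat]; trivial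
  obtain ⟨n, hn⟩ := Set.mem_iUnion.1 hxu
  have := hx n
  rw [Set.indicator_of_mem hn] at this
  refine this.trans (iSup₂_mono fun r hr => S.avg_mono_ae ?_ x r)
  exact Filter.Eventually.of_forall fun y => Set.indicator_le_self _ _ y

end HomogeneousSpace

/-! ### Strong type bounds for `A₁` weights by dyadic interpolation. -/

namespace HomogeneousSpace

variable {X : Type*} [MeasurableSpace X] (S : HomogeneousSpace X)

lemma lintegral_withDensity_eq {w : X → ℝ≥0∞} (hwm : AEMeasurable w S.μ) {f : X → ℝ≥0∞}
    (hf : AEMeasurable f S.μ) :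
    ∫⁻ x, f x ∂S.μ.withDensity w = ∫⁻ x, f x * w x ∂S.μ := by
  rw [lintegral_withDensity_eq_lintegral_mul₀ hwm hf]
  simp [mul_comm]

/-- The weighted weak type inequality, with the function restricted to its large values. -/
lemma weak_type_truncated {w : X → ℝ≥0∞} {a : ℝ≥0∞} (hw : S.A1With w a)
    (hwm : AEMeasurable w S.μ) {f : X → ℝ≥0∞} (hf : AEMeasurable f S.μ) (lam : ℝ≥0∞) :
    (2 * lam) * S.μ.withDensity w {x | 2 * lam < S.maximal f x} ≤
      2 * S.vitaliConst * a * ∫⁻ x, {x | lam < f x}.indicator f x * w x ∂S.μ := by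
  have hset : NullMeasurableSet {x | lam < f x} S.μ := nullMeasurableSet_lt aemeasurable_const hf
  have hg : AEMeasurable ({x | lam < f x}.indicator f) S.μ := hf.indicator₀ hset
  -- The part of `f` below height `lam` contributes at most `lam` to the maximal function, so the
  -- part above must contribute more than `lam`.
  have hsub : {x | 2 * lam < S.maximal f x} ⊆
      {x | lam < S.maximal ({x | lam < f x}.indicator f) x} := by
    intro x hx
    simp only [Set.mem_ofPred_eq] at hx ⊢
    by_contra hcon
    rw [not_lt] at hcon
    refine absurd hx (not_lt.2 ?_)
    calc S.maximal f x ≤ S.maximal (fun y => {x | lam < f x}.indicator f y + lam) x := by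
          refine S.maximal_mono_ae (Filter.Eventually.of_forall fun y => ?_) x
          by_cases hy : lam < f y
          · simp [Set.indicator, hy]
          · simp [Set.indicator, hy, not_lt.1 hy]
      _ ≤ _ := S.maximal_add_le hg x
      _ ≤ lam + lam := add_le_add hcon (S.maximal_const_le _ _)
      _ = 2 * lam := by ring
  calc (2 * lam) * S.μ.withDensity w {x | 2 * lam < S.maximal f x}
      ≤ (2 * lam) * S.μ.withDensity w
        {x | lam < S.maximal ({x | lam < f x}.indicator f) x} :=
          mul_le_mul_right (measure_mono hsub) _
    _ = 2 * (lam * S.μ.withDensity w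
        {x | lam < S.maximal ({x | lam < f x}.indicator f) x}) := by ring
    _ ≤ 2 * (S.vitaliConst * a * ∫⁻ x, {x | lam < f x}.indicator f x * w x ∂S.μ) :=
        mul_le_mul_right (S.weak_type hw hwm hg lam) _
    _ = _ := by ring

/-- The left side is the sum of the geometric series with ratio `2^{-x}`. The bound has the right
order `1/x` as `x → 0` and becomes the factor `s/(s-1)` for `x = s - 1`. It follows from `2^x ≥ 1 +
0.69 x`, since `log 2 > 0.69`. -/
lemma one_sub_two_rpow_inv_le {x : ℝ} (hx : 0 < x) :
    (1 - (2 : ℝ≥0∞) ^ (-x))⁻¹ ≤ ENNReal.ofReal (2 * ((x + 1) / x)) := by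
  have h2 : 1 + x * 0.69 ≤ (2:ℝ) ^ x := by
    rw [Real.rpow_def_of_pos (by norm_num)]
    have := Real.add_one_le_exp (Real.log 2 * x)
    have h3 : x * 0.69 ≤ Real.log 2 * x := by
      rw [mul_comm]; gcongr; linarith [Real.log_two_gt_d9]
    linarith
  have h3 : (2:ℝ) ^ (-x) ≤ 1 - x / (2 * (x + 1)) := by
    rw [Real.rpow_neg (by norm_num), inv_le_comm₀ (by positivity)]
    · refine le_trans ?_ h2
      rw [inv_le_iff_one_le_mul₀]
      · have : (1 - x / (2 * (x + 1))) = (x + 2) / (2 * (x + 1)) := by field_simp; ring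
        rw [this, ← mul_div_assoc, le_div_iff₀ (by positivity)]
        nlinarith
      · have : (1 - x / (2 * (x + 1))) = (x + 2) / (2 * (x + 1)) := by field_simp; ring
        rw [this]; positivity
    · have : (1 - x / (2 * (x + 1))) = (x + 2) / (2 * (x + 1)) := by field_simp; ring
      rw [this]; positivity
  have h4 : (2 : ℝ≥0∞) ^ (-x) = ENNReal.ofReal ((2:ℝ) ^ (-x)) := by
    rw [← ENNReal.ofReal_rpow_of_pos (by norm_num)]; simp
  rw [h4, ← ENNReal.ofReal_one, ← ENNReal.ofReal_sub _ (by positivity),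
    ← ENNReal.ofReal_inv_of_pos]
  · apply ENNReal.ofReal_le_ofReal
    have : 2 * ((x + 1) / x) = (x / (2 * (x + 1)))⁻¹ := by field_simp
    rw [this]
    gcongr
    linarith
  · have : 0 < x / (2 * (x + 1)) := by positivity
    linarith

/-- This is the discrete form of the inner integral in Marcinkiewicz interpolation. The sum is a
geometric series running down from the largest `n` with `2^n < y`, hence comparable to its top term.
-/
lemma tsum_dyadic_le {x : ℝ} (hx : 0 < x) (y : ℝ≥0∞) :
    ∑' k : ℤ, {k : ℤ | (2 : ℝ≥0∞) ^ k < y}.indicator (fun k => (2 : ℝ≥0∞) ^ ((k + 1 : ℤ) * x)) k ≤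
      ENNReal.ofReal (2 * ((x + 1) / x)) * (2 * y) ^ x := by
  have hc : ENNReal.ofReal (2 * ((x + 1) / x)) ≠ 0 := by
    rw [Ne, ENNReal.ofReal_eq_zero, not_le]; positivity
  rcases eq_or_ne y ∞ with rfl | hy
  · rw [ENNReal.mul_top (by norm_num), ENNReal.top_rpow_of_pos hx, ENNReal.mul_top hc]
    exact le_top
  rcases eq_or_ne y 0 with rfl | hy0
  · simp
  obtain ⟨n, hn1, hn2⟩ := ENNReal.exists_mem_Ioc_zpow hy0 hy (y := 2) (by norm_num) (by norm_num)
  have hinj : Function.Injective fun j : ℕ => n - (j : ℤ) := by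
    intro a b h; simpa using h
  rw [← hinj.tsum_eq]
  · calc ∑' j : ℕ, {k : ℤ | (2 : ℝ≥0∞) ^ k < y}.indicator
          (fun k => (2 : ℝ≥0∞) ^ ((k + 1 : ℤ) * x)) (n - j)
        ≤ ∑' j : ℕ, (2 : ℝ≥0∞) ^ ((n + 1 : ℤ) * x) * ((2 : ℝ≥0∞) ^ (-x)) ^ j := by
          refine ENNReal.tsum_le_tsum fun j => (Set.indicator_le_self _ _ _).trans_eq ?_
          rw [← ENNReal.rpow_natCast, ← ENNReal.rpow_mul,
            ← ENNReal.rpow_add _ _ (by norm_num) (by norm_num)]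
          congr 1; push_cast; ring
      _ = (2 : ℝ≥0∞) ^ ((n + 1 : ℤ) * x) * (1 - (2 : ℝ≥0∞) ^ (-x))⁻¹ := by
          rw [ENNReal.tsum_mul_left, ENNReal.tsum_geometric]
      _ ≤ (2 * y) ^ x * ENNReal.ofReal (2 * ((x + 1) / x)) := by
          gcongr
          · rw [ENNReal.rpow_mul, ENNReal.rpow_intCast]
            gcongr
            rw [ENNReal.zpow_add (by norm_num) (by norm_num), zpow_one, mul_comm]
            gcongr
          · exact one_sub_two_rpow_inv_le hx
      _ = _ := mul_comm _ _
  · intro k hk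
    rw [Function.mem_support, Ne, Set.indicator_apply_eq_zero, Classical.not_imp] at hk
    have h1 : (2 : ℝ≥0∞) ^ k < 2 ^ (n + 1) := lt_of_lt_of_le hk.1 hn2
    have h2 : k < n + 1 := by
      by_contra h
      exact absurd h1 (not_lt.2 (ENNReal.zpow_le_of_le (by norm_num) (not_lt.1 h)))
    exact ⟨(n - k).toNat, by simp; omega⟩

/-- The weighted strong type inequality for `A₁` weights; the maximal function, which need not be
measurable, is replaced by a measurable majorant. -/
lemma exists_measurable_maximal_le {w : X → ℝ≥0∞} {a : ℝ≥0∞} (hw : S.A1With w a)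
    (hwm : AEMeasurable w S.μ) {f : X → ℝ≥0∞} (hf : AEMeasurable f S.μ) {s : ℝ} (hs : 1 < s) :
    ∃ T : X → ℝ≥0∞, Measurable T ∧ (∀ x, S.maximal f x ≤ T x) ∧
      ∫⁻ x, T x ^ s * w x ∂S.μ ≤
        ENNReal.ofReal (2 * 4 ^ s * (s / (s - 1))) * S.vitaliConst * a *
          ∫⁻ x, f x ^ s * w x ∂S.μ := by
  set ν := S.μ.withDensity w with hν
  -- The measurable hull of a level set has the same weighted measure, so the weak type bound
  -- survives. The step function `T` built on the hulls is measurable, and it dominates `M f`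
  -- because it takes the upper endpoint `2^(k+1)` of each dyadic range.
  set G : ℤ → Set X := fun k => toMeasurable ν {x | (2 : ℝ≥0∞) ^ k < S.maximal f x} with hG
  have hGm : ∀ k, MeasurableSet (G k) := fun k => measurableSet_toMeasurable _ _
  set T : X → ℝ≥0∞ := fun x => ⨆ k : ℤ, (G k).indicator (fun _ => (2 : ℝ≥0∞) ^ (k + 1)) x with hT
  have hTm : Measurable T := Measurable.iSup fun k => measurable_const.indicator (hGm k)
  have hs0 : 0 < s := by linarith
  have hx0 : 0 < s - 1 := by linarith
  refine ⟨T, hTm, fun x => ?_, ?_⟩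
  · have hmem : ∀ k : ℤ, (2 : ℝ≥0∞) ^ k < S.maximal f x → (2 : ℝ≥0∞) ^ (k + 1) ≤ T x := by
      intro k hk
      refine le_iSup_of_le k ?_
      rw [Set.indicator_of_mem (subset_toMeasurable ν _ hk)]
    rcases eq_or_ne (S.maximal f x) ∞ with h | h
    · rw [h, top_le_iff]; refine ENNReal.eq_top_of_forall_nnreal_le ?_
      intro r
      obtain ⟨n, hn⟩ := pow_unbounded_of_one_lt r (one_lt_two)
      refine le_trans ?_ (hmem n (by
        rw [h, zpow_natCast]; exact ENNReal.pow_lt_top (by simp)))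
      rw [ENNReal.zpow_add (by norm_num) (by norm_num), zpow_one, zpow_natCast]
      calc (r : ℝ≥0∞) ≤ 2 ^ n := by exact_mod_cast hn.le
        _ ≤ 2 ^ n * 2 := le_mul_of_one_le_right' (by norm_num)
    rcases eq_or_ne (S.maximal f x) 0 with h0 | h0
    · rw [h0]; exact zero_le
    obtain ⟨n, hn1, hn2⟩ := ENNReal.exists_mem_Ioc_zpow h0 h (y := 2) (by norm_num) (by norm_num)
    exact hn2.trans (hmem n hn1)
  · have hTs : ∀ x, T x ^ s ≤
        ∑' k : ℤ, (G k).indicator (fun _ => ((2 : ℝ≥0∞) ^ (k + 1)) ^ s) x := by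
      intro x
      rw [← ENNReal.le_rpow_inv_iff hs0]
      refine iSup_le fun k => ?_
      rw [ENNReal.le_rpow_inv_iff hs0]
      refine le_trans ?_ (ENNReal.le_tsum k)
      by_cases hxk : x ∈ G k
      · simp [hxk]
      · simp [hxk, hs0]
    have hset : ∀ lam : ℝ≥0∞, NullMeasurableSet {x | lam < f x} S.μ := fun lam =>
      nullMeasurableSet_lt aemeasurable_const hf
    -- The truncated weak type inequality at height `2^(k-1)` uses one factor `2^k`. The remaining
    -- `2^{k(s-1)}` goes under the integral, where it is summed over `k` pointwise.
    have hterm : ∀ k : ℤ, ((2 : ℝ≥0∞) ^ (k + 1)) ^ s * ν (G k) ≤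
        2 * S.vitaliConst * a * 2 ^ s * ∫⁻ x, {x | (2 : ℝ≥0∞) ^ (k - 1) < f x}.indicator
          (fun _ => (2 : ℝ≥0∞) ^ (k * (s - 1))) x * (f x * w x) ∂S.μ := by
      intro k
      have h1 := S.weak_type_truncated hw hwm hf ((2 : ℝ≥0∞) ^ (k - 1))
      have h2 : (2 : ℝ≥0∞) * 2 ^ (k - 1) = 2 ^ k := by
        rw [mul_comm, ENNReal.zpow_sub (by norm_num) (by norm_num), zpow_one, mul_assoc,
          ENNReal.inv_mul_cancel (by norm_num) (by norm_num), mul_one]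
      rw [h2] at h1
      have h3 : ((2 : ℝ≥0∞) ^ (k + 1)) ^ s = 2 ^ s * 2 ^ (k * (s - 1)) * 2 ^ k := by
        rw [← ENNReal.rpow_intCast, ← ENNReal.rpow_intCast, ← ENNReal.rpow_mul,
          ← ENNReal.rpow_add _ _ (by norm_num) (by norm_num),
          ← ENNReal.rpow_add _ _ (by norm_num) (by norm_num)]
        congr 1; push_cast; ring
      rw [h3, hG]
      simp only [measure_toMeasurable]
      calc 2 ^ s * 2 ^ (k * (s - 1)) * 2 ^ k * ν {x | (2 : ℝ≥0∞) ^ k < S.maximal f x}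
          = 2 ^ s * 2 ^ (k * (s - 1)) *
            (2 ^ k * ν {x | (2 : ℝ≥0∞) ^ k < S.maximal f x}) := by ring
        _ ≤ 2 ^ s * 2 ^ (k * (s - 1)) * _ := mul_le_mul_right h1 _
        _ = 2 * S.vitaliConst * a * 2 ^ s * (2 ^ (k * (s - 1)) *
            ∫⁻ x, {x | (2 : ℝ≥0∞) ^ (k - 1) < f x}.indicator f x * w x ∂S.μ) := by ring
        _ = _ := by
            rw [← lintegral_const_mul'' _ ((hf.indicator₀ (hset _)).fun_mul hwm)]
            congr 2
            ext x
            by_cases hx : (2 : ℝ≥0∞) ^ (k - 1) < f x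
            · simp [Set.indicator, hx]
            · simp [Set.indicator, hx]
    calc ∫⁻ x, T x ^ s * w x ∂S.μ = ∫⁻ x, T x ^ s ∂ν :=
          (S.lintegral_withDensity_eq hwm (hTm.pow_const s).aemeasurable).symm
      _ ≤ ∫⁻ x, ∑' k : ℤ, (G k).indicator (fun _ => ((2 : ℝ≥0∞) ^ (k + 1)) ^ s) x ∂ν :=
          lintegral_mono hTs
      _ = ∑' k : ℤ, ((2 : ℝ≥0∞) ^ (k + 1)) ^ s * ν (G k) := by
          rw [lintegral_tsum fun k => (measurable_const.indicator (hGm k)).aemeasurable]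
          congr! 2 with k
          rw [lintegral_indicator_const (hGm k)]
      _ ≤ ∑' k : ℤ, 2 * S.vitaliConst * a * 2 ^ s *
          ∫⁻ x, {x | (2 : ℝ≥0∞) ^ (k - 1) < f x}.indicator
          (fun _ => (2 : ℝ≥0∞) ^ (k * (s - 1))) x * (f x * w x) ∂S.μ :=
          ENNReal.tsum_le_tsum hterm
      _ = 2 * S.vitaliConst * a * 2 ^ s * ∫⁻ x, ∑' k : ℤ,
          {x | (2 : ℝ≥0∞) ^ (k - 1) < f x}.indicator
          (fun _ => (2 : ℝ≥0∞) ^ (k * (s - 1))) x * (f x * w x) ∂S.μ := by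
          rw [ENNReal.tsum_mul_left, lintegral_tsum]
          exact fun k => (aemeasurable_const.indicator₀ (hset _)).mul (hf.mul hwm)
      _ ≤ 2 * S.vitaliConst * a * 2 ^ s * ∫⁻ x, ENNReal.ofReal (2 * (s / (s - 1))) *
          2 ^ (s - 1) * (f x ^ s * w x) ∂S.μ := by
          refine mul_le_mul_right (lintegral_mono fun x => ?_) _
          simp only
          rw [ENNReal.tsum_mul_right]
          have h1 := tsum_dyadic_le hx0 (f x)
          -- Reindexing by `k + 1` matches the truncation height to the form of the dyadic sum.
          have h2 : ∑' k : ℤ, {x | (2 : ℝ≥0∞) ^ (k - 1) < f x}.indicator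
              (fun _ => (2 : ℝ≥0∞) ^ (k * (s - 1))) x =
              ∑' k : ℤ, {k : ℤ | (2 : ℝ≥0∞) ^ k < f x}.indicator
              (fun k => (2 : ℝ≥0∞) ^ ((k + 1 : ℤ) * (s - 1))) k := by
            rw [← (Equiv.addRight (1 : ℤ)).tsum_eq]
            congr! 2 with k
            simp [Set.indicator]
          rw [h2]
          calc _ ≤ ENNReal.ofReal (2 * ((s - 1 + 1) / (s - 1))) * (2 * f x) ^ (s - 1) *
                (f x * w x) := mul_le_mul_left h1 _
            _ = _ := by
              rw [ENNReal.mul_rpow_of_nonneg _ _ hx0.le]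
              have h5 : f x ^ s = f x ^ (s - 1) * f x := by
                nth_rewrite 3 [← ENNReal.rpow_one (f x)]
                rw [← ENNReal.rpow_add_of_nonneg _ _ hx0.le zero_le_one]
                congr 1; ring
              rw [h5, sub_add_cancel]; ring
      _ = ENNReal.ofReal (2 * 4 ^ s * (s / (s - 1))) * S.vitaliConst * a *
          ∫⁻ x, f x ^ s * w x ∂S.μ := by
          rw [lintegral_const_mul'' _ ((hf.pow_const s).fun_mul hwm)]
          have h4 : ENNReal.ofReal (2 * 4 ^ s * (s / (s - 1))) =
              2 * 2 ^ s * (ENNReal.ofReal (2 * (s / (s - 1))) * 2 ^ (s - 1)) := by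
            have e1 : (2 : ℝ≥0∞) ^ s = ENNReal.ofReal (2 ^ s) := by
              rw [← ENNReal.ofReal_rpow_of_pos (by norm_num)]; simp
            have e2 : (2 : ℝ≥0∞) ^ (s - 1) = ENNReal.ofReal (2 ^ (s - 1)) := by
              rw [← ENNReal.ofReal_rpow_of_pos (by norm_num)]; simp
            have e3 : (2 : ℝ≥0∞) = ENNReal.ofReal 2 := by simp
            have : 0 < s / (s - 1) := by positivity
            rw [e1, e2, e3,← ENNReal.ofReal_mul (by norm_num), ← ENNReal.ofReal_mul (by positivity),
              ← ENNReal.ofReal_mul (by positivity)]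
            congr 1
            rw [Real.rpow_sub (by norm_num), Real.rpow_one,
              show (4:ℝ) = 2 * 2 by norm_num, Real.mul_rpow (by norm_num) (by norm_num)]
            ring
          rw [h4]; ring

end HomogeneousSpace

/-! ### Quantitative self-improvement of `A₁` weights. -/

namespace HomogeneousSpace

variable {X : Type*} [MeasurableSpace X] (S : HomogeneousSpace X)

/-- The dilation factor relating a ball to the region that controls its level sets. -/
noncomputable def halo : ℝ := S.κ * (1 + 2 * S.κ)

lemma one_le_halo : 1 ≤ S.halo := by
  have := S.one_le_κ
  unfold halo; nlinarith

/-- Stopping radius: a point of high average has a ball of high average all of whose substantial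
dilates have low average. -/
lemma exists_stopping_radius {v : X → ℝ≥0∞} {c : X} {R : ℝ} {lam : ℝ≥0∞}
    (hlam : ∀ c' r, 0 < r → S.ball c R ⊆ S.ball c' r → S.avg v c' r ≤ lam) {x : X}
    (hx : x ∈ S.ball c R) (hvx : lam < ⨆ (r : ℝ) (_ : 0 < r), S.avg v x r) :
    ∃ ρ : ℝ, 0 < ρ ∧ ρ ≤ 2 * S.κ * R ∧ lam < S.avg v x ρ ∧ ∀ r, 2 * ρ ≤ r → S.avg v x r ≤ lam := by
  set P : Set ℝ := {ρ | 0 < ρ ∧ lam < S.avg v x ρ} with hP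
  -- A ball about `x` of radius larger than `2κR` contains the whole ball `B(c, R)`, and such balls
  -- have low average by hypothesis.
  have hbound : ∀ ρ ∈ P, ρ ≤ 2 * S.κ * R := by
    rintro ρ ⟨hρ, hρ'⟩
    by_contra hcon
    rw [not_le] at hcon
    refine absurd hρ' (not_lt.2 (hlam x ρ hρ ?_))
    refine (S.ball_subset_of_d_le (s := R) (by rw [S.d_symm]; exact le_of_lt hx)).trans
      (S.ball_mono x ?_)
    linarith
  have hne : P.Nonempty := by
    simp only [lt_iSup_iff] at hvx
    obtain ⟨r, hr, h⟩ := hvx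
    exact ⟨r, hr, h⟩
  have hbdd : BddAbove P := ⟨_, hbound⟩
  obtain ⟨ρ₀, hρ₀⟩ := hne
  have hs : 0 < sSup P := hρ₀.1.trans_le (le_csSup hbdd hρ₀)
  -- The supremum need not be attained. A radius above half of it suffices, since every radius at
  -- least `2ρ` then exceeds the supremum.
  obtain ⟨ρ, hρP, hρ⟩ := exists_lt_of_lt_csSup ⟨ρ₀, hρ₀⟩ (half_lt_self hs)
  refine ⟨ρ, hρP.1, hbound ρ hρP, hρP.2, fun r hr => ?_⟩
  by_contra hcon
  have : r ∈ P := ⟨by linarith [hρP.1], not_le.1 hcon⟩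
  linarith [le_csSup hbdd this]

/-- The level set estimate behind the reverse Hölder inequality. -/
lemma withDensity_level_le {v : X → ℝ≥0∞} {a : ℝ≥0∞} (hv : S.A1With v a)
    (hvm : AEMeasurable v S.μ) (hint : ∀ x r, ∫⁻ y in S.ball x r, v y ∂S.μ ≠ ∞) {c : X} {R : ℝ}
    {lam : ℝ≥0∞}
    (hlam : ∀ c' r, 0 < r → S.ball c R ⊆ S.ball c' r → S.avg v c' r ≤ lam) :
    (S.μ.withDensity v) (S.ball c R ∩ {x | lam < v x}) ≤
      S.vitaliConst * lam * S.μ (S.ball c (S.halo * R) ∩ {x | lam < a * v x}) := by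
  set t : Set (X × ℝ) := {b | b.1 ∈ S.ball c R ∧ 0 < b.2 ∧ b.2 ≤ 2 * S.κ * R ∧
    lam < S.avg v b.1 b.2 ∧ ∀ r, 2 * b.2 ≤ r → S.avg v b.1 r ≤ lam} with ht
  obtain ⟨u, hut, hc, hdisj, hcov⟩ := S.exists_disjoint_balls t (2 * S.κ * R)
    (fun b hb => hb.2.1) (fun b hb => hb.2.2.1)
  have : Countable u := hc
  have hset : NullMeasurableSet {x | lam < a * v x} S.μ :=
    nullMeasurableSet_lt aemeasurable_const (hvm.const_mul a)
  have hsub : ∀ᵐ x ∂S.μ.withDensity v, x ∈ S.ball c R ∩ {x | lam < v x} →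
      x ∈ ⋃ b : u, S.ball b.1.1 (S.enlarge * b.1.2) := by
    refine (withDensity_absolutelyContinuous S.μ v).ae_le ?_
    filter_upwards [S.ae_le_iSup_avg hvm hint] with x hx hxB
    obtain ⟨ρ, h1, h2, h3, h4⟩ := S.exists_stopping_radius hlam hxB.1
      (lt_of_lt_of_le hxB.2 hx)
    obtain ⟨b, hb, hsb⟩ := hcov (x, ρ) ⟨hxB.1, h1, h2, h3, h4⟩
    exact Set.mem_iUnion.2 ⟨⟨b, hb⟩, hsb (S.mem_ball_self h1)⟩
  -- Each selected ball is used twice. Its enlargement has average at most `lam` because the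
  -- enlargement factor is at least 2. Its own average exceeds `lam`, so by the `A₁` condition
  -- almost all of the ball lies in `{a v > lam}`.
  have hterm : ∀ b : u, (S.μ.withDensity v) (S.ball b.1.1 (S.enlarge * b.1.2)) ≤
      S.vitaliConst * lam * S.μ (S.ball b.1.1 b.1.2 ∩ {x | lam < a * v x}) := by
    intro b
    obtain ⟨h0, h1, h2, h3, h4⟩ := hut b.2
    rw [withDensity_apply _ (S.measurableSet_ball' _ _),
      ← S.measure_mul_avg v b.1.1 (S.enlarge_mul_pos h1)]
    have h5 : S.μ (S.ball b.1.1 b.1.2) ≤ S.μ (S.ball b.1.1 b.1.2 ∩ {x | lam < a * v x}) := by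
      apply measure_mono_ae
      filter_upwards [hv] with z hz hzb
      exact ⟨hzb, lt_of_lt_of_le h3 ((S.avg_le_maximal v h1 hzb).trans hz)⟩
    calc S.μ (S.ball b.1.1 (S.enlarge * b.1.2)) * S.avg v b.1.1 (S.enlarge * b.1.2)
        ≤ (S.vitaliConst * S.μ (S.ball b.1.1 b.1.2)) * lam := by
          gcongr
          · exact S.measure_enlarge_le _ h1
          · exact h4 _ (by nlinarith [S.two_le_enlarge])
      _ ≤ (S.vitaliConst * S.μ (S.ball b.1.1 b.1.2 ∩ {x | lam < a * v x})) * lam := by gcongr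
      _ = _ := by ring
  calc (S.μ.withDensity v) (S.ball c R ∩ {x | lam < v x})
      ≤ (S.μ.withDensity v) (⋃ b : u, S.ball b.1.1 (S.enlarge * b.1.2)) := measure_mono_ae hsub
    _ ≤ ∑' b : u, (S.μ.withDensity v) (S.ball b.1.1 (S.enlarge * b.1.2)) := measure_iUnion_le _
    _ ≤ ∑' b : u, S.vitaliConst * lam * S.μ (S.ball b.1.1 b.1.2 ∩ {x | lam < a * v x}) :=
        ENNReal.tsum_le_tsum hterm
    _ = S.vitaliConst * lam *
        S.μ (⋃ b : u, S.ball b.1.1 b.1.2 ∩ {x | lam < a * v x}) := by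
        rw [ENNReal.tsum_mul_left, measure_iUnion₀]
        · intro b b' hbb
          exact ((hdisj b.2 b'.2 (fun h => hbb (Subtype.ext h))).mono Set.inter_subset_left
            Set.inter_subset_left).aedisjoint
        · exact fun b => (S.measurableSet_ball' _ _).nullMeasurableSet.inter hset
    _ ≤ _ := by
        refine mul_le_mul_right (measure_mono ?_) _
        refine Set.iUnion_subset fun b => Set.inter_subset_inter_left _ ?_
        obtain ⟨h0, h1, h2, h3, h4⟩ := hut b.2
        refine (S.ball_subset_of_d_le (le_of_lt h0)).trans (S.ball_mono c ?_)
        have := S.κ_pos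
        calc S.κ * (R + b.1.2) ≤ S.κ * (R + 2 * S.κ * R) := by gcongr
          _ = S.halo * R := by unfold halo; ring

/-- Reverse Hölder estimate on one ball for bounded `A₁` weights. -/
lemma setLIntegral_rpow_le {v : X → ℝ≥0∞} {a : ℝ≥0} (hv : S.A1With v a)
    (hvm : AEMeasurable v S.μ) {u : ℝ≥0} (hu : ∀ x, v x ≤ u) {c : X} {R : ℝ}
    {I : ℝ≥0}
    (hI : ∀ c' r, 0 < r → S.ball c R ⊆ S.ball c' r → S.avg v c' r ≤ I) {ε : ℝ} (hε : 0 < ε) :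
    ∫⁻ x in S.ball c R, v x ^ (1 + ε) ∂S.μ ≤ I ^ ε * ∫⁻ x in S.ball c R, v x ∂S.μ +
      ENNReal.ofReal ε * S.vitaliConst * a ^ (1 + ε) *
        ∫⁻ x in S.ball c (S.halo * R), v x ^ (1 + ε) ∂S.μ := by
  have hfin : ∀ x, v x ≠ ∞ := fun x => ((hu x).trans_lt ENNReal.coe_lt_top).ne
  have hint : ∀ x r, ∫⁻ y in S.ball x r, v y ∂S.μ ≠ ∞ := fun x r =>
    ((lintegral_mono hu).trans_lt (by
      rw [setLIntegral_const]; exact ENNReal.mul_lt_top ENNReal.coe_lt_top (S.measure_ball_lt_top x r))).ne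
  set ν := (S.μ.withDensity v).restrict (S.ball c R) with hν
  have hνac : ν ≪ S.μ := Measure.restrict_le_self.absolutelyContinuous.trans
    (withDensity_absolutelyContinuous S.μ v)
  set B₂ := S.ball c (S.halo * R) with hB₂
  have hνint : ∀ f : X → ℝ≥0∞, AEMeasurable f S.μ →
      ∫⁻ x, f x ∂ν = ∫⁻ x in S.ball c R, f x * v x ∂S.μ := by
    intro f hf
    rw [hν, restrict_withDensity (S.measurableSet_ball' c R),
      lintegral_withDensity_eq_lintegral_mul₀ hvm.restrict hf.restrict]
    simp [mul_comm]
  have h1 := lintegral_rpow_eq_lintegral_meas_lt_mul ν (f := fun x => (v x).toReal)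
    (Filter.Eventually.of_forall fun x => ENNReal.toReal_nonneg)
    (hvm.ennreal_toReal.mono_ac hνac) hε
  -- The layer-cake formula for the constant `I` packages the heights `t < I`, where no level set
  -- estimate is available. There the bound by the full mass of `ν` is used, and it integrates to
  -- `I^ε` times the mass of the ball.
  have h2 := lintegral_rpow_eq_lintegral_meas_lt_mul ν (f := fun _ => (I : ℝ))
    (Filter.Eventually.of_forall fun x => I.2) aemeasurable_const hε
  have h3 := lintegral_rpow_eq_lintegral_meas_lt_mul (S.μ.restrict B₂)
    (f := fun x => (a * v x).toReal)
    (Filter.Eventually.of_forall fun x => ENNReal.toReal_nonneg)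
    ((hvm.const_mul _).ennreal_toReal.restrict) (show 0 < 1 + ε by linarith)
  have e1 : ∫⁻ x, ENNReal.ofReal ((v x).toReal ^ ε) ∂ν =
      ∫⁻ x in S.ball c R, v x ^ (1 + ε) ∂S.μ := by
    rw [hνint _ (hvm.ennreal_toReal.pow_const ε).ennreal_ofReal]
    refine lintegral_congr fun x => ?_
    rw [← ENNReal.ofReal_rpow_of_nonneg ENNReal.toReal_nonneg hε.le, ENNReal.ofReal_toReal (hfin x),
      add_comm, ENNReal.rpow_add_of_nonneg _ _ hε.le zero_le_one, ENNReal.rpow_one]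
  have e2 : ∫⁻ _, ENNReal.ofReal ((I : ℝ) ^ ε) ∂ν = I ^ ε * ∫⁻ x in S.ball c R, v x ∂S.μ := by
    rw [hνint _ aemeasurable_const, lintegral_const_mul'' _ hvm.restrict,
      ← ENNReal.ofReal_rpow_of_nonneg (NNReal.coe_nonneg I) hε.le, ENNReal.ofReal_coe_nnreal]
  have e3 : ∫⁻ x in B₂, ENNReal.ofReal ((a * v x).toReal ^ (1 + ε)) ∂S.μ =
      a ^ (1 + ε) * ∫⁻ x in B₂, v x ^ (1 + ε) ∂S.μ := by
    rw [← lintegral_const_mul'' _ (hvm.pow_const _).restrict]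
    refine lintegral_congr fun x => ?_
    rw [← ENNReal.ofReal_rpow_of_nonneg ENNReal.toReal_nonneg (by linarith),
      ENNReal.ofReal_toReal (ENNReal.mul_ne_top ENNReal.coe_ne_top (hfin x)),
      ENNReal.mul_rpow_of_nonneg _ _ (by linarith)]
  have hpt : ∀ t : ℝ, 0 < t → ν {x | t < (v x).toReal} ≤
      ν {x : X | t < (I : ℝ)} + S.vitaliConst * ENNReal.ofReal t *
        (S.μ.restrict B₂) {x | t < (a * v x).toReal} := by
    intro t ht
    by_cases htI : t < I
    · exact le_add_right (measure_mono fun x _ => htI)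
    · refine le_add_left ?_
      have hIt : (I : ℝ≥0∞) ≤ ENNReal.ofReal t := by
        rw [← ENNReal.ofReal_coe_nnreal]; exact ENNReal.ofReal_le_ofReal (not_lt.1 htI)
      have h4 := S.withDensity_level_le hv hvm hint
        (fun c' r hr h => (hI c' r hr h).trans hIt)
      have s1 : {x | t < (v x).toReal} = {x | ENNReal.ofReal t < v x} := by
        ext x
        exact (ENNReal.ofReal_lt_iff_lt_toReal ht.le (hfin x)).symm
      have s2 : {x | t < (a * v x).toReal} = {x | ENNReal.ofReal t < a * v x} := by
        ext x
        exact (ENNReal.ofReal_lt_iff_lt_toReal ht.le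
          (ENNReal.mul_ne_top ENNReal.coe_ne_top (hfin x))).symm
      rw [s1, s2, hν, Measure.restrict_apply' (S.measurableSet_ball' _ _),
        Measure.restrict_apply' (S.measurableSet_ball' _ _), Set.inter_comm,
        Set.inter_comm {x | ENNReal.ofReal t < a * v x}]
      exact h4
  rw [← e1, h1, ← e2, h2]
  have hmeas : ∀ (m : Measure X) (f : X → ℝ), Measurable fun t : ℝ => m {x | t < f x} := by
    intro m f
    refine Antitone.measurable fun s t hst => measure_mono fun x hx => ?_
    exact lt_of_le_of_lt hst hx
  have hpow : ∀ r : ℝ, Measurable fun t : ℝ => ENNReal.ofReal (t ^ r) := fun r =>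
    (measurable_id.pow_const r).ennreal_ofReal
  calc ENNReal.ofReal ε * ∫⁻ t in Set.Ioi 0, ν {x | t < (v x).toReal} * ENNReal.ofReal (t ^ (ε - 1))
      ≤ ENNReal.ofReal ε * ∫⁻ t in Set.Ioi 0,
          (ν {x : X | t < (I : ℝ)} * ENNReal.ofReal (t ^ (ε - 1)) + S.vitaliConst *
          ((S.μ.restrict B₂) {x | t < (a * v x).toReal} * ENNReal.ofReal (t ^ (1 + ε - 1)))) := by
        refine mul_le_mul_right (setLIntegral_mono' measurableSet_Ioi fun t ht => ?_) _
        have ht' : (0 : ℝ) < t := ht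
        calc _ ≤ _ := mul_le_mul_left (hpt t ht') _
          _ = _ := by
            have : ENNReal.ofReal (t ^ (1 + ε - 1)) =
                ENNReal.ofReal t * ENNReal.ofReal (t ^ (ε - 1)) := by
              rw [← ENNReal.ofReal_mul ht'.le]
              congr 1
              rw [← Real.rpow_one_add' ht'.le (by linarith)]
              congr 1; ring
            rw [this]; ring
    _ = ENNReal.ofReal ε *
          (∫⁻ t in Set.Ioi 0, ν {x : X | t < (I : ℝ)} * ENNReal.ofReal (t ^ (ε - 1)))
        + ENNReal.ofReal ε * S.vitaliConst * ∫⁻ t in Set.Ioi 0,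
          ((S.μ.restrict B₂) {x | t < (a * v x).toReal} * ENNReal.ofReal (t ^ (1 + ε - 1))) := by
        rw [lintegral_add_left ((hmeas _ _).fun_mul (hpow _)),
          lintegral_const_mul _ ((hmeas _ _).fun_mul (hpow _))]
        ring
    _ ≤ _ := by
        refine add_le_add le_rfl ?_
        rw [mul_assoc (ENNReal.ofReal ε * (S.vitaliConst : ℝ≥0∞)), ← e3, h3]
        refine mul_le_mul_right ?_ _
        -- The layer-cake formula for the exponent `1 + ε` has the prefactor `1 + ε ≥ 1`, which is
        -- discarded.
        refine le_mul_of_one_le_left' ?_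
        rw [ENNReal.one_le_ofReal]; linarith

/-- Self-improvement of bounded `A₁` weights. -/
lemma A1With.rpow_of_bounded {v : X → ℝ≥0∞} {a : ℝ≥0} (hv : S.A1With v a)
    (hvm : AEMeasurable v S.μ) {u : ℝ≥0} (hu : ∀ x, v x ≤ u) {ε : ℝ} (hε : 0 < ε)
    (hsmall : ENNReal.ofReal ε * S.vitaliConst * a ^ (1 + ε) * S.dil S.halo ≤ 1 / 2) :
    S.A1With (fun x => v x ^ (1 + ε)) (2 * a ^ (1 + ε)) := by
  filter_upwards [hv] with y hy
  have hIu : S.maximal v y ≤ u :=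
    (S.maximal_mono_ae (Filter.Eventually.of_forall hu) y).trans (S.maximal_const_le _ _)
  obtain ⟨I, hI⟩ : ∃ I : ℝ≥0, (I : ℝ≥0∞) = S.maximal v y :=
    ⟨_, ENNReal.coe_toNNReal (hIu.trans_lt ENNReal.coe_lt_top).ne⟩
  set Z := S.maximal (fun x => v x ^ (1 + ε)) y with hZ
  -- Boundedness of the weight is used here: finiteness of `Z` permits the term `Z/2` to be absorbed
  -- below.
  have hZtop : Z ≠ ∞ := by
    refine ((S.maximal_mono_ae (g := fun _ => (u : ℝ≥0∞) ^ (1 + ε))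
      (Filter.Eventually.of_forall fun x => ?_) y).trans_lt
      ((S.maximal_const_le _ _).trans_lt ?_)).ne
    · exact ENNReal.rpow_le_rpow (hu x) (by linarith)
    · exact ENNReal.rpow_lt_top_of_nonneg (by linarith) ENNReal.coe_ne_top
  -- The estimate on a ball involves its larger halo, so it cannot be closed on a single ball. The
  -- halo also contains `y`, so its average is again at most `Z`. Comparing the measures of the halo
  -- and the ball gives the factor `dil halo` in the smallness condition.
  have hZle : Z ≤ (I : ℝ≥0∞) ^ (1 + ε) + 1 / 2 * Z := by
    refine maximal_le fun c R hR hyB => ?_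
    have h1 := S.setLIntegral_rpow_le hv hvm hu (I := I) (fun c' r hr h => by
      rw [hI]; exact S.avg_le_maximal v hr (h hyB)) hε
    have hB0 := S.measure_ball_ne_zero c hR
    have hBt := S.measure_ball_ne_top c R
    have hR2 : 0 < S.halo * R := mul_pos (by linarith [S.one_le_halo]) hR
    have hyB2 : y ∈ S.ball c (S.halo * R) := S.ball_mono c (by nlinarith [S.one_le_halo]) hyB
    rw [← S.measure_mul_avg _ c hR, ← S.measure_mul_avg _ c hR, ← S.measure_mul_avg _ c hR2] at h1
    rw [← ENNReal.mul_le_mul_iff_right hB0 hBt]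
    refine h1.trans ?_
    calc _ ≤ (I : ℝ≥0∞) ^ ε * (S.μ (S.ball c R) * I) +
          ENNReal.ofReal ε * S.vitaliConst * a ^ (1 + ε) *
            ((S.dil S.halo * S.μ (S.ball c R)) * Z) := by
          gcongr
          · rw [hI]; exact S.avg_le_maximal v hR hyB
          · exact S.measure_ball_mul_le c hR S.one_le_halo
          · exact S.avg_le_maximal (fun x => v x ^ (1 + ε)) hR2 hyB2
      _ = S.μ (S.ball c R) * ((I : ℝ≥0∞) ^ ε * I + (ENNReal.ofReal ε * S.vitaliConst * a ^ (1 + ε) *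
            S.dil S.halo) * Z) := by ring
      _ ≤ S.μ (S.ball c R) * ((I : ℝ≥0∞) ^ (1 + ε) + 1 / 2 * Z) := by
          gcongr
          rw [add_comm 1 ε, ENNReal.rpow_add_of_nonneg _ _ hε.le zero_le_one, ENNReal.rpow_one]
  have hZ2 : Z ≤ 2 * (I : ℝ≥0∞) ^ (1 + ε) := by
    have hhalf : Z = 1 / 2 * Z + 1 / 2 * Z := by
      rw [← add_mul, ENNReal.add_halves, one_mul]
    have hne : 1 / 2 * Z ≠ ∞ := ENNReal.mul_ne_top (by norm_num) hZtop
    have h3 : 1 / 2 * Z ≤ (I : ℝ≥0∞) ^ (1 + ε) := by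
      refine (ENNReal.add_le_add_iff_right hne).1 ?_
      rw [← hhalf]; exact hZle
    calc Z = 2 * (1 / 2 * Z) := by
          rw [← mul_assoc, one_div, ENNReal.mul_inv_cancel (by norm_num) (by norm_num), one_mul]
      _ ≤ _ := by gcongr
  calc Z ≤ 2 * (I : ℝ≥0∞) ^ (1 + ε) := hZ2
    _ ≤ 2 * (a * v y) ^ (1 + ε) := by rw [hI]; gcongr
    _ = 2 * a ^ (1 + ε) * v y ^ (1 + ε) := by
      rw [ENNReal.mul_rpow_of_nonneg _ _ (by linarith), mul_assoc]

-- Truncation preserves the constant because `M` of a minimum is at most the minimum of the maximal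
-- functions, and `M u ≤ u ≤ a u` for the constant `u` when `a ≥ 1`. This reduces self-improvement
-- to bounded weights.
variable {S} in
lemma A1With.min_const {w : X → ℝ≥0∞} {a : ℝ≥0} (hw : S.A1With w a) (ha : 1 ≤ a) (u : ℝ≥0∞) :
    S.A1With (fun x => min (w x) u) a := by
  filter_upwards [hw] with x hx
  have ha' : (1 : ℝ≥0∞) ≤ a := by exact_mod_cast ha
  rw [mul_min]
  refine le_min ((S.maximal_mono_ae (Filter.Eventually.of_forall fun y => min_le_left _ _) x).trans
    hx) ?_
  exact ((S.maximal_mono_ae (Filter.Eventually.of_forall fun y => min_le_right _ _) x).trans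
    (S.maximal_const_le u x)).trans (le_mul_of_one_le_left' ha')

variable {S} in
/-- Self-improvement of `A₁` weights. -/
lemma A1With.rpow {w : X → ℝ≥0∞} {a : ℝ≥0} (hw : S.A1With w a) (ha : 1 ≤ a)
    (hwm : AEMeasurable w S.μ) {ε : ℝ} (hε : 0 < ε)
    (hsmall : ENNReal.ofReal ε * S.vitaliConst * a ^ (1 + ε) * S.dil S.halo ≤ 1 / 2) :
    S.A1With (fun x => w x ^ (1 + ε)) (2 * a ^ (1 + ε)) := by
  have h : ∀ n : ℕ, S.A1With (fun x => min (w x) n ^ (1 + ε)) (2 * a ^ (1 + ε)) := fun n =>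
    A1With.rpow_of_bounded S (u := n) (hw.min_const ha n) (hwm.min aemeasurable_const)
      (fun x => by simp) hε hsmall
  filter_upwards [ae_all_iff.2 h] with y hy
  refine maximal_le fun c R hR hyB => ?_
  -- The bound for truncations is uniform in `n`, so monotone convergence on each ball passes it to
  -- `w`.
  have hsup : ∀ x, w x ^ (1 + ε) = ⨆ n : ℕ, min (w x) n ^ (1 + ε) := by
    intro x
    have h1 : w x = ⨆ n : ℕ, min (w x) n := by
      rw [← inf_iSup_eq, ENNReal.iSup_natCast]; simp
    apply le_antisymm
    · rw [← ENNReal.le_rpow_inv_iff (by linarith)]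
      nth_rewrite 1 [h1]
      refine iSup_le fun n => ?_
      rw [ENNReal.le_rpow_inv_iff (by linarith)]
      exact le_iSup (fun n : ℕ => min (w x) n ^ (1 + ε)) n
    · exact iSup_le fun n => ENNReal.rpow_le_rpow (min_le_left _ _) (by linarith)
  simp_rw [hsup]
  rw [avg_eq, lintegral_iSup']
  · refine iSup_le fun n => ?_
    rw [← avg_eq]
    refine (S.avg_le_maximal _ hR hyB).trans ((hy n).trans ?_)
    rw [← hsup]
    exact mul_le_mul_right (ENNReal.rpow_le_rpow (min_le_left _ _) (by linarith)) _
  · exact fun n => ((hwm.min aemeasurable_const).pow_const _).ballMeasure c R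
  · refine Filter.Eventually.of_forall fun x n m hnm => ?_
    exact ENNReal.rpow_le_rpow (min_le_min le_rfl (by exact_mod_cast hnm)) (by linarith)

end HomogeneousSpace

/-! ### Comparison of the constants with `c̄`. -/

namespace HomogeneousSpace

variable {X : Type*} [MeasurableSpace X] (S : HomogeneousSpace X)

section Constants

lemma coe_vitaliConst : (S.vitaliConst : ℝ) = (2 * S.enlarge) ^ S.D :=
  Real.coe_toNNReal _ (Real.rpow_nonneg (by linarith [S.two_le_enlarge]) _)

lemma coe_dil_halo : (S.dil S.halo : ℝ) = (2 * S.halo) ^ S.D :=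
  Real.coe_toNNReal _ (Real.rpow_nonneg (by linarith [S.one_le_halo]) _)

lemma one_le_vitaliConst : (1 : ℝ) ≤ S.vitaliConst := by
  exact_mod_cast S.one_le_dil (by linarith [S.two_le_enlarge])

lemma one_le_dil_halo : (1 : ℝ) ≤ S.dil S.halo := by exact_mod_cast S.one_le_dil S.one_le_halo

/-- The product of the two dilation constants has base `2θ · 2κ(1 + 2κ) = 4κ²(1 + 2κ)(4κ + 1)`,
which is at most the base of `τ`. The factor `κ^D ≥ 1` in `c̄` is slack. -/
lemma const_le_cbar :
    32 * S.vitaliConst * (1 + 6 * (S.vitaliConst * S.dil S.halo)) ≤ S.cbar := by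
  have hκ := S.one_le_κ
  have hκ0 := S.κ_pos
  have hD := S.D_pos
  have h1 : (S.vitaliConst * S.dil S.halo : ℝ) ≤ (32 * S.κ ^ 4 * (4 * S.κ + 1)) ^ S.D := by
    rw [coe_vitaliConst, coe_dil_halo, ← Real.mul_rpow (by linarith [S.two_le_enlarge])
      (by linarith [S.one_le_halo])]
    refine Real.rpow_le_rpow (mul_nonneg (by linarith [S.two_le_enlarge])
      (by linarith [S.one_le_halo])) ?_ hD.le
    unfold enlarge halo
    have h2 : 4 * S.κ ^ 2 * (1 + 2 * S.κ) ≤ 32 * S.κ ^ 4 := by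
      have h3 : S.κ ^ 2 ≤ S.κ ^ 4 := pow_le_pow_right₀ hκ (by norm_num)
      have h4 : S.κ ^ 3 ≤ S.κ ^ 4 := pow_le_pow_right₀ hκ (by norm_num)
      nlinarith
    calc 2 * (4 * S.κ ^ 2 + S.κ) * (2 * (S.κ * (1 + 2 * S.κ)))
        = 4 * S.κ ^ 2 * (1 + 2 * S.κ) * (4 * S.κ + 1) := by ring
      _ ≤ _ := by gcongr
  have h2 : 1 ≤ S.κ ^ S.D := Real.one_le_rpow hκ hD.le
  have hK := S.one_le_vitaliConst
  unfold cbar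
  rw [← enlarge, ← coe_vitaliConst]
  calc 32 * (S.vitaliConst : ℝ) * (1 + 6 * (S.vitaliConst * S.dil S.halo))
      = 32 * 1 * (S.vitaliConst : ℝ) * (1 + 6 * (S.vitaliConst * S.dil S.halo)) := by ring
    _ ≤ _ := by gcongr

lemma eight_mul_vitaliConst_le_cbar : 8 * (S.vitaliConst : ℝ) ≤ S.cbar := by
  have h1 := S.const_le_cbar
  have h2 := S.one_le_vitaliConst
  have h3 := S.one_le_dil_halo
  nlinarith [mul_nonneg (sub_nonneg.2 h2) (sub_nonneg.2 h3)]

lemma one_le_cbar : 1 ≤ S.cbar := by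
  linarith [S.eight_mul_vitaliConst_le_cbar, S.one_le_vitaliConst]

/-- The `r`-th power of `a^{1/(r-1)}` is `a · a^{1/(r-1)}`: one factor `a` is the `A₁` constant of
the strong type bound. The other absorbs the blow-up of `r/(r-1) = 1 + 1/(r-1)` as `r → 1`, by
Bernoulli's inequality for base 2. This is where `a ≥ 2` matters. -/
lemma strong_const_le {r a : ℝ} (hr : 1 < r) (ha : 2 ≤ a) :
    2 * 4 ^ r * (r / (r - 1)) * S.vitaliConst * a ≤ (S.cbar * r * a ^ (1 / (r - 1))) ^ r := by
  have hx : 0 < r - 1 := by linarith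
  have hK := S.one_le_vitaliConst
  have h8 := S.eight_mul_vitaliConst_le_cbar
  have ha1 : 1 ≤ a := by linarith
  have ha0 : 0 < a := by linarith
  have h1 : 2 * 4 ^ r * (S.vitaliConst : ℝ) ≤ S.cbar ^ r := by
    calc 2 * 4 ^ r * (S.vitaliConst : ℝ) = 4 ^ r * (2 * S.vitaliConst) ^ (1 : ℝ) := by
          rw [Real.rpow_one]; ring
      _ ≤ 4 ^ r * (2 * S.vitaliConst) ^ r := by
          gcongr
          linarith
      _ = (8 * S.vitaliConst : ℝ) ^ r := by
          rw [← Real.mul_rpow (by norm_num) (by positivity)]; ring_nf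
      _ ≤ _ := by gcongr
  have h2 : r / (r - 1) * a ≤ r ^ r * (a ^ (1 / (r - 1))) ^ r := by
    have e : (a ^ (1 / (r - 1))) ^ r = a ^ (1 / (r - 1)) * a := by
      rw [← Real.rpow_mul ha0.le]
      nth_rewrite 3 [← Real.rpow_one a]
      rw [← Real.rpow_add ha0]
      congr 1; field_simp; ring
    rw [e, ← mul_assoc]
    gcongr
    have hrr : r ≤ r ^ r := by
      nth_rewrite 1 [← Real.rpow_one r]
      exact Real.rpow_le_rpow_of_exponent_le hr.le hr.le
    have hapow : 1 ≤ a ^ (1 / (r - 1)) := Real.one_le_rpow ha1 (by positivity)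
    have e2 : r / (r - 1) = 1 + 1 / (r - 1) := by field_simp; ring
    rcases le_total (r - 1) 1 with h | h
    · have h3 : 1 ≤ 1 / (r - 1) := by rw [le_div_iff₀ hx]; linarith
      have h4 := one_add_mul_self_le_rpow_one_add (s := 1) (by norm_num) h3
      rw [mul_one] at h4
      calc r / (r - 1) ≤ (1 + 1) ^ (1 / (r - 1)) := by rw [e2]; exact h4
        _ ≤ a ^ (1 / (r - 1)) := by
            gcongr
            linarith
        _ ≤ r ^ r * a ^ (1 / (r - 1)) := le_mul_of_one_le_left (by positivity) (by linarith)
    · have h3 : 1 / (r - 1) ≤ 1 := by rw [div_le_one hx]; exact h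
      calc r / (r - 1) ≤ r := by rw [e2]; linarith
        _ ≤ r ^ r * 1 := by linarith
        _ ≤ _ := by gcongr
  have hc := S.one_le_cbar
  rw [Real.mul_rpow (by positivity) (by positivity), Real.mul_rpow (by positivity) (by positivity)]
  calc 2 * 4 ^ r * (r / (r - 1)) * S.vitaliConst * a
      = (2 * 4 ^ r * S.vitaliConst) * (r / (r - 1) * a) := by ring
    _ ≤ S.cbar ^ r * (r ^ r * (a ^ (1 / (r - 1))) ^ r) := by gcongr
    _ = _ := by ring

/-- The self-improvement exponent of an `A₁` weight with constant `a`. -/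
noncomputable def gain (a : ℝ) : ℝ := 1 / (4 * (S.vitaliConst * S.dil S.halo) * a)

lemma gain_pos {a : ℝ} (ha : 1 ≤ a) : 0 < S.gain a := by
  have := S.one_le_vitaliConst
  have := S.one_le_dil_halo
  unfold gain; positivity

/-- The exponent is chosen so that, apart from `a^ε`, the product is exactly `1/4`. The remaining
factor is at most 2, since `ε ≤ 1/a` and `a ≤ 2^a`. -/
lemma gain_small {a : ℝ} (ha : 1 ≤ a) :
    S.gain a * S.vitaliConst * a ^ (1 + S.gain a) * S.dil S.halo ≤ 1 / 2 := by
  have h1 := S.one_le_vitaliConst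
  have h2 := S.one_le_dil_halo
  have ha0 : 0 < a := by linarith
  have hle : S.gain a ≤ 1 / a := by
    unfold gain
    apply one_div_le_one_div_of_le ha0
    have : 1 ≤ (S.vitaliConst * S.dil S.halo : ℝ) := one_le_mul_of_one_le_of_one_le h1 h2
    nlinarith
  have h3 : a ^ S.gain a ≤ 2 := by
    calc a ^ S.gain a ≤ a ^ (1 / a) := Real.rpow_le_rpow_of_exponent_le ha hle
      _ ≤ ((1 + 1) ^ a) ^ (1 / a) := by
          gcongr
          have := one_add_mul_self_le_rpow_one_add (s := 1) (by norm_num) ha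
          linarith
      _ = 2 := by
          rw [← Real.rpow_mul (by norm_num), mul_one_div_cancel ha0.ne', Real.rpow_one]; norm_num
  rw [Real.rpow_add ha0, Real.rpow_one]
  have e : S.gain a * S.vitaliConst * (a * a ^ S.gain a) * S.dil S.halo = a ^ S.gain a / 4 := by
    nth_rewrite 1 [gain]
    field_simp
  rw [e]; linarith

/-- Linearity in `a` comes from adding exponents: the self-improved weight contributes `a^{t-1}`,
and `s/(s-1)`, which is of order `1/ε`, contributes one more power of `a`. The total is `a^t`. The
exponent `s` is `t` divided by the conjugate of `(1 + ε) r`. -/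
lemma dual_const_le {t r a : ℝ} (htr : t.HolderConjugate r) (ha : 1 ≤ a) {ε s : ℝ}
    (hε : ε = S.gain a) (hs : s = (r * (1 + ε) - 1) / ((1 + ε) * (r - 1))) :
    (2 * a ^ (1 + ε)) ^ (t / ((1 + ε) * r)) * (2 * 4 ^ s * (s / (s - 1)) * S.vitaliConst) ≤
      (S.cbar * r * a) ^ t := by
  have hr : 1 < r := htr.symm.lt
  have ht : 1 < t := htr.lt
  have hr1 : 0 < r - 1 := by linarith
  have hε0 : 0 < ε := hε ▸ S.gain_pos ha
  have ha0 : 0 < a := by linarith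
  have hK := S.one_le_vitaliConst
  have hK2 := S.one_le_dil_halo
  have htr' : t = r / (r - 1) := htr.symm.conjugate_eq
  set L : ℝ := S.vitaliConst * S.dil S.halo with hL
  have hL1 : 1 ≤ L := one_le_mul_of_one_le_of_one_le hK hK2
  have hs1 : s - 1 = ε / ((1 + ε) * (r - 1)) := by rw [hs]; field_simp; ring
  have hs' : s / (s - 1) ≤ r * (a * (1 + 4 * L)) := by
    have h1 : s / (s - 1) = (r * (1 + ε) - 1) / ε := by
      rw [hs1, hs]; field_simp
    have h2 : 1 / ε = 4 * L * a := by rw [hε, gain, one_div_one_div]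
    rw [h1]
    calc (r * (1 + ε) - 1) / ε ≤ r * (1 + ε) / ε := by gcongr; linarith
      _ = r * (1 + 1 / ε) := by field_simp; ring
      _ ≤ r * (a * (1 + 4 * L)) := by rw [h2]; gcongr; nlinarith
  have hst : s ≤ t := by
    rw [hs, htr', div_le_div_iff₀ (by positivity) hr1]
    nlinarith
  have hsp : 0 < s - 1 := by rw [hs1]; positivity
  have hpow1 : t / ((1 + ε) * r) ≤ t - 1 := by
    have : t - 1 = t / r := by rw [htr']; field_simp; ring
    rw [this]
    apply div_le_div_of_nonneg_left (by linarith) (by linarith)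
    nlinarith
  have hpow2 : (1 + ε) * (t / ((1 + ε) * r)) = t - 1 := by rw [htr']; field_simp; ring
  have h1 : (2 * a ^ (1 + ε)) ^ (t / ((1 + ε) * r)) ≤ 2 ^ (t - 1) * a ^ (t - 1) := by
    rw [Real.mul_rpow (by norm_num) (by positivity), ← Real.rpow_mul ha0.le, hpow2]
    gcongr
    norm_num
  have h8 : 8 * (S.vitaliConst : ℝ) * (1 + 4 * L) ≤ S.cbar := by
    refine le_trans ?_ S.const_le_cbar
    rw [← hL]; nlinarith
  have hKL : 1 ≤ (S.vitaliConst : ℝ) * (1 + 4 * L) := by nlinarith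
  have hself : ∀ y : ℝ, 1 ≤ y → y ≤ y ^ t := fun y hy => by
    nth_rewrite 1 [← Real.rpow_one y]
    exact Real.rpow_le_rpow_of_exponent_le hy ht.le
  have hc := S.one_le_cbar
  calc (2 * a ^ (1 + ε)) ^ (t / ((1 + ε) * r)) * (2 * 4 ^ s * (s / (s - 1)) * S.vitaliConst)
      ≤ (2 ^ (t - 1) * a ^ (t - 1)) * (2 * 4 ^ t * (r * (a * (1 + 4 * L))) * S.vitaliConst) := by
        have : 0 ≤ s / (s - 1) := by have : 0 < s := by linarith
                                     positivity
        gcongr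
        norm_num
    _ = 8 ^ t * a ^ t * r * (S.vitaliConst * (1 + 4 * L)) := by
        rw [Real.rpow_sub (by norm_num), Real.rpow_sub ha0, Real.rpow_one, Real.rpow_one,
          show (8:ℝ) = 2 * 4 by norm_num, Real.mul_rpow (by norm_num) (by norm_num)]
        field_simp
    _ ≤ 8 ^ t * a ^ t * r ^ t * (S.vitaliConst * (1 + 4 * L)) ^ t := by
        gcongr
        · exact hself r hr.le
        · exact hself _ hKL
    _ = (8 * (S.vitaliConst * (1 + 4 * L)) * r * a) ^ t := by
        have hKL0 : 0 ≤ (S.vitaliConst : ℝ) * (1 + 4 * L) := by linarith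
        generalize (S.vitaliConst : ℝ) * (1 + 4 * L) = Y at hKL0
        rw [Real.mul_rpow (by positivity) (by positivity),
          Real.mul_rpow (by positivity) (by positivity),
          Real.mul_rpow (by positivity) (by positivity)]; ring
    _ ≤ _ := by
        gcongr
        linarith

end Constants

end HomogeneousSpace

/-! ### Rubio de Francia iteration in weighted Lebesgue spaces. -/

/-- Jensen's inequality for a geometric series. -/
lemma ENNReal.tsum_geometric_rpow_le (f : ℕ → ℝ≥0∞) {s : ℝ} (hs : 1 ≤ s) :
    (∑' k, (2⁻¹ : ℝ≥0∞) ^ (k + 1) * f k) ^ s ≤ ∑' k, (2⁻¹ : ℝ≥0∞) ^ (k + 1) * f k ^ s := by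
  set ν : Measure ℕ := Measure.sum fun k => (2⁻¹ : ℝ≥0∞) ^ (k + 1) • Measure.dirac k with hν
  have hint : ∀ g : ℕ → ℝ≥0∞, ∫⁻ k, g k ∂ν = ∑' k, (2⁻¹ : ℝ≥0∞) ^ (k + 1) * g k := by
    intro g
    rw [hν, lintegral_sum_measure]
    simp [lintegral_smul_measure]
  have hprob : IsProbabilityMeasure ν := by
    constructor
    rw [← lintegral_one, hint]
    simp [ENNReal.tsum_geometric_add_one, ENNReal.inv_mul_cancel two_ne_zero ENNReal.ofNat_ne_top]
  rw [← hint, ← hint]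
  exact rpow_lintegral_le_lintegral_rpow ν (measurable_of_countable f).aemeasurable hs

namespace HomogeneousSpace

variable {X : Type*} [MeasurableSpace X] (S : HomogeneousSpace X)

/-- The Rubio de Francia iteration algorithm for the operator `f ↦ M (f ω) / ω` on `L^s(w)`, in
terms of measurable majorants. -/
lemma exists_iteration {w ω : X → ℝ≥0∞} (hwm : AEMeasurable w S.μ) (hωm : AEMeasurable ω S.μ)
    {s : ℝ} (hs : 1 ≤ s) {A : ℝ≥0∞} (hA0 : A ≠ 0) (hA : A ≠ ∞)
    (hT : ∀ f : X → ℝ≥0∞, AEMeasurable f S.μ → ∃ T : X → ℝ≥0∞, AEMeasurable T S.μ ∧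
      (∀ᵐ x ∂S.μ, S.maximal (fun y => f y * ω y) x ≤ T x * ω x) ∧
      ∫⁻ x, T x ^ s * w x ∂S.μ ≤ A ^ s * ∫⁻ x, f x ^ s * w x ∂S.μ)
    {h : X → ℝ≥0∞} (hh : AEMeasurable h S.μ) :
    ∃ u : X → ℝ≥0∞, AEMeasurable u S.μ ∧ (∀ x, h x ≤ u x) ∧
      S.A1With (fun x => u x * ω x) (2 * A) ∧
      ∫⁻ x, u x ^ s * w x ∂S.μ ≤ 2 ^ s * ∫⁻ x, h x ^ s * w x ∂S.μ := by
  have hs0 : 0 < s := by linarith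
  choose! T hTm hTM hTi using hT
  set g : ℕ → X → ℝ≥0∞ := fun k => T^[k] h with hg
  have hg0 : g 0 = h := rfl
  have hgs : ∀ k, g (k + 1) = T (g k) := fun k => Function.iterate_succ_apply' T k h
  have hgm : ∀ k, AEMeasurable (g k) S.μ := by
    intro k
    induction k with
    | zero => exact hh
    | succ k ih => rw [hgs]; exact hTm _ ih
  have hgi : ∀ k, ∫⁻ x, g k x ^ s * w x ∂S.μ ≤ (A ^ s) ^ k * ∫⁻ x, h x ^ s * w x ∂S.μ := by
    intro k
    induction k with
    | zero => simp [hg0]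
    | succ k ih =>
      rw [hgs, pow_succ', mul_assoc]
      exact (hTi _ (hgm k)).trans (mul_le_mul_right ih _)
  -- The majorant is `∑ (2A)^{-k} T^k h`. Applying the operator shifts the series by one index,
  -- which costs the factor `2A` in the `A₁` condition.
  set c : ℝ≥0∞ := (2 * A)⁻¹ with hc
  have h2A0 : 2 * A ≠ 0 := mul_ne_zero (by norm_num) hA0
  have h2A : 2 * A ≠ ∞ := ENNReal.mul_ne_top (by norm_num) hA
  refine ⟨fun x => ∑' k, c ^ k * g k x, AEMeasurable.tsum fun k => (hgm k).const_mul _,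
    fun x => ?_, ?_, ?_⟩
  · refine le_trans ?_ (ENNReal.le_tsum 0)
    simp [hg0]
  · have hall : ∀ᵐ x ∂S.μ, ∀ k, S.maximal (fun y => g k y * ω y) x ≤ g (k + 1) x * ω x := by
      refine ae_all_iff.2 fun k => ?_
      rw [hgs]; exact hTM _ (hgm k)
    filter_upwards [hall] with x hx
    have e : (fun y => (∑' k, c ^ k * g k y) * ω y) = fun y => ∑' k, c ^ k * (g k y * ω y) := by
      ext y
      rw [← ENNReal.tsum_mul_right]
      simp only [mul_assoc]
    rw [e]
    calc _ ≤ ∑' k, S.maximal (fun y => c ^ k * (g k y * ω y)) x :=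
          S.maximal_tsum_le (fun k => ((hgm k).fun_mul hωm).const_mul _) x
      _ = ∑' k, c ^ k * S.maximal (fun y => (g k y * ω y)) x := by
          congr! 2 with k
          exact S.maximal_const_mul ((hgm k).fun_mul hωm) _ x
      _ ≤ ∑' k, (2 * A) * (c ^ (k + 1) * g (k + 1) x * ω x) := by
          refine ENNReal.tsum_le_tsum fun k => ?_
          have : 2 * A * (c ^ (k + 1) * g (k + 1) x * ω x) = c ^ k * (g (k + 1) x * ω x) := by
            rw [pow_succ]
            calc _ = (2 * A * c) * (c ^ k * (g (k + 1) x * ω x)) := by ring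
              _ = _ := by rw [hc, ENNReal.mul_inv_cancel h2A0 h2A, one_mul]
          rw [this]
          exact mul_le_mul_right (hx k) _
      _ = (2 * A) * ((∑' k, c ^ (k + 1) * g (k + 1) x) * ω x) := by
          rw [ENNReal.tsum_mul_left, ENNReal.tsum_mul_right]
      _ ≤ _ := by
          refine mul_le_mul_right (mul_le_mul_left ?_ _) _
          exact ENNReal.tsum_comp_le_tsum_of_injective Nat.succ_injective
            (fun k => c ^ k * g k x)
  -- The series is twice a convex combination of the functions `A^{-k} T^k h`, each of which has
  -- norm at most that of `h`. Jensen's inequality then takes the place of the triangle inequality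
  -- in `L^s(w)`.
  · have e : ∀ x, (∑' k, c ^ k * g k x) =
        2 * ∑' k, (2⁻¹ : ℝ≥0∞) ^ (k + 1) * (A⁻¹ ^ k * g k x) := by
      intro x
      rw [← ENNReal.tsum_mul_left]
      refine tsum_congr fun k => ?_
      rw [hc, ENNReal.mul_inv (Or.inl (by norm_num)) (Or.inl (by norm_num)), mul_pow, pow_succ]
      calc _ = (2 * 2⁻¹ : ℝ≥0∞) * (2⁻¹ ^ k * A⁻¹ ^ k * g k x) := by
            rw [ENNReal.mul_inv_cancel (by norm_num) (by norm_num), one_mul]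
        _ = _ := by ring
    calc ∫⁻ x, (∑' k, c ^ k * g k x) ^ s * w x ∂S.μ
        ≤ ∫⁻ x, 2 ^ s * ∑' k, (2⁻¹ : ℝ≥0∞) ^ (k + 1) * ((A⁻¹ ^ k) ^ s * (g k x ^ s * w x)) ∂S.μ := by
          refine lintegral_mono fun x => ?_
          simp only
          rw [e, ENNReal.mul_rpow_of_nonneg _ _ hs0.le, mul_assoc]
          refine mul_le_mul_right ?_ _
          refine (mul_le_mul_left (ENNReal.tsum_geometric_rpow_le _ hs) _).trans_eq ?_
          rw [← ENNReal.tsum_mul_right]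
          refine tsum_congr fun k => ?_
          rw [ENNReal.mul_rpow_of_nonneg _ _ hs0.le]
          ring
      _ = 2 ^ s * ∑' k, (2⁻¹ : ℝ≥0∞) ^ (k + 1) * ((A⁻¹ ^ k) ^ s * ∫⁻ x, g k x ^ s * w x ∂S.μ) := by
          have hm : ∀ k, AEMeasurable (fun x => g k x ^ s * w x) S.μ := fun k =>
            ((hgm k).pow_const s).fun_mul hwm
          rw [lintegral_const_mul'', lintegral_tsum]
          · congr! 3 with k
            rw [lintegral_const_mul'' _ ((hm k).const_mul _), lintegral_const_mul'' _ (hm k)]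
          · exact fun k => ((hm k).const_mul _).const_mul _
          · exact AEMeasurable.tsum fun k => ((hm k).const_mul _).const_mul _
      _ ≤ 2 ^ s * ∑' k, (2⁻¹ : ℝ≥0∞) ^ (k + 1) * ∫⁻ x, h x ^ s * w x ∂S.μ := by
          refine mul_le_mul_right (ENNReal.tsum_le_tsum fun k => mul_le_mul_right ?_ _) _
          calc _ ≤ (A⁻¹ ^ k) ^ s * ((A ^ s) ^ k * ∫⁻ x, h x ^ s * w x ∂S.μ) :=
                mul_le_mul_right (hgi k) _
            _ = ((A⁻¹ ^ s * A ^ s) ^ k) * ∫⁻ x, h x ^ s * w x ∂S.μ := by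
                rw [mul_pow, ← mul_assoc]
                congr 2
                rw [← ENNReal.rpow_natCast, ← ENNReal.rpow_natCast, ← ENNReal.rpow_mul,
                  ← ENNReal.rpow_mul, mul_comm]
            _ = _ := by
                rw [← ENNReal.mul_rpow_of_nonneg _ _ hs0.le, ENNReal.inv_mul_cancel hA0 hA,
                  ENNReal.one_rpow, one_pow, one_mul]
      _ = _ := by
          rw [ENNReal.tsum_mul_right]
          simp [ENNReal.tsum_geometric_add_one,
            ENNReal.inv_mul_cancel two_ne_zero ENNReal.ofNat_ne_top]

/-- The iteration algorithm for the maximal operator on `L^r(w)`, `w ∈ A₁`. -/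
lemma exists_A1_majorant {w : X → ℝ≥0∞} {a : ℝ≥0} (hw : S.A1With w a) (ha : 2 ≤ a)
    (hwm : AEMeasurable w S.μ) {r : ℝ} (hr : 1 < r) {h : X → ℝ≥0∞} (hh : AEMeasurable h S.μ) :
    ∃ u : X → ℝ≥0∞, AEMeasurable u S.μ ∧ (∀ x, h x ≤ u x) ∧
      S.A1With u (2 * ENNReal.ofReal (S.cbar * r * a ^ (1 / (r - 1)))) ∧
      ∫⁻ x, u x ^ r * w x ∂S.μ ≤ 2 ^ r * ∫⁻ x, h x ^ r * w x ∂S.μ := by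
  have hc := S.one_le_cbar
  have ha' : (2 : ℝ) ≤ a := by exact_mod_cast ha
  have hpos : 0 < S.cbar * r * (a : ℝ) ^ (1 / (r - 1)) := by positivity
  have hT : ∀ f : X → ℝ≥0∞, AEMeasurable f S.μ → ∃ T : X → ℝ≥0∞, AEMeasurable T S.μ ∧
      (∀ᵐ x ∂S.μ, S.maximal (fun y => f y * 1) x ≤ T x * 1) ∧
      ∫⁻ x, T x ^ r * w x ∂S.μ ≤ ENNReal.ofReal (S.cbar * r * a ^ (1 / (r - 1))) ^ r *
        ∫⁻ x, f x ^ r * w x ∂S.μ := by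
    intro f hf
    obtain ⟨T, hTm, hTM, hTi⟩ := S.exists_measurable_maximal_le hw hwm hf hr
    refine ⟨T, hTm.aemeasurable, by simpa using Filter.Eventually.of_forall hTM, hTi.trans ?_⟩
    gcongr
    rw [ENNReal.ofReal_rpow_of_pos hpos, ← ENNReal.ofReal_coe_nnreal, ← ENNReal.ofReal_coe_nnreal]
    have : 0 < r - 1 := by linarith
    rw [← ENNReal.ofReal_mul (by positivity), ← ENNReal.ofReal_mul (by positivity)]
    exact ENNReal.ofReal_le_ofReal (S.strong_const_le hr ha')
  obtain ⟨u, h1, h2, h3, h4⟩ := S.exists_iteration hwm aemeasurable_const hr.le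
    (by simpa using hpos) ENNReal.ofReal_ne_top hT hh
  exact ⟨u, h1, h2, by simpa using h3, h4⟩

-- Writing `f w = (f w^{1/t}) w^{1/r}`, Hölder's inequality with exponents `b` and `sr` leaves an
-- average of `w^s`, which the `A₁` condition for `w^s` bounds pointwise. What remains is an
-- unweighted maximal function, so a weighted bound reduces to an unweighted one.
variable {S} in
lemma A1With.maximal_mul_le {w : X → ℝ≥0∞} {t r b s : ℝ} {C : ℝ≥0∞}
    (hRH : S.A1With (fun x => w x ^ s) C) (hwm : AEMeasurable w S.μ)
    (htr : t.HolderConjugate r) (hb' : b.HolderConjugate (s * r)) {f : X → ℝ≥0∞}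
    (hf : AEMeasurable f S.μ) :
    ∀ᵐ x ∂S.μ, S.maximal (fun y => f y * w y) x ≤ C ^ (1 / (s * r)) * w x ^ (1 / r) *
      S.maximal (fun y => (f y ^ t * w y) ^ (b / t)) x ^ (1 / b) := by
  have ht0 : 0 < t := htr.pos
  have hr0 : 0 < r := htr.symm.pos
  have hb0 : 0 < b := hb'.pos
  have hs0 : 0 < s := pos_of_mul_pos_left hb'.symm.pos hr0.le
  filter_upwards [hRH] with x h2
  refine maximal_le fun c R hR hx => ?_
  have e : ∀ y, f y * w y = (f y * w y ^ (1 / t)) * w y ^ (1 / r) := by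
    intro y
    rw [mul_assoc, ← ENNReal.rpow_add_of_nonneg _ _ (by positivity) (by positivity),
      one_div, one_div, htr.inv_add_inv_eq_one, ENNReal.rpow_one]
  simp_rw [e]
  refine (S.avg_mul_le_rpow (hf.fun_mul (hwm.pow_const _)) (hwm.pow_const _) hb' c R).trans ?_
  have e1 : ∀ y, (f y * w y ^ (1 / t)) ^ b = (f y ^ t * w y) ^ (b / t) := by
    intro y
    rw [ENNReal.mul_rpow_of_nonneg _ _ hb0.le, ENNReal.mul_rpow_of_nonneg _ _ (by positivity),
      ← ENNReal.rpow_mul, ← ENNReal.rpow_mul]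
    congr 2
    · field_simp
    · ring
  have e2 : ∀ y, (w y ^ (1 / r)) ^ (s * r) = w y ^ s := by
    intro y
    rw [← ENNReal.rpow_mul]
    congr 1; field_simp
  simp_rw [e1, e2]
  have h3 := S.avg_le_maximal (fun y => (f y ^ t * w y) ^ (b / t)) hR hx
  have h4 : S.avg (fun y => w y ^ s) c R ≤ C * w x ^ s :=
    (S.avg_le_maximal (fun y => w y ^ s) hR hx).trans h2
  calc _ ≤ S.maximal (fun y => (f y ^ t * w y) ^ (b / t)) x ^ (1 / b) *
        (C * w x ^ s) ^ (1 / (s * r)) := by gcongr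
    _ = _ := by
        rw [ENNReal.mul_rpow_of_nonneg _ _ (by positivity), ← ENNReal.rpow_mul,
          show s * (1 / (s * r)) = 1 / r by field_simp]
        ring

/-- The bound for the operator `f ↦ M (f w) / w` on `L^t(w)`, `w ∈ A₁`, that depends linearly on
the constant of the weight. -/
lemma exists_dual_maximal_le {w : X → ℝ≥0∞} {a : ℝ≥0} (hw : S.A1With w a) (ha : 1 ≤ a)
    (hwm : AEMeasurable w S.μ) (hw0 : ∀ᵐ x ∂S.μ, w x ≠ 0) (hwt : ∀ᵐ x ∂S.μ, w x ≠ ∞)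
    {t r : ℝ} (htr : t.HolderConjugate r) {f : X → ℝ≥0∞} (hf : AEMeasurable f S.μ) :
    ∃ T : X → ℝ≥0∞, AEMeasurable T S.μ ∧
      (∀ᵐ x ∂S.μ, S.maximal (fun y => f y * w y) x ≤ T x * w x) ∧
      ∫⁻ x, T x ^ t * w x ∂S.μ ≤
        ENNReal.ofReal (S.cbar * r * a) ^ t * ∫⁻ x, f x ^ t * w x ∂S.μ := by
  have ha' : (1 : ℝ) ≤ a := by exact_mod_cast ha
  have hr : 1 < r := htr.symm.lt
  have ht : 1 < t := htr.lt
  have ht0 : 0 < t := by linarith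
  have hr0 : 0 < r := by linarith
  have hr1 : 0 < r - 1 := by linarith
  have htr' : t = r / (r - 1) := htr.symm.conjugate_eq
  set ε := S.gain a with hε
  have hε0 : 0 < ε := S.gain_pos ha'
  set s := (r * (1 + ε) - 1) / ((1 + ε) * (r - 1)) with hs
  have hs1 : s - 1 = ε / ((1 + ε) * (r - 1)) := by rw [hs]; field_simp; ring
  have hs0 : 1 < s := by
    have : 0 < s - 1 := by rw [hs1]; positivity
    linarith
  set b := t / s with hb
  -- The exponent `s` is arranged so that `t/s` is conjugate to `(1 + ε) r`. The gain `ε > 0` makes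
  -- `s > 1`, hence `M` is bounded on the unweighted `L^s`.
  have hb' : b.HolderConjugate ((1 + ε) * r) := by
    have h1 : 1 < (1 + ε) * r := by nlinarith
    rw [Real.holderConjugate_comm, Real.holderConjugate_iff_eq_conjExponent h1, hb, htr', hs]
    have : r * (1 + ε) - 1 ≠ 0 := by nlinarith
    have : (1 + ε) * r - 1 ≠ 0 := by nlinarith
    field_simp
  have hb0 : 0 < b := div_pos ht0 (by linarith)
  have hsmall : ENNReal.ofReal ε * S.vitaliConst * (a : ℝ≥0∞) ^ (1 + ε) * S.dil S.halo ≤ 1 / 2 := by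
    have h1 := ENNReal.ofReal_le_ofReal (S.gain_small ha')
    rw [ENNReal.ofReal_mul (by positivity), ENNReal.ofReal_mul (by positivity),
      ENNReal.ofReal_mul hε0.le, ENNReal.ofReal_coe_nnreal, ENNReal.ofReal_coe_nnreal,
      ← ENNReal.ofReal_rpow_of_pos (by linarith), ENNReal.ofReal_coe_nnreal] at h1
    refine h1.trans_eq ?_
    rw [ENNReal.ofReal_div_of_pos (by norm_num)]; simp
  have hRH := hw.rpow ha hwm hε0 hsmall
  -- Its `s`-th power is `f^t w`, so the unweighted `L^s` bound for `M F` is exactly an `L^t(w)`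
  -- bound in terms of `f`.
  set F : X → ℝ≥0∞ := fun x => (f x ^ t * w x) ^ (1 / s) with hF
  have hFm : AEMeasurable F S.μ := ((hf.pow_const t).fun_mul hwm).pow_const _
  obtain ⟨m, hmm, hmM, hmi⟩ := S.exists_measurable_maximal_le S.A1With_one aemeasurable_const hFm hs0
  set C : ℝ≥0∞ := (2 * a ^ (1 + ε)) ^ (1 / ((1 + ε) * r)) with hC
  have e7 : C ^ t = ENNReal.ofReal ((2 * (a : ℝ) ^ (1 + ε)) ^ (t / ((1 + ε) * r))) := by
    rw [hC, ← ENNReal.rpow_mul, ← ENNReal.ofReal_rpow_of_pos (by positivity),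
      ENNReal.ofReal_mul (by norm_num), ← ENNReal.ofReal_rpow_of_pos (by linarith),
      ENNReal.ofReal_coe_nnreal, ENNReal.ofReal_ofNat, one_div_mul_eq_div]
  have hmain := hRH.maximal_mul_le hwm htr hb' hf
  rw [← hC] at hmain
  clear_value C
  refine ⟨fun x => (w x)⁻¹ * (C * w x ^ (1 / r) * m x ^ (1 / b)), ?_, ?_, ?_⟩
  · exact hwm.inv.mul (((hwm.pow_const _).const_mul C).mul (hmm.pow_const _).aemeasurable)
  · filter_upwards [hw0, hwt, hmain] with x h0 h1 h2
    rw [mul_right_comm, ENNReal.inv_mul_cancel h0 h1, one_mul]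
    refine h2.trans ?_
    have e : b / t = 1 / s := by rw [hb]; field_simp
    rw [e]
    exact mul_le_mul_right (ENNReal.rpow_le_rpow (hmM x) (by positivity)) _
  · have e3 : ∀ᵐ x ∂S.μ, ((w x)⁻¹ * (C * w x ^ (1 / r) * m x ^ (1 / b))) ^ t * w x =
        C ^ t * (m x ^ s * 1) := by
      filter_upwards [hw0, hwt] with x h0 h1
      rw [ENNReal.mul_rpow_of_nonneg _ _ ht0.le, ENNReal.mul_rpow_of_nonneg _ _ ht0.le,
        ENNReal.mul_rpow_of_nonneg _ _ ht0.le, ← ENNReal.rpow_mul, ← ENNReal.rpow_mul,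
        ← ENNReal.rpow_neg_one, ← ENNReal.rpow_mul]
      -- The powers of the weight cancel because `t` and `r` are conjugate: `-t + t/r + 1 = 0`.
      have e4 : w x ^ (-1 * t) * w x ^ (1 / r * t) * w x = 1 := by
        nth_rewrite 3 [← ENNReal.rpow_one (w x)]
        rw [← ENNReal.rpow_add _ _ h0 h1, ← ENNReal.rpow_add _ _ h0 h1]
        rw [show -1 * t + 1 / r * t + 1 = 0 by rw [htr']; field_simp; ring, ENNReal.rpow_zero]
      have e5 : 1 / b * t = s := by rw [hb]; field_simp
      rw [e5]
      calc _ = C ^ t * m x ^ s * (w x ^ (-1 * t) * w x ^ (1 / r * t) * w x) := by ring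
        _ = _ := by rw [e4]; ring
    have e6 : ∀ x, F x ^ s * 1 = f x ^ t * w x := by
      intro x
      rw [hF]
      simp only
      rw [← ENNReal.rpow_mul, one_div_mul_cancel (by linarith), ENNReal.rpow_one, mul_one]
    rw [lintegral_congr_ae e3,
      lintegral_const_mul'' _ ((hmm.pow_const s).aemeasurable.mul_const _)]
    simp_rw [e6] at hmi
    calc _ ≤ C ^ t * (ENNReal.ofReal (2 * 4 ^ s * (s / (s - 1))) * S.vitaliConst * 1 *
          ∫⁻ x, f x ^ t * w x ∂S.μ) := by gcongr
      _ = (C ^ t * (ENNReal.ofReal (2 * 4 ^ s * (s / (s - 1))) * S.vitaliConst)) *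
          ∫⁻ x, f x ^ t * w x ∂S.μ := by ring
      _ ≤ _ := by
          gcongr
          have hc := S.one_le_cbar
          have : 0 < s - 1 := by linarith
          rw [e7, ENNReal.ofReal_rpow_of_pos (by positivity), ← ENNReal.ofReal_coe_nnreal,
            ← ENNReal.ofReal_mul (by positivity), ← ENNReal.ofReal_mul (by positivity)]
          exact ENNReal.ofReal_le_ofReal (S.dual_const_le htr ha' hε hs)

/-- The iteration algorithm for the operator `f ↦ M (f w) / w` on `L^t(w)`, `w ∈ A₁`. -/
lemma exists_dual_A1_majorant {w : X → ℝ≥0∞} {a : ℝ≥0} (hw : S.A1With w a) (ha : 1 ≤ a)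
    (hwm : AEMeasurable w S.μ) (hw0 : ∀ᵐ x ∂S.μ, w x ≠ 0) (hwt : ∀ᵐ x ∂S.μ, w x ≠ ∞)
    {t r : ℝ} (htr : t.HolderConjugate r) {h : X → ℝ≥0∞} (hh : AEMeasurable h S.μ) :
    ∃ u : X → ℝ≥0∞, AEMeasurable u S.μ ∧ (∀ x, h x ≤ u x) ∧
      S.A1With (fun x => u x * w x) (2 * ENNReal.ofReal (S.cbar * r * a)) ∧
      ∫⁻ x, u x ^ t * w x ∂S.μ ≤ 2 ^ t * ∫⁻ x, h x ^ t * w x ∂S.μ := by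
  have hc := S.one_le_cbar
  have hr : 1 < r := htr.symm.lt
  have ha' : (1 : ℝ) ≤ a := by exact_mod_cast ha
  have hpos : 0 < S.cbar * r * (a : ℝ) := by positivity
  exact S.exists_iteration hwm hwm htr.lt.le (by simpa using hpos) ENNReal.ofReal_ne_top
    (fun f hf => S.exists_dual_maximal_le hw ha hwm hw0 hwt htr hf) hh

end HomogeneousSpace

/-! ### Muckenhoupt weights built from `A₁` weights. -/

namespace HomogeneousSpace

variable {X : Type*} [MeasurableSpace X] {S : HomogeneousSpace X}

lemma exists_mem_ball_of_ae {P : X → Prop} (h : ∀ᵐ x ∂S.μ, P x) (c : X) {r : ℝ} (hr : 0 < r) :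
    ∃ x ∈ S.ball c r, P x := by
  have := S.isProbabilityMeasure_ballMeasure c hr
  have h1 := (S.ae_ballMeasure_mem c r).and ((S.ballMeasure_absolutelyContinuous c r).ae_le h)
  exact h1.exists

/-- Every ball contains a point at which `M u ≤ b u < ∞`, so local integrability follows from
finiteness almost everywhere. -/
lemma A1With.avg_ne_top {u : X → ℝ≥0∞} {b : ℝ≥0∞} (hu : S.A1With u b) (hb : b ≠ ∞)
    (hut : ∀ᵐ x ∂S.μ, u x ≠ ∞) (c : X) {r : ℝ} (hr : 0 < r) : S.avg u c r ≠ ∞ := by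
  obtain ⟨x, hx, h1, h2⟩ := exists_mem_ball_of_ae (hu.and hut) c hr
  exact (((S.avg_le_maximal u hr hx).trans h1).trans_lt (ENNReal.mul_lt_top hb.lt_top h2.lt_top)).ne

lemma avg_ne_zero {u : X → ℝ≥0∞} (hum : AEMeasurable u S.μ) (hu0 : ∀ᵐ x ∂S.μ, u x ≠ 0) (c : X)
    {r : ℝ} (hr : 0 < r) : S.avg u c r ≠ 0 := by
  have := S.isProbabilityMeasure_ballMeasure c hr
  rw [avg_eq, Ne, lintegral_eq_zero_iff' (hum.ballMeasure c r)]
  intro h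
  have h1 : ∀ᵐ x ∂S.ballMeasure c r, u x ≠ 0 :=
    (S.ballMeasure_absolutelyContinuous c r).ae_le hu0
  obtain ⟨x, hx, hx'⟩ := (h1.and h).exists
  exact hx hx'

lemma setLIntegral_ball_lt_top {u : X → ℝ≥0∞} (h : ∀ c r, 0 < r → S.avg u c r ≠ ∞) (c : X)
    (r : ℝ) : ∫⁻ y in S.ball c r, u y ∂S.μ < ∞ := by
  refine (lintegral_mono_set (S.ball_mono c (le_max_left r 1))).trans_lt ?_
  have hpos : 0 < max r 1 := lt_max_of_lt_right one_pos
  rw [← S.measure_mul_avg u c hpos]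
  exact ENNReal.mul_lt_top (S.measure_ball_lt_top _ _) (h _ _ hpos).lt_top

lemma A1With.isWeight {u : X → ℝ≥0∞} {b : ℝ≥0∞} (hu : S.A1With u b) (hb : b ≠ ∞)
    (hum : AEMeasurable u S.μ) (hu0 : ∀ᵐ x ∂S.μ, u x ≠ 0) (hut : ∀ᵐ x ∂S.μ, u x ≠ ∞) :
    S.IsWeight u where
  aemeasurable := hum
  pos := hu0.mono fun _ h => pos_iff_ne_zero.2 h
  locallyIntegrable := setLIntegral_ball_lt_top fun c _ hr => hu.avg_ne_top hb hut c hr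

lemma IsWeight.ae_ne_zero {w : X → ℝ≥0∞} (hw : S.IsWeight w) : ∀ᵐ x ∂S.μ, w x ≠ 0 :=
  hw.pos.mono fun _ h => h.ne'

lemma IsWeight.ae_ne_top {w : X → ℝ≥0∞} (hw : S.IsWeight w) : ∀ᵐ x ∂S.μ, w x ≠ ∞ := by
  rcases isEmpty_or_nonempty X with h | ⟨⟨o⟩⟩
  · exact Filter.Eventually.of_forall fun x => h.elim x
  have h1 : ∀ n : ℕ, ∀ᵐ x ∂S.μ, x ∈ S.ball o n → w x < ∞ := fun n =>
    (ae_restrict_iff' (S.measurableSet_ball' o n)).1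
      (ae_lt_top' hw.aemeasurable.restrict (hw.locallyIntegrable o n).ne)
  filter_upwards [ae_all_iff.2 h1] with x hx
  have hxu : x ∈ ⋃ n : ℕ, S.ball o n := by rw [iUnion_ball_nat]; trivial
  obtain ⟨n, hn⟩ := Set.mem_iUnion.1 hxu
  exact (hx n hn).ne

/-- Monotonicity of `N` is available only on `[1, ∞)`, so characteristics must be located there. For
`r > 1` this is Hölder's inequality for `1 = w^{1/r} w^{-1/r}`; for `r = 1` the `A₁` inequality is
averaged over one ball. -/
lemma IsWeight.one_le_apConst [Nonempty X] {w : X → ℝ≥0∞} (hw : S.IsWeight w) {r : ℝ}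
    (hr : 1 ≤ r) : 1 ≤ S.apConst r w := by
  obtain ⟨o⟩ := ‹Nonempty X›
  have hprob := S.isProbabilityMeasure_ballMeasure o one_pos
  have hm0 : S.avg w o 1 ≠ 0 := avg_ne_zero hw.aemeasurable hw.ae_ne_zero o one_pos
  rcases hr.eq_or_lt with rfl | hr
  · rw [apConst, if_pos rfl]
    refine le_sInf fun C hC => ?_
    have hmt : S.avg w o 1 ≠ ∞ := by
      unfold avg
      exact ENNReal.mul_ne_top (ENNReal.inv_ne_top.2 (S.measure_ball_ne_zero o one_pos))
        (hw.locallyIntegrable o 1).ne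
    have h1 : S.avg w o 1 ≤ C * S.avg w o 1 := by
      calc S.avg w o 1 = S.avg (fun _ => S.avg w o 1) o 1 := (S.avg_const _ o one_pos).symm
        _ ≤ S.avg (fun x => C * w x) o 1 := by
            simp only [avg_eq S (fun x => _)]
            apply lintegral_mono_ae
            filter_upwards [S.ae_ballMeasure_mem o 1,
              (S.ballMeasure_absolutelyContinuous o 1).ae_le hC] with x hx hxC
            rw [← avg_eq]
            exact (S.avg_le_maximal w one_pos hx).trans hxC
        _ = C * S.avg w o 1 := by
            rw [avg_eq, avg_eq, lintegral_const_mul'' _ (hw.aemeasurable.ballMeasure o 1)]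
    calc (1 : ℝ≥0∞) = S.avg w o 1 * (S.avg w o 1)⁻¹ := (ENNReal.mul_inv_cancel hm0 hmt).symm
      _ ≤ C * S.avg w o 1 * (S.avg w o 1)⁻¹ := mul_le_mul_left h1 _
      _ = C := by rw [mul_assoc, ENNReal.mul_inv_cancel hm0 hmt, mul_one]
  · rw [apConst, if_neg hr.ne']
    refine le_iSup_of_le o <| le_iSup_of_le 1 <| le_iSup_of_le one_pos ?_
    have hr0 : 0 < r - 1 := by linarith
    have hr0' : 0 < r := by linarith
    have hc := Real.HolderConjugate.conjExponent hr
    have h1 := S.avg_mul_le_rpow (hw.aemeasurable.pow_const (1 / r))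
      (hw.aemeasurable.pow_const (-(1 / r))) hc o 1
    have e1 : S.avg (fun x => w x ^ (1 / r) * w x ^ (-(1 / r))) o 1 = 1 := by
      rw [avg_eq, lintegral_congr_ae (g := fun _ => 1), lintegral_one, measure_univ]
      filter_upwards [(S.ballMeasure_absolutelyContinuous o 1).ae_le hw.ae_ne_zero,
        (S.ballMeasure_absolutelyContinuous o 1).ae_le hw.ae_ne_top] with x h0 h1
      rw [← ENNReal.rpow_add _ _ h0 h1, add_neg_cancel, ENNReal.rpow_zero]
    have e2 : (fun x => (w x ^ (1 / r)) ^ r) = w := by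
      ext x
      rw [← ENNReal.rpow_mul, one_div_mul_cancel hr0'.ne', ENNReal.rpow_one]
    have e3 : (fun x => (w x ^ (-(1 / r))) ^ r.conjExponent) = fun x => w x ^ (-1 / (r - 1)) := by
      ext x
      rw [← ENNReal.rpow_mul]
      congr 1
      unfold Real.conjExponent
      field_simp
    rw [e1, e2, e3] at h1
    calc (1 : ℝ≥0∞) = 1 ^ r := (ENNReal.one_rpow r).symm
      _ ≤ _ := ENNReal.rpow_le_rpow h1 hr0'.le
      _ = _ := by
        rw [ENNReal.mul_rpow_of_nonneg _ _ hr0'.le, ← ENNReal.rpow_mul, ← ENNReal.rpow_mul,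
          one_div_mul_cancel hr0'.ne', ENNReal.rpow_one]
        congr 2
        unfold Real.conjExponent
        field_simp

lemma avg_rpow_le {u : X → ℝ≥0∞} (hum : AEMeasurable u S.μ) {s : ℝ} (hs0 : 0 ≤ s) (hs1 : s ≤ 1)
    (c : X) {r : ℝ} (hr : 0 < r) : S.avg (fun x => u x ^ s) c r ≤ S.avg u c r ^ s := by
  have := S.isProbabilityMeasure_ballMeasure c hr
  rcases hs0.eq_or_lt with rfl | hs0
  · simpa using (S.avg_const 1 c hr).le
  have h := rpow_lintegral_le_lintegral_rpow (S.ballMeasure c r)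
    ((hum.pow_const s).ballMeasure c r) (s := 1 / s) (by rw [le_div_iff₀ hs0]; linarith)
  simp only [← ENNReal.rpow_mul, mul_one_div_cancel hs0.ne', ENNReal.rpow_one] at h
  rw [avg_eq, avg_eq]
  calc _ = ((∫⁻ x, u x ^ s ∂S.ballMeasure c r) ^ (1 / s)) ^ s := by
        rw [← ENNReal.rpow_mul, one_div_mul_cancel hs0.ne', ENNReal.rpow_one]
    _ ≤ _ := ENNReal.rpow_le_rpow h hs0.le

/-- An `A₁` weight is bounded below on a ball by its average divided by the constant. Negative
powers can therefore be replaced by powers of the average, which is the mechanism behind the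
factorisation. -/
lemma A1With.inv_le {u : X → ℝ≥0∞} {b : ℝ≥0∞} (hu : S.A1With u b) (hb : b ≠ ∞)
    (hum : AEMeasurable u S.μ) (hu0 : ∀ᵐ x ∂S.μ, u x ≠ 0) (hut : ∀ᵐ x ∂S.μ, u x ≠ ∞) (c : X) {r : ℝ}
    (hr : 0 < r) : ∀ᵐ x ∂S.ballMeasure c r, (u x)⁻¹ ≤ (S.avg u c r)⁻¹ * b := by
  have hac := S.ballMeasure_absolutelyContinuous c r
  have hm0 := avg_ne_zero hum hu0 c hr
  have hmt := hu.avg_ne_top hb hut c hr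
  filter_upwards [S.ae_ballMeasure_mem c r, hac.ae_le hu, hac.ae_le hu0, hac.ae_le hut]
    with x hx h1 h2 h3
  have h4 : S.avg u c r ≤ b * u x := (S.avg_le_maximal u hr hx).trans h1
  have h5 : S.avg u c r * (u x)⁻¹ ≤ b := by
    calc _ ≤ b * u x * (u x)⁻¹ := mul_le_mul_left h4 _
      _ = b := by rw [mul_assoc, ENNReal.mul_inv_cancel h2 h3, mul_one]
  calc (u x)⁻¹ = (S.avg u c r)⁻¹ * (S.avg u c r * (u x)⁻¹) := by
        rw [← mul_assoc, ENNReal.inv_mul_cancel hm0 hmt, one_mul]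
    _ ≤ _ := mul_le_mul_right h5 _

/-- The easy half of the factorisation of `A_r` weights. -/
lemma A1With.mul_rpow_neg_mem_Ap {w u : X → ℝ≥0∞} {a b : ℝ≥0∞} (hwA : S.A1With w a) (ha : a ≠ ∞)
    (hw : S.IsWeight w) (hu : S.A1With u b) (hb : b ≠ ∞) (hum : AEMeasurable u S.μ)
    (hu0 : ∀ᵐ x ∂S.μ, u x ≠ 0) (hut : ∀ᵐ x ∂S.μ, u x ≠ ∞) {r e : ℝ} (he : 0 ≤ e)
    (her : e ≤ r - 1) :
    (fun x => w x * u x ^ (-e)) ∈ S.Ap r ∧ S.apConst r (fun x => w x * u x ^ (-e)) ≤ a * b ^ e := by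
  have hwm := hw.aemeasurable
  have hw0 := hw.ae_ne_zero
  have hwt := hw.ae_ne_top
  set W : X → ℝ≥0∞ := fun x => w x * u x ^ (-e) with hW
  have havg : ∀ c R, 0 < R → S.avg W c R ≤ S.avg w c R * ((S.avg u c R)⁻¹ * b) ^ e := by
    intro c R hR
    rw [avg_eq, avg_eq S w, mul_comm, ← lintegral_const_mul'' _ (hwm.ballMeasure c R)]
    refine lintegral_mono_ae ?_
    filter_upwards [hu.inv_le hb hum hu0 hut c hR] with x hx
    rw [hW]
    simp only
    rw [mul_comm, ENNReal.rpow_neg, ← ENNReal.inv_rpow]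
    gcongr
  have hm0 : ∀ c R, 0 < R → S.avg u c R ≠ 0 := fun c R hR => avg_ne_zero hum hu0 c hR
  have hmt : ∀ c R, 0 < R → S.avg u c R ≠ ∞ := fun c R hR => hu.avg_ne_top hb hut c hR
  have hn0 : ∀ c R, 0 < R → S.avg w c R ≠ 0 := fun c R hR => avg_ne_zero hwm hw0 c hR
  have hnt : ∀ c R, 0 < R → S.avg w c R ≠ ∞ := fun c R hR => hwA.avg_ne_top ha hwt c hR
  have hweight : S.IsWeight W := by
    refine ⟨hwm.mul (hum.pow_const _), ?_, setLIntegral_ball_lt_top fun c R hR => ?_⟩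
    · filter_upwards [hw0, hut] with x h1 h2
      exact ENNReal.mul_pos h1 (by simp [ENNReal.rpow_eq_zero_iff, h2, he])
    · refine ((havg c R hR).trans_lt (ENNReal.mul_lt_top (hnt c R hR).lt_top ?_)).ne
      exact ENNReal.rpow_lt_top_of_nonneg he
        (ENNReal.mul_ne_top (ENNReal.inv_ne_top.2 (hm0 c R hR)) hb)
  have hconst : S.apConst r W ≤ a * b ^ e := by
    rcases eq_or_ne r 1 with rfl | hr1
    -- For `r = 1` the constraint `e ≤ r - 1` removes the factor `u`, and the claim is the `A₁`
    -- condition for `w`.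
    · have he0 : e = 0 := le_antisymm (by linarith) he
      rw [apConst, if_pos rfl]
      refine sInf_le ?_
      have hWw : W = w := by ext x; simp [hW, he0]
      have hwA' : ∀ᵐ x ∂S.μ, S.maximal w x ≤ a * w x := hwA
      rw [hWw, he0, ENNReal.rpow_zero, mul_one]
      exact hwA'
    rw [apConst, if_neg hr1]
    have hr0 : 0 < r - 1 := lt_of_le_of_ne (he.trans her) (fun h => hr1 (by linarith))
    refine iSup_le fun c => iSup_le fun R => iSup_le fun hR => ?_
    have hac := S.ballMeasure_absolutelyContinuous c R
    set m := S.avg u c R with hm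
    set n := S.avg w c R with hn
    -- Here the roles are exchanged: the negative power of `w` is bounded pointwise by its `A₁`
    -- condition, while the positive power of `u` is averaged by Jensen's inequality, which needs
    -- `e/(r - 1) ≤ 1`.
    have h1 : S.avg (fun x => W x ^ (-1 / (r - 1))) c R ≤
        (n⁻¹ * a) ^ (1 / (r - 1)) * m ^ (e / (r - 1)) := by
      calc S.avg (fun x => W x ^ (-1 / (r - 1))) c R
          ≤ ∫⁻ x, (n⁻¹ * a) ^ (1 / (r - 1)) * u x ^ (e / (r - 1)) ∂S.ballMeasure c R := by
            rw [avg_eq]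
            refine lintegral_mono_ae ?_
            filter_upwards [hwA.inv_le ha hwm hw0 hwt c hR, hac.ae_le hw0, hac.ae_le hwt,
              hac.ae_le hu0, hac.ae_le hut] with x hx h2 h3 h4 h5
            have e1 : W x ^ (-1 / (r - 1)) = (w x)⁻¹ ^ (1 / (r - 1)) * u x ^ (e / (r - 1)) := by
              rw [hW]
              simp only
              rw [ENNReal.mul_rpow_of_ne_zero h2 (by simp [ENNReal.rpow_eq_zero_iff, h5, he]),
                ← ENNReal.rpow_mul, ENNReal.inv_rpow, ← ENNReal.rpow_neg]
              congr 2
              · ring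
              · field_simp
            rw [e1]
            gcongr
        _ = (n⁻¹ * a) ^ (1 / (r - 1)) * S.avg (fun x => u x ^ (e / (r - 1))) c R := by
            rw [lintegral_const_mul'' _ ((hum.pow_const _).ballMeasure c R), avg_eq]
        _ ≤ _ := mul_le_mul_right (avg_rpow_le hum (by positivity)
            (by rw [div_le_one hr0]; exact her) c hR) _
    calc S.avg W c R * S.avg (fun x => W x ^ (-1 / (r - 1))) c R ^ (r - 1)
        ≤ (n * (m⁻¹ * b) ^ e) * ((n⁻¹ * a) ^ (1 / (r - 1)) * m ^ (e / (r - 1))) ^ (r - 1) := by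
          gcongr
          exact havg c R hR
      _ = (n * (m⁻¹ * b) ^ e) * ((n⁻¹ * a) * m ^ e) := by
          rw [ENNReal.mul_rpow_of_nonneg _ _ hr0.le, ← ENNReal.rpow_mul, ← ENNReal.rpow_mul,
            one_div_mul_cancel hr0.ne', ENNReal.rpow_one, div_mul_cancel₀ _ hr0.ne']
      _ = (n * n⁻¹) * (m * m⁻¹) ^ e * (a * b ^ e) := by
          rw [ENNReal.mul_rpow_of_nonneg _ _ he, ENNReal.mul_rpow_of_nonneg _ _ he]
          ring
      _ = a * b ^ e := by
          rw [ENNReal.mul_inv_cancel (hn0 c R hR) (hnt c R hR),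
            ENNReal.mul_inv_cancel (hm0 c R hR) (hmt c R hR), ENNReal.one_rpow, one_mul, one_mul]
  exact ⟨⟨hweight, hconst.trans_lt (ENNReal.mul_lt_top ha.lt_top
    (ENNReal.rpow_lt_top_of_nonneg he hb))⟩, hconst⟩

lemma A1With.mem_Ap {w : X → ℝ≥0∞} {a : ℝ≥0∞} (hwA : S.A1With w a) (ha : a ≠ ∞)
    (hw : S.IsWeight w) {r : ℝ} (hr : 1 ≤ r) : w ∈ S.Ap r ∧ S.apConst r w ≤ a := by
  have h := hwA.mul_rpow_neg_mem_Ap ha hw S.A1With_one ENNReal.one_ne_top aemeasurable_const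
    (by simp) (by simp) (r := r) le_rfl (by linarith)
  simpa using h

/-- Geometric means of `A₁` weights are `A₁` weights. -/
lemma A1With.geometric_mean {v w : X → ℝ≥0∞} {a b : ℝ≥0∞} (hv : S.A1With v b) (hw : S.A1With w a)
    (hvm : AEMeasurable v S.μ) (hwm : AEMeasurable w S.μ) {s : ℝ} (hs0 : 0 < s) (hs1 : s ≤ 1) :
    S.A1With (fun x => v x ^ s * w x ^ (1 - s)) (b ^ s * a ^ (1 - s)) := by
  rcases hs1.eq_or_lt with rfl | hs1
  · simpa using hv
  have hs1' : 0 < 1 - s := by linarith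
  filter_upwards [hv, hw] with x h1 h2
  refine maximal_le fun c R hR hx => ?_
  have hc : (1 / s).HolderConjugate (1 / (1 - s)) := by
    rw [Real.holderConjugate_iff]
    exact ⟨by rw [lt_div_iff₀ hs0]; linarith, by simp⟩
  have h3 := S.avg_mul_le_rpow (hvm.pow_const s) (hwm.pow_const (1 - s)) hc c R
  simp only [← ENNReal.rpow_mul, mul_one_div_cancel hs0.ne', mul_one_div_cancel hs1'.ne',
    ENNReal.rpow_one, one_div_one_div] at h3
  calc _ ≤ _ := h3
    _ ≤ (b * v x) ^ s * (a * w x) ^ (1 - s) := by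
      gcongr
      · exact (S.avg_le_maximal v hR hx).trans h1
      · exact (S.avg_le_maximal w hR hx).trans h2
    _ = _ := by
      rw [ENNReal.mul_rpow_of_nonneg _ _ hs0.le, ENNReal.mul_rpow_of_nonneg _ _ hs1'.le]
      ring

end HomogeneousSpace

/-- Hölder's inequality for weighted geometric means. -/
lemma MeasureTheory.lintegral_geometric_mean_le {α : Type*} [MeasurableSpace α] {μ : Measure α}
    {f g : α → ℝ≥0∞} (hf : AEMeasurable f μ) (hg : AEMeasurable g μ) {s : ℝ} (hs0 : 0 < s)
    (hs1 : s < 1) :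
    ∫⁻ x, f x ^ s * g x ^ (1 - s) ∂μ ≤ (∫⁻ x, f x ∂μ) ^ s * (∫⁻ x, g x ∂μ) ^ (1 - s) := by
  have hs1' : 0 < 1 - s := by linarith
  have hc : (1 / s).HolderConjugate (1 / (1 - s)) := by
    rw [Real.holderConjugate_iff]
    exact ⟨by rw [lt_div_iff₀ hs0]; linarith, by simp⟩
  have h := ENNReal.lintegral_mul_le_Lp_mul_Lq μ hc (hf.pow_const s) (hg.pow_const (1 - s))
  simpa only [Pi.mul_apply, ← ENNReal.rpow_mul, mul_one_div_cancel hs0.ne',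
    mul_one_div_cancel hs1'.ne', ENNReal.rpow_one, one_div_one_div] using h

/-! ### Off-diagonal extrapolation for `A₁` weights. -/

namespace HomogeneousSpace

variable {X : Type*} [MeasurableSpace X] {S : HomogeneousSpace X}

lemma A1With.ae_ne_zero {u : X → ℝ≥0∞} {b : ℝ≥0∞} (hu : S.A1With u b) (hum : AEMeasurable u S.μ)
    (h0 : ¬ ∀ᵐ x ∂S.μ, u x = 0) : ∀ᵐ x ∂S.μ, u x ≠ 0 := by
  filter_upwards [hu] with x hx hux
  have := S.maximal_pos hum h0 x
  rw [hux, mul_zero] at hx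
  exact absurd hx (not_le.2 this)

/-- Extrapolation downwards, from the exponents `(p₀, q₀)` to `(p, q)` with `q < q₀`, for `A₁`
weights. -/
lemma extrapolate_down {p₀ q₀ p q : ℝ} (hp₀ : 1 ≤ p₀) (hq₀ : 1 ≤ q₀) (hp : 1 < p) (hq : 1 < q)
    (hpq : 1 / p - 1 / q = 1 / p₀ - 1 / q₀) (hlt : q < q₀) {r e : ℝ}
    (hr : r = gammaExponent p₀ q₀ * q) (he : e = gammaExponent p₀ q₀ * (q₀ - q))
    {f g w : X → ℝ≥0∞} (hf : AEMeasurable f S.μ) (hg : AEMeasurable g S.μ) {a : ℝ≥0} (ha : 2 ≤ a)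
    (hw : S.IsWeight w) (hwA : S.A1With w a) {K : ℝ≥0∞}
    (hK : ∀ W ∈ S.Ap (1 + q₀ * (1 - 1 / p₀)), S.apConst (1 + q₀ * (1 - 1 / p₀)) W ≤
        a * (2 * ENNReal.ofReal (S.cbar * r * a ^ (1 / (r - 1)))) ^ e →
      (∫⁻ x, g x ^ q₀ * W x ∂S.μ) ^ (1 / q₀) ≤
        K * (∫⁻ x, f x ^ p₀ * W x ^ (p₀ / q₀) ∂S.μ) ^ (1 / p₀)) (hK0 : K ≠ 0) :
    (∫⁻ x, g x ^ q * w x ∂S.μ) ^ (1 / q) ≤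
      2 * K * (∫⁻ x, f x ^ p * w x ^ (p / q) ∂S.μ) ^ (1 / p) := by
  have hp₀0 : 0 < p₀ := by linarith
  have hq₀0 : 0 < q₀ := by linarith
  have hp0 : 0 < p := by linarith
  have hq0 : 0 < q := by linarith
  have hγ : gammaExponent p₀ q₀ = 1 / q + (1 - 1 / p) := by unfold gammaExponent; linarith
  have hr' : r = 1 + q * (1 - 1 / p) := by rw [hr, hγ]; field_simp
  have hp1 : 0 < 1 - 1 / p := by rw [sub_pos, div_lt_one hp0]; exact hp
  have hr1 : 1 < r := by rw [hr']; have := mul_pos hq0 hp1; linarith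
  have hr0 : 0 < r := by linarith
  have hr₀ : 1 + q₀ * (1 - 1 / p₀) = gammaExponent p₀ q₀ * q₀ := by
    unfold gammaExponent; field_simp
  have hγ0 : 0 < gammaExponent p₀ q₀ := by rw [hγ]; positivity
  have he0 : 0 < e := by rw [he]; exact mul_pos hγ0 (by linarith)
  have her : e ≤ 1 + q₀ * (1 - 1 / p₀) - 1 := by
    rw [hr₀, he, mul_sub, ← hr]; linarith
  have hqq : 0 < 1 / q - 1 / q₀ := sub_pos.2 (one_div_lt_one_div_of_lt hq0 hlt)
  have hpp : p < p₀ := by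
    have : 1 / p₀ < 1 / p := by linarith
    exact (one_div_lt_one_div hp₀0 hp0).1 this
  have hwm := hw.aemeasurable
  have hw0 := hw.ae_ne_zero
  have hwt := hw.ae_ne_top
  set J := ∫⁻ x, f x ^ p * w x ^ (p / q) ∂S.μ with hJ
  rcases eq_or_ne J ∞ with hJt | hJt
  · rw [hJt, ENNReal.top_rpow_of_pos (by positivity),
      ENNReal.mul_top (mul_ne_zero (by norm_num) hK0)]
    exact le_top
  set b : ℝ≥0∞ := 2 * ENNReal.ofReal (S.cbar * r * a ^ (1 / (r - 1))) with hb
  have ha1 : (1 : ℝ) ≤ a := by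
    have : (2 : ℝ) ≤ a := by exact_mod_cast ha
    linarith
  have hb1 : 1 ≤ b := by
    have h1 : (1 : ℝ) ≤ S.cbar * r * a ^ (1 / (r - 1)) := by
      have := S.one_le_cbar
      have h2 : (1 : ℝ) ≤ a ^ (1 / (r - 1)) :=
        Real.one_le_rpow ha1 (one_div_nonneg.2 (by linarith))
      exact one_le_mul_of_one_le_of_one_le (one_le_mul_of_one_le_of_one_le this hr1.le) h2
    calc (1 : ℝ≥0∞) ≤ 1 * ENNReal.ofReal 1 := by simp
      _ ≤ b := by rw [hb]; gcongr; norm_num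
  have hbt : b ≠ ∞ := ENNReal.mul_ne_top (by norm_num) ENNReal.ofReal_ne_top
  -- The choice makes `h^r w = f^p w^{p/q}`, so the right-hand side of the goal is a power of the
  -- `L^r(w)` norm of `h`.
  set h : X → ℝ≥0∞ := fun x => (f x ^ p * w x ^ (p / q - 1)) ^ (1 / r) with hh
  have hhm : AEMeasurable h S.μ := ((hf.pow_const p).fun_mul (hwm.pow_const _)).pow_const _
  have hhr : ∀ x, h x ^ r = f x ^ p * w x ^ (p / q - 1) := fun x => by
    rw [hh]; simp only; rw [← ENNReal.rpow_mul, one_div_mul_cancel hr0.ne', ENNReal.rpow_one]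
  have hhJ : ∫⁻ x, h x ^ r * w x ∂S.μ = J := by
    refine lintegral_congr_ae ?_
    filter_upwards [hw0, hwt] with x h0 h1
    rw [hhr, mul_assoc]
    congr 1
    nth_rewrite 2 [← ENNReal.rpow_one (w x)]
    rw [← ENNReal.rpow_add _ _ h0 h1, sub_add_cancel]
  -- If `h` vanishes, its majorant may vanish too and cannot be raised to a negative power. In that
  -- case `f = 0`, and the hypothesis for the weight `w` itself forces `g = 0`.
  by_cases hf0 : ∀ᵐ x ∂S.μ, h x = 0
  · have hfz : ∀ᵐ x ∂S.μ, f x = 0 := by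
      filter_upwards [hf0, hw0, hwt] with x h1 h2 h3
      have h4 := hhr x
      rw [h1, ENNReal.zero_rpow_of_pos hr0] at h4
      rcases mul_eq_zero.1 h4.symm with h5 | h5
      · exact (ENNReal.rpow_eq_zero_iff_of_pos hp0).1 h5
      · simp [ENNReal.rpow_eq_zero_iff, h2, h3] at h5
    have hA := hwA.mem_Ap ENNReal.coe_ne_top hw (r := 1 + q₀ * (1 - 1 / p₀)) (by linarith)
    have h1 := hK w hA.1 (hA.2.trans (le_mul_of_one_le_right'
      (ENNReal.one_le_rpow hb1 he0)))
    have h2 : ∫⁻ x, f x ^ p₀ * w x ^ (p₀ / q₀) ∂S.μ = 0 := by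
      rw [lintegral_eq_zero_iff' ((hf.pow_const _).fun_mul (hwm.pow_const _))]
      filter_upwards [hfz] with x hx
      simp [hx, hp₀0]
    rw [h2, ENNReal.zero_rpow_of_pos (by positivity), mul_zero, nonpos_iff_eq_zero,
      ENNReal.rpow_eq_zero_iff_of_pos (by positivity),
      lintegral_eq_zero_iff' ((hg.pow_const _).fun_mul hwm)] at h1
    have h3 : ∫⁻ x, g x ^ q * w x ∂S.μ = 0 := by
      rw [lintegral_eq_zero_iff' ((hg.pow_const _).fun_mul hwm)]
      filter_upwards [h1, hw0] with x hx hx0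
      have h4 : g x ^ q₀ * w x = 0 := hx
      rcases mul_eq_zero.1 h4 with h5 | h5
      · simp [(ENNReal.rpow_eq_zero_iff_of_pos hq₀0).1 h5, hq0]
      · exact absurd h5 hx0
    rw [h3, ENNReal.zero_rpow_of_pos (by positivity)]
    exact zero_le
  obtain ⟨u, hum, hhu, huA, hui⟩ := S.exists_A1_majorant hwA ha hwm hr1 hhm
  rw [hhJ] at hui
  rw [← hb] at huA
  have hu0 : ∀ᵐ x ∂S.μ, u x ≠ 0 := huA.ae_ne_zero hum fun hcon =>
    hf0 (hcon.mono fun x hx => le_antisymm ((hhu x).trans hx.le) zero_le)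
  have hut : ∀ᵐ x ∂S.μ, u x ≠ ∞ := by
    have h1 : ∫⁻ x, u x ^ r * w x ∂S.μ ≠ ∞ := (hui.trans_lt (ENNReal.mul_lt_top
      (ENNReal.rpow_lt_top_of_nonneg hr0.le (by norm_num)) hJt.lt_top)).ne
    filter_upwards [ae_lt_top' ((hum.pow_const r).fun_mul hwm) h1, hw0] with x hx hx0 hux
    rw [hux, ENNReal.top_rpow_of_pos hr0, ENNReal.top_mul hx0] at hx
    exact lt_irrefl _ hx
  have hW := hwA.mul_rpow_neg_mem_Ap ENNReal.coe_ne_top hw huA hbt hum hu0 hut he0.le her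
  have hmain := hK _ hW.1 hW.2
  -- Since `h ≤ u`, the excess power `f^{p₀-p}` is bounded by powers of `u` and `w`. The exponent
  -- relation makes the powers of `u` cancel those in the test weight and leaves `w^{p/q}`.
  have hfW : ∫⁻ x, f x ^ p₀ * (w x * u x ^ (-e)) ^ (p₀ / q₀) ∂S.μ ≤ J := by
    refine lintegral_mono_ae ?_
    filter_upwards [hw0, hwt, hu0, hut] with x h0 h1 h2 h3
    have h4 : f x ^ p ≤ u x ^ r * w x ^ (1 - p / q) := by
      have h5 : f x ^ p * w x ^ (p / q - 1) ≤ u x ^ r := by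
        rw [← hhr]; exact ENNReal.rpow_le_rpow (hhu x) hr0.le
      calc f x ^ p = f x ^ p * w x ^ (p / q - 1) * w x ^ (1 - p / q) := by
            rw [mul_assoc, ← ENNReal.rpow_add _ _ h0 h1]; simp
        _ ≤ _ := mul_le_mul_left h5 _
    have e1 : f x ^ p₀ = f x ^ p * (f x ^ p) ^ ((p₀ - p) / p) := by
      rw [← ENNReal.rpow_mul, ← ENNReal.rpow_add_of_nonneg _ _ hp0.le
        (mul_nonneg hp0.le (div_nonneg (by linarith) hp0.le))]
      congr 1; field_simp; ring
    have hd : 0 ≤ (p₀ - p) / p := div_nonneg (by linarith) hp0.le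
    calc f x ^ p₀ * (w x * u x ^ (-e)) ^ (p₀ / q₀)
        ≤ f x ^ p * (u x ^ r * w x ^ (1 - p / q)) ^ ((p₀ - p) / p) *
          (w x * u x ^ (-e)) ^ (p₀ / q₀) := by rw [e1]; gcongr
      _ = f x ^ p * ((w x ^ ((1 - p / q) * ((p₀ - p) / p)) * w x ^ (p₀ / q₀)) *
          (u x ^ (r * ((p₀ - p) / p)) * u x ^ (-e * (p₀ / q₀)))) := by
          rw [ENNReal.mul_rpow_of_nonneg _ _ hd, ENNReal.mul_rpow_of_nonneg _ _ (by positivity),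
            ← ENNReal.rpow_mul, ← ENNReal.rpow_mul, ← ENNReal.rpow_mul]
          ring
      _ = f x ^ p * w x ^ (p / q) := by
          rw [← ENNReal.rpow_add _ _ h0 h1, ← ENNReal.rpow_add _ _ h2 h3]
          have e2 : r * ((p₀ - p) / p) + -e * (p₀ / q₀) = 0 := by
            have e3 : p₀ * (1 / p - 1 / p₀) = p₀ * (1 / q - 1 / q₀) := by
              congr 1; linarith
            have e4 : (p₀ - p) / p = p₀ * (1 / p - 1 / p₀) := by field_simp
            rw [e4, e3, hr, he]; field_simp; ring
          have e5 : (1 - p / q) * ((p₀ - p) / p) + p₀ / q₀ = p / q := by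
            have e6 : p₀ * (1 / p - 1 / q + 1 / q₀) = 1 := by
              rw [hpq]; field_simp; ring
            calc _ = p₀ * (1 / p - 1 / q + 1 / q₀) - 1 + p / q := by field_simp; ring
              _ = _ := by rw [e6]; ring
          rw [e2, e5, ENNReal.rpow_zero, mul_one]
  -- With `e = γ(q₀ - q)` and `r = γq`, the function `g^q w` is the geometric mean of `g^{q₀} w
  -- u^{-e}` and `u^r w`.
  have hgW : ∫⁻ x, g x ^ q * w x ∂S.μ ≤ (∫⁻ x, g x ^ q₀ * (w x * u x ^ (-e)) ∂S.μ) ^ (q / q₀) *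
      (∫⁻ x, u x ^ r * w x ∂S.μ) ^ (1 - q / q₀) := by
    have hθ1 : q / q₀ < 1 := (div_lt_one hq₀0).2 hlt
    refine le_trans (le_of_eq ?_) (lintegral_geometric_mean_le
      ((hg.pow_const q₀).fun_mul (hwm.fun_mul (hum.pow_const (-e))))
      ((hum.pow_const r).fun_mul hwm) (s := q / q₀) (by positivity) hθ1)
    refine lintegral_congr_ae ?_
    filter_upwards [hw0, hwt, hu0, hut] with x h0 h1 h2 h3
    have hs : 0 ≤ 1 - q / q₀ := by linarith
    rw [ENNReal.mul_rpow_of_nonneg _ _ (by positivity),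
      ENNReal.mul_rpow_of_nonneg _ _ (by positivity), ENNReal.mul_rpow_of_nonneg _ _ hs,
      ← ENNReal.rpow_mul, ← ENNReal.rpow_mul, ← ENNReal.rpow_mul]
    calc g x ^ q * w x = g x ^ q * w x ^ (q / q₀ + (1 - q / q₀)) *
          u x ^ (-e * (q / q₀) + r * (1 - q / q₀)) := by
          have e1 : -e * (q / q₀) + r * (1 - q / q₀) = 0 := by rw [hr, he]; field_simp; ring
          rw [e1, ENNReal.rpow_zero, mul_one, add_sub_cancel, ENNReal.rpow_one]
      _ = _ := by
          rw [ENNReal.rpow_add _ _ h0 h1, ENNReal.rpow_add _ _ h2 h3,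
            show q₀ * (q / q₀) = q by field_simp]
          ring
  -- This is the exponent with which the factor 2 of the majorant enters the result, so at most one
  -- factor 2 is lost.
  have hexp : r * (1 / q - 1 / q₀) ≤ 1 := by
    have h1 : 0 < 1 / p₀ := by positivity
    have h2 : r * (1 / q - 1 / q₀) = e / q₀ := by rw [hr, he]; field_simp
    rw [h2, div_le_one hq₀0]
    have h3 : q₀ * (1 - 1 / p₀) ≤ q₀ * 1 := by gcongr; linarith
    linarith
  calc (∫⁻ x, g x ^ q * w x ∂S.μ) ^ (1 / q)
      ≤ ((∫⁻ x, g x ^ q₀ * (w x * u x ^ (-e)) ∂S.μ) ^ (q / q₀) *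
        (∫⁻ x, u x ^ r * w x ∂S.μ) ^ (1 - q / q₀)) ^ (1 / q) := by gcongr
    _ = (∫⁻ x, g x ^ q₀ * (w x * u x ^ (-e)) ∂S.μ) ^ (1 / q₀) *
        (∫⁻ x, u x ^ r * w x ∂S.μ) ^ (1 / q - 1 / q₀) := by
        rw [ENNReal.mul_rpow_of_nonneg _ _ (by positivity), ← ENNReal.rpow_mul,
          ← ENNReal.rpow_mul]
        congr 2 <;> field_simp
    _ ≤ (K * J ^ (1 / p₀)) * (2 ^ r * J) ^ (1 / q - 1 / q₀) := by
        gcongr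
        exact hmain.trans (by gcongr)
    _ = 2 ^ (r * (1 / q - 1 / q₀)) * K * (J ^ (1 / p₀) * J ^ (1 / q - 1 / q₀)) := by
        rw [ENNReal.mul_rpow_of_nonneg _ _ hqq.le, ← ENNReal.rpow_mul]
        ring
    _ = 2 ^ (r * (1 / q - 1 / q₀)) * K * J ^ (1 / p) := by
        rw [← ENNReal.rpow_add_of_nonneg _ _ (by positivity) hqq.le]
        congr 2; linarith
    _ ≤ 2 ^ (1 : ℝ) * K * J ^ (1 / p) := by
        gcongr
        norm_num
    _ = _ := by rw [ENNReal.rpow_one]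

end HomogeneousSpace

namespace HomogeneousSpace

variable {X : Type*} [MeasurableSpace X] {S : HomogeneousSpace X}

/-- Extrapolation upwards, from the exponents `(p₀, q₀)` to `(p, q)` with `q₀ < q`, for `A₁`
weights. -/
lemma extrapolate_up {p₀ q₀ p q : ℝ} (hp₀ : 1 ≤ p₀) (hq₀ : 1 ≤ q₀) (hp : 1 < p) (hq : 1 < q)
    (hpq : 1 / p - 1 / q = 1 / p₀ - 1 / q₀) (hlt : q₀ < q) {r s : ℝ}
    (hr : r = gammaExponent p₀ q₀ * q) (hs : s = gammaExponent p₀ q₀ * (q - q₀) / (r - 1))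
    {f g w : X → ℝ≥0∞} (hf : AEMeasurable f S.μ) (hg : AEMeasurable g S.μ) {a : ℝ≥0} (ha : 1 ≤ a)
    (hw : S.IsWeight w) (hwA : S.A1With w a) {K : ℝ≥0∞}
    (hK : ∀ W ∈ S.Ap (1 + q₀ * (1 - 1 / p₀)), S.apConst (1 + q₀ * (1 - 1 / p₀)) W ≤
        (2 * ENNReal.ofReal (S.cbar * r * a)) ^ s * a ^ (1 - s) →
      (∫⁻ x, g x ^ q₀ * W x ∂S.μ) ^ (1 / q₀) ≤
        K * (∫⁻ x, f x ^ p₀ * W x ^ (p₀ / q₀) ∂S.μ) ^ (1 / p₀))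
    (hJt : ∫⁻ x, g x ^ q * w x ∂S.μ ≠ ∞) :
    (∫⁻ x, g x ^ q * w x ∂S.μ) ^ (1 / q) ≤
      2 * K * (∫⁻ x, f x ^ p * w x ^ (p / q) ∂S.μ) ^ (1 / p) := by
  have hp₀0 : 0 < p₀ := by linarith
  have hq₀0 : 0 < q₀ := by linarith
  have hp0 : 0 < p := by linarith
  have hq0 : 0 < q := by linarith
  have hγ : gammaExponent p₀ q₀ = 1 / q + (1 - 1 / p) := by unfold gammaExponent; linarith
  have hr' : r = 1 + q * (1 - 1 / p) := by rw [hr, hγ]; field_simp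
  have hp1 : 0 < 1 - 1 / p := by rw [sub_pos, div_lt_one hp0]; exact hp
  have hr1 : 0 < r - 1 := by rw [hr']; have := mul_pos hq0 hp1; linarith
  have hr0 : 0 < r := by linarith
  have hr₀ : 1 + q₀ * (1 - 1 / p₀) = gammaExponent p₀ q₀ * q₀ := by
    unfold gammaExponent; field_simp
  have hp₀1 : 0 ≤ 1 - 1 / p₀ := by rw [sub_nonneg, div_le_one hp₀0]; exact hp₀
  have hr₀1 : 1 ≤ 1 + q₀ * (1 - 1 / p₀) := by have := mul_nonneg hq₀0.le hp₀1; linarith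
  have hγ0 : 0 < gammaExponent p₀ q₀ := by rw [hγ]; positivity
  have hs0 : 0 < s := by rw [hs]; exact div_pos (mul_pos hγ0 (by linarith)) hr1
  have hs1 : s ≤ 1 := by
    rw [hs, div_le_one hr1, mul_sub, ← hr, ← hr₀]; linarith
  have hqq : 0 < 1 / q₀ - 1 / q := sub_pos.2 (one_div_lt_one_div_of_lt hq₀0 hlt)
  have hpp : p₀ < p := by
    have : 1 / p < 1 / p₀ := by linarith
    exact (one_div_lt_one_div hp0 hp₀0).1 this
  have hwm := hw.aemeasurable
  have hw0 := hw.ae_ne_zero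
  have hwt := hw.ae_ne_top
  set t := r / (r - 1) with ht
  have ht0 : 0 < t := div_pos hr0 hr1
  have htr : t.HolderConjugate r := by
    rw [Real.holderConjugate_comm, Real.holderConjugate_iff_eq_conjExponent (by linarith)]
  have hts : q / t * s = q - q₀ := by
    rw [hs, ht]
    have := hr1.ne'
    have e : gammaExponent p₀ q₀ * q = r := hr.symm
    field_simp
    linear_combination (q - q₀) * e
  have hts2 : t * (1 / q₀ - 1 / q) = s / q₀ := by
    rw [hs, ht]; nth_rewrite 1 [hr]; field_simp
  set J := ∫⁻ x, g x ^ q * w x ∂S.μ with hJ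
  set I := ∫⁻ x, f x ^ p * w x ^ (p / q) ∂S.μ with hI
  rcases eq_or_ne J 0 with hJ0 | hJ0
  · rw [hJ0, ENNReal.zero_rpow_of_pos (by positivity)]
    exact zero_le
  -- Here the iteration starts from a power of `g`, normalised by `k^t w = g^q w`.
  set k : X → ℝ≥0∞ := fun x => g x ^ (q / t) with hk
  have hkm : AEMeasurable k S.μ := hg.pow_const _
  have hkJ : ∫⁻ x, k x ^ t * w x ∂S.μ = J := by
    refine lintegral_congr fun x => ?_
    rw [hk]; simp only
    rw [← ENNReal.rpow_mul, div_mul_cancel₀ _ ht0.ne']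
  obtain ⟨v, hvm, hkv, hvA, hvi⟩ := S.exists_dual_A1_majorant hwA ha hwm hw0 hwt htr hkm
  rw [hkJ] at hvi
  set b : ℝ≥0∞ := 2 * ENNReal.ofReal (S.cbar * r * a) with hb
  have hbt : b ≠ ∞ := ENNReal.mul_ne_top (by norm_num) ENNReal.ofReal_ne_top
  have hvwm : AEMeasurable (fun x => v x * w x) S.μ := hvm.fun_mul hwm
  have hvw0 : ∀ᵐ x ∂S.μ, v x * w x ≠ 0 := by
    refine hvA.ae_ne_zero hvwm fun hcon => hJ0 ?_
    rw [← hkJ, lintegral_eq_zero_iff' ((hkm.pow_const t).fun_mul hwm)]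
    filter_upwards [hcon, hw0] with x hx h0
    have hv0 : v x = 0 := (mul_eq_zero.1 hx).resolve_right h0
    have hk0 : k x = 0 := le_antisymm ((hkv x).trans hv0.le) zero_le
    simp [hk0, ht0]
  have hvwt : ∀ᵐ x ∂S.μ, v x * w x ≠ ∞ := by
    have h1 : ∫⁻ x, v x ^ t * w x ∂S.μ ≠ ∞ := (hvi.trans_lt (ENNReal.mul_lt_top
      (ENNReal.rpow_lt_top_of_nonneg ht0.le (by norm_num)) hJt.lt_top)).ne
    filter_upwards [ae_lt_top' ((hvm.pow_const t).fun_mul hwm) h1, hw0, hwt] with x hx hx0 hxt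
    refine ENNReal.mul_ne_top (fun hux => ?_) hxt
    rw [hux, ENNReal.top_rpow_of_pos ht0, ENNReal.top_mul hx0] at hx
    exact lt_irrefl _ hx
  -- This equals `v^s w`; the geometric mean form shows that it satisfies an `A₁` condition. The
  -- exponent `s` is such that `k^s = g^{q-q₀}`, hence `g^q ≤ g^{q₀} v^s`.
  set W : X → ℝ≥0∞ := fun x => (v x * w x) ^ s * w x ^ (1 - s) with hW
  have hs1' : 0 ≤ 1 - s := by linarith
  have hWeq : ∀ x, W x = v x ^ s * w x := by
    intro x
    rw [hW]; simp only
    rw [ENNReal.mul_rpow_of_nonneg _ _ hs0.le, mul_assoc,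
      ← ENNReal.rpow_add_of_nonneg _ _ hs0.le hs1', add_sub_cancel, ENNReal.rpow_one]
  have hWm : AEMeasurable W S.μ := (hvwm.pow_const s).fun_mul (hwm.pow_const _)
  have hWA := hvA.geometric_mean hwA hvwm hwm hs0 hs1
  have hct : b ^ s * (a : ℝ≥0∞) ^ (1 - s) ≠ ∞ := ENNReal.mul_ne_top
    (ENNReal.rpow_ne_top_of_nonneg hs0.le hbt)
    (ENNReal.rpow_ne_top_of_nonneg hs1' ENNReal.coe_ne_top)
  have hWw : S.IsWeight W := by
    refine hWA.isWeight hct hWm ?_ ?_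
    · filter_upwards [hvw0, hw0, hvwt, hwt] with x h1 h2 h3 h4
      exact mul_ne_zero (by simp [ENNReal.rpow_eq_zero_iff, h1, h3])
        (by simp [ENNReal.rpow_eq_zero_iff, h2, h4])
    · filter_upwards [hvwt, hwt] with x h3 h4
      exact ENNReal.mul_ne_top (ENNReal.rpow_ne_top_of_nonneg hs0.le h3)
        (ENNReal.rpow_ne_top_of_nonneg hs1' h4)
  have hmem := hWA.mem_Ap hct hWw hr₀1
  have hmain := hK W hmem.1 hmem.2
  have hJle : J ≤ ∫⁻ x, g x ^ q₀ * W x ∂S.μ := by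
    refine lintegral_mono fun x => ?_
    rw [hWeq, ← mul_assoc]
    refine mul_le_mul_left ?_ _
    calc g x ^ q = g x ^ q₀ * k x ^ s := by
          rw [hk]; simp only
          rw [← ENNReal.rpow_mul, hts, ← ENNReal.rpow_add_of_nonneg _ _ hq₀0.le (by linarith),
            add_sub_cancel]
      _ ≤ g x ^ q₀ * v x ^ s := mul_le_mul_right (ENNReal.rpow_le_rpow (hkv x) hs0.le) _
  have hp₀p : p₀ / p < 1 := (div_lt_one hp0).2 hpp
  have hexp : p₀ * (1 / p₀ - 1 / p) = p₀ * (1 / q₀ - 1 / q) := by congr 1; linarith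
  have hfW : ∫⁻ x, f x ^ p₀ * W x ^ (p₀ / q₀) ∂S.μ ≤
      I ^ (p₀ / p) * (∫⁻ x, v x ^ t * w x ∂S.μ) ^ (1 - p₀ / p) := by
    refine le_trans (le_of_eq (lintegral_congr fun x => ?_)) (lintegral_geometric_mean_le
      ((hf.pow_const p).fun_mul (hwm.pow_const (p / q)))
      ((hvm.pow_const t).fun_mul hwm) (s := p₀ / p) (by positivity) hp₀p)
    have h1 : 0 ≤ 1 - p₀ / p := by linarith
    rw [hWeq, ENNReal.mul_rpow_of_nonneg _ _ (by positivity),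
      ENNReal.mul_rpow_of_nonneg _ _ (by positivity), ENNReal.mul_rpow_of_nonneg _ _ h1,
      ← ENNReal.rpow_mul, ← ENNReal.rpow_mul, ← ENNReal.rpow_mul, ← ENNReal.rpow_mul]
    have e0 : 1 - p₀ / p = p₀ * (1 / q₀ - 1 / q) := by rw [← hexp]; field_simp
    have e1 : p₀ / q₀ = p / q * (p₀ / p) + (1 - p₀ / p) := by rw [e0]; field_simp; ring
    have e2 : t * (1 - p₀ / p) = s * (p₀ / q₀) := by
      rw [e0]
      calc _ = p₀ * (t * (1 / q₀ - 1 / q)) := by ring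
        _ = _ := by rw [hts2]; ring
    have e3 : w x ^ (p₀ / q₀) = w x ^ (p / q * (p₀ / p)) * w x ^ (1 - p₀ / p) := by
      rw [← ENNReal.rpow_add_of_nonneg _ _ (by positivity) h1, ← e1]
    rw [e2, e3, show p * (p₀ / p) = p₀ by field_simp]
    ring
  have hδ : 1 / p₀ - 1 / p = 1 / q₀ - 1 / q := by linarith
  -- The size of `v` is controlled by `J` itself, so a power of `J` appears on both sides. It can be
  -- cancelled because `J` is neither zero nor infinite.
  have hfinal : J ^ (1 / q) * J ^ (1 / q₀ - 1 / q) ≤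
      (2 * K * I ^ (1 / p)) * J ^ (1 / q₀ - 1 / q) := by
    rw [← ENNReal.rpow_add_of_nonneg _ _ (by positivity) hqq.le, add_sub_cancel]
    calc J ^ (1 / q₀) ≤ (∫⁻ x, g x ^ q₀ * W x ∂S.μ) ^ (1 / q₀) := by gcongr
      _ ≤ K * (I ^ (p₀ / p) * (2 ^ t * J) ^ (1 - p₀ / p)) ^ (1 / p₀) := by
          have h1 : 0 ≤ 1 - p₀ / p := by linarith
          refine hmain.trans (mul_le_mul_right (ENNReal.rpow_le_rpow (hfW.trans ?_)
            (by positivity)) _)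
          gcongr
      _ = 2 ^ (t * (1 / q₀ - 1 / q)) * K * I ^ (1 / p) * J ^ (1 / q₀ - 1 / q) := by
          rw [ENNReal.mul_rpow_of_nonneg _ _ (by positivity), ← ENNReal.rpow_mul,
            ← ENNReal.rpow_mul, show p₀ / p * (1 / p₀) = 1 / p by field_simp,
            show (1 - p₀ / p) * (1 / p₀) = 1 / q₀ - 1 / q by rw [← hδ]; field_simp,
            ENNReal.mul_rpow_of_nonneg _ _ hqq.le, ← ENNReal.rpow_mul]
          ring
      _ ≤ 2 ^ (1 : ℝ) * K * I ^ (1 / p) * J ^ (1 / q₀ - 1 / q) := by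
          gcongr
          · norm_num
          · rw [hts2, div_le_one hq₀0]; linarith
      _ = _ := by rw [ENNReal.rpow_one]
  have hJpow0 : J ^ (1 / q₀ - 1 / q) ≠ 0 := by simp [ENNReal.rpow_eq_zero_iff, hJ0, hJt]
  have hJpowt : J ^ (1 / q₀ - 1 / q) ≠ ∞ := ENNReal.rpow_ne_top_of_nonneg hqq.le hJt
  exact (ENNReal.mul_le_mul_iff_left hJpow0 hJpowt).1 hfinal

/-- Off-diagonal extrapolation for `A₁` weights with explicit constants. -/
lemma extrapolate [Nonempty X] {p₀ q₀ p q : ℝ} (hp₀ : 1 ≤ p₀) (hq₀ : 1 ≤ q₀) (hp : 1 < p)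
    (hq : 1 < q) (hpq : 1 / p - 1 / q = 1 / p₀ - 1 / q₀) {C : ℝ} (hC : 0 < C) {N : ℝ → ℝ}
    (hNpos : ∀ t, 1 ≤ t → 0 < N t) (hNmono : MonotoneOn N (Set.Ici 1))
    {f g w : X → ℝ≥0∞} (hf : AEMeasurable f S.μ) (hg : AEMeasurable g S.μ)
    (hweighted : ∀ w ∈ S.Ap (1 + q₀ * (1 - 1 / p₀)), (∫⁻ x, g x ^ q₀ * w x ∂S.μ) ^ (1 / q₀) ≤
        ENNReal.ofReal (C * N (S.apConst (1 + q₀ * (1 - 1 / p₀)) w).toReal) *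
          (∫⁻ x, f x ^ p₀ * w x ^ (p₀ / q₀) ∂S.μ) ^ (1 / p₀))
    {m : ℝ≥0} (hm : 1 ≤ m) (hw : S.IsWeight w) (hwA : S.A1With w (2 * m))
    (hJt : ∫⁻ x, g x ^ q * w x ∂S.μ ≠ ∞) :
    0 < Kbar C N S.cbar p₀ q₀ p q m ∧ (∫⁻ x, g x ^ q * w x ∂S.μ) ^ (1 / q) ≤
      2 * ENNReal.ofReal (Kbar C N S.cbar p₀ q₀ p q m) *
        (∫⁻ x, f x ^ p * w x ^ (p / q) ∂S.μ) ^ (1 / p) := by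
  have hp₀0 : 0 < p₀ := by linarith
  have hq₀0 : 0 < q₀ := by linarith
  have hp0 : 0 < p := by linarith
  have hq0 : 0 < q := by linarith
  have hm' : (1 : ℝ) ≤ m := by exact_mod_cast hm
  have hc := S.one_le_cbar
  have hp₀1 : 0 ≤ 1 - 1 / p₀ := by rw [sub_nonneg, div_le_one hp₀0]; exact hp₀
  have hr₀1 : 1 ≤ 1 + q₀ * (1 - 1 / p₀) := by have := mul_nonneg hq₀0.le hp₀1; linarith
  have hγ : gammaExponent p₀ q₀ = 1 / q + (1 - 1 / p) := by unfold gammaExponent; linarith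
  set r := gammaExponent p₀ q₀ * q with hr
  have hp1 : 0 < 1 - 1 / p := by rw [sub_pos, div_lt_one hp0]; exact hp
  have hr' : r = 1 + q * (1 - 1 / p) := by rw [hr, hγ]; field_simp
  have hr1 : 0 < r - 1 := by rw [hr']; have := mul_pos hq0 hp1; linarith
  have hrc : 1 + q / p.conjExponent = r := by
    rw [hr', Real.conjExponent]
    have : p - 1 ≠ 0 := by linarith
    field_simp
  have hγ0 : 0 < gammaExponent p₀ q₀ := by rw [hγ]; positivity
  have key : ∀ T : ℝ, 0 ≤ T → ∀ W ∈ S.Ap (1 + q₀ * (1 - 1 / p₀)),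
      S.apConst (1 + q₀ * (1 - 1 / p₀)) W ≤ ENNReal.ofReal T →
      (∫⁻ x, g x ^ q₀ * W x ∂S.μ) ^ (1 / q₀) ≤ ENNReal.ofReal (C * N T) *
        (∫⁻ x, f x ^ p₀ * W x ^ (p₀ / q₀) ∂S.μ) ^ (1 / p₀) := by
    intro T hT W hW hWT
    refine (hweighted W hW).trans ?_
    have h1 : 1 ≤ (S.apConst (1 + q₀ * (1 - 1 / p₀)) W).toReal :=
      by
      rw [← ENNReal.toReal_one]
      exact ENNReal.toReal_mono hW.2.ne (hW.1.one_le_apConst hr₀1)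
    have h2 : (S.apConst (1 + q₀ * (1 - 1 / p₀)) W).toReal ≤ T :=
      ENNReal.toReal_le_of_le_ofReal hT hWT
    gcongr
    exact hNmono h1 (h1.trans h2) h2
  have ha2 : (2 : ℝ≥0) ≤ 2 * m := by
    calc (2 : ℝ≥0) = 2 * 1 := by norm_num
      _ ≤ _ := by gcongr
  have hwA' : S.A1With w ((2 * m : ℝ≥0) : ℝ≥0∞) := by push_cast; exact hwA
  have hB : 1 ≤ 2 * S.cbar * r := by nlinarith
  have hB0 : 0 < 2 * S.cbar * r := by linarith
  have h2m : (1 : ℝ) ≤ 2 * m := by linarith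
  have h2m0 : (0 : ℝ) < 2 * m := by linarith
  rcases lt_trichotomy q q₀ with hlt | rfl | hlt
  · set e := gammaExponent p₀ q₀ * (q₀ - q) with he
    have he0 : 0 < e := mul_pos hγ0 (by linarith)
    -- This is the identity `r - 1 = q/p'`, which rewrites the exponent in the stated constant in
    -- terms of the exponents of the construction.
    have hexp : gammaExponent p₀ q₀ * p.conjExponent * (q₀ - q) / q = 1 / (r - 1) * e := by
      rw [hr', he, Real.conjExponent]
      have : p - 1 ≠ 0 := by linarith
      field_simp
      ring
    set T := (2 * S.cbar * r) ^ e * (2 * (m : ℝ)) ^ (1 + 1 / (r - 1) * e) with hT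
    have hT1 : 1 ≤ T := one_le_mul_of_one_le_of_one_le (Real.one_le_rpow hB he0.le)
      (Real.one_le_rpow h2m (by positivity))
    have hKbar : Kbar C N S.cbar p₀ q₀ p q m = C * N T := by
      rw [Kbar, if_pos hlt, hrc, hexp]
    have hpos : 0 < C * N T := mul_pos hC (hNpos T hT1)
    rw [hKbar]
    refine ⟨hpos, extrapolate_down hp₀ hq₀ hp hq hpq hlt hr he hf hg ha2 hw hwA'
      (fun W hW hWT => key T (zero_le_one.trans hT1) W hW (hWT.trans_eq ?_)) (by simpa using hpos)⟩
    rw [hT, ← ENNReal.ofReal_coe_nnreal, ← ENNReal.ofReal_ofNat, ← ENNReal.ofReal_mul (by norm_num),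
      ENNReal.ofReal_rpow_of_nonneg (by positivity) he0.le, ← ENNReal.ofReal_mul (by positivity)]
    congr 1
    push_cast
    rw [show 2 * (S.cbar * r * (2 * (m : ℝ)) ^ (1 / (r - 1))) =
      2 * S.cbar * r * (2 * (m : ℝ)) ^ (1 / (r - 1)) by ring,
      Real.mul_rpow hB0.le (by positivity), ← Real.rpow_mul h2m0.le, Real.rpow_add h2m0,
      Real.rpow_one]
    ring
  -- For `q = q₀` also `p = p₀`, and the hypothesis applies directly to the `A₁` weight `w`.
  · have hKbar : Kbar C N S.cbar p₀ q p q m = C * N (2 * m) := by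
      rw [Kbar, if_neg (lt_irrefl q)]; simp
    have hpos : 0 < C * N (2 * m) := mul_pos hC (hNpos _ h2m)
    have hpp : p₀ = p := by
      have : 1 / p₀ = 1 / p := by linarith
      simpa using this
    rw [hKbar]
    refine ⟨hpos, ?_⟩
    have h1 := hwA'.mem_Ap ENNReal.coe_ne_top hw hr₀1
    have h2 := key (2 * m) h2m0.le w h1.1 (h1.2.trans_eq (by
      rw [← ENNReal.ofReal_coe_nnreal]; push_cast; rfl))
    rw [hpp] at h2
    refine h2.trans (mul_le_mul_left ?_ _)
    exact le_mul_of_one_le_left' (by norm_num)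
  · set s := gammaExponent p₀ q₀ * (q - q₀) / (r - 1) with hs
    have hs0 : 0 < s := div_pos (mul_pos hγ0 (by linarith)) hr1
    set T := (2 * S.cbar * r) ^ s * (2 * (m : ℝ)) with hT
    have hT1 : 1 ≤ T := one_le_mul_of_one_le_of_one_le (Real.one_le_rpow hB hs0.le) h2m
    have hKbar : Kbar C N S.cbar p₀ q₀ p q m = C * N T := by
      rw [Kbar, if_neg hlt.not_gt, hrc]
    have hpos : 0 < C * N T := mul_pos hC (hNpos T hT1)
    rw [hKbar]
    refine ⟨hpos, extrapolate_up hp₀ hq₀ hp hq hpq hlt hr hs hf hg (one_le_two.trans ha2) hw hwA'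
      (fun W hW hWT => key T (zero_le_one.trans hT1) W hW (hWT.trans_eq ?_)) hJt⟩
    have ha0 : 0 < ((2 * m : ℝ≥0) : ℝ) := by push_cast; exact h2m0
    rw [hT, ← ENNReal.ofReal_coe_nnreal, ← ENNReal.ofReal_ofNat, ← ENNReal.ofReal_mul (by norm_num),
      ENNReal.ofReal_rpow_of_nonneg (by positivity) hs0.le, ENNReal.ofReal_rpow_of_pos ha0,
      ← ENNReal.ofReal_mul (by positivity)]
    congr 1
    push_cast
    rw [show 2 * (S.cbar * r * (2 * (m : ℝ))) = 2 * S.cbar * r * (2 * (m : ℝ)) by ring,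
      Real.mul_rpow hB0.le h2m0.le, mul_assoc, ← Real.rpow_add h2m0, add_sub_cancel, Real.rpow_one]

end HomogeneousSpace

/-! ### The Lorentz–Luxemburg theorem by projection in `L²`. -/

namespace HomogeneousSpace

variable {X : Type*} [MeasurableSpace X] {S : HomogeneousSpace X}

/-- The truncation of a function to the ball `B(o, n)` and to height `n`. -/
noncomputable def trunc (S : HomogeneousSpace X) (o : X) (f : X → ℝ≥0∞) (n : ℕ) : X → ℝ≥0∞ :=
  (S.ball o n).indicator fun x => min (f x) n

lemma trunc_le (o : X) (f : X → ℝ≥0∞) (n : ℕ) (x : X) : S.trunc o f n x ≤ f x :=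
  Set.indicator_apply_le' (fun _ => min_le_left _ _) fun _ => zero_le

lemma trunc_le_indicator (o : X) (f : X → ℝ≥0∞) (n : ℕ) (x : X) :
    S.trunc o f n x ≤ (S.ball o n).indicator (fun _ => (n : ℝ≥0∞)) x :=
  Set.indicator_le_indicator (min_le_right _ _)

lemma trunc_ne_top (o : X) (f : X → ℝ≥0∞) (n : ℕ) (x : X) : S.trunc o f n x ≠ ∞ := by
  refine ((S.trunc_le_indicator o f n x).trans_lt ?_).ne
  exact (Set.indicator_apply_le' (fun _ => le_rfl) fun _ => zero_le).trans_lt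
    (ENNReal.natCast_lt_top n)

lemma aemeasurable_trunc (o : X) {f : X → ℝ≥0∞} (hf : AEMeasurable f S.μ) (n : ℕ) :
    AEMeasurable (S.trunc o f n) S.μ :=
  (hf.min aemeasurable_const).indicator (S.measurableSet_ball' o n)

lemma trunc_mono (o : X) (f : X → ℝ≥0∞) (x : X) : Monotone fun n => S.trunc o f n x := by
  intro m n hmn
  have hB : S.ball o m ⊆ S.ball o n := S.ball_mono o (by exact_mod_cast hmn)
  refine (Set.indicator_le_indicator_of_subset hB (fun _ => zero_le) x).trans
    (Set.indicator_le_indicator (min_le_min le_rfl ?_))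
  exact_mod_cast hmn

lemma iSup_trunc (o : X) (f : X → ℝ≥0∞) (x : X) : ⨆ n, S.trunc o f n x = f x := by
  refine le_antisymm (iSup_le fun n => S.trunc_le o f n x) (le_of_forall_lt fun c hc => ?_)
  obtain ⟨k, hk⟩ := Set.mem_iUnion.1 ((S.iUnion_ball_nat o).symm ▸ Set.mem_univ x)
  obtain ⟨l, hl⟩ := ENNReal.exists_nat_gt (ne_top_of_lt hc)
  have hx : x ∈ S.ball o (max k l : ℕ) := S.ball_mono o (by exact_mod_cast le_max_left k l) hk
  refine lt_of_lt_of_le ?_ (le_iSup _ (max k l))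
  rw [trunc, Set.indicator_of_mem hx]
  refine lt_min hc (hl.trans_le ?_)
  exact_mod_cast le_max_right k l

lemma memLp_mul_trunc (o : X) {f : X → ℝ≥0∞} (hf : AEMeasurable f S.μ) (n : ℕ) {e : X → ℝ}
    (hem : Measurable e) (he : ∀ x, |e x| = 1) (p : ℝ≥0∞) :
    MemLp (fun x => e x * (S.trunc o f n x).toReal) p S.μ := by
  refine (memLp_indicator_const p (S.measurableSet_ball' o n) (n : ℝ)
    (Or.inr (S.measure_ball_ne_top o n))).mono
    (hem.aemeasurable.mul (S.aemeasurable_trunc o hf n).ennreal_toReal).aestronglyMeasurable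
    (Filter.Eventually.of_forall fun x => ?_)
  have h := ENNReal.toReal_mono (b := (S.ball o n).indicator (fun _ => (n : ℝ≥0∞)) x) (by
    by_cases hx : x ∈ S.ball o n <;> simp [hx]) (S.trunc_le_indicator o f n x)
  rw [Real.norm_eq_abs, abs_mul, he, one_mul, abs_of_nonneg ENNReal.toReal_nonneg]
  refine h.trans (le_trans (le_of_eq ?_) (le_abs_self _))
  by_cases hx : x ∈ S.ball o n <;> simp [hx]

/-- The Fatou property of a Banach function space. -/
lemma IsBFS.le_of_tendsto {ρ : (X → ℝ≥0∞) → ℝ≥0∞} (hρ : S.IsBFS ρ) {f : ℕ → X → ℝ≥0∞}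
    {g : X → ℝ≥0∞} (hf : ∀ n, AEMeasurable (f n) S.μ) (hg : AEMeasurable g S.μ)
    (hfg : ∀ᵐ x ∂S.μ, Filter.Tendsto (fun n => f n x) Filter.atTop (nhds (g x))) {c : ℝ≥0∞}
    (hc : ∀ n, ρ (f n) ≤ c) : ρ g ≤ c := by
  have hm : ∀ n, AEMeasurable (fun x => ⨅ j, f (n + j) x) S.μ :=
    fun n => AEMeasurable.iInf fun j => hf (n + j)
  have hmono : ∀ x, Monotone fun n => ⨅ j, f (n + j) x := by
    intro x a b hab
    refine le_iInf fun j => (iInf_le _ (b - a + j)).trans_eq ?_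
    congr 1
    omega
  calc ρ g ≤ ρ (fun x => ⨆ n, ⨅ j, f (n + j) x) := by
        refine hρ.mono _ _ (AEMeasurable.iSup hm) hg ?_
        filter_upwards [hfg] with x hx
        rw [← hx.liminf_eq, Filter.liminf_eq_iSup_iInf_of_nat']
        simp_rw [add_comm]
        exact le_rfl
    _ = ⨆ n, ρ (fun x => ⨅ j, f (n + j) x) :=
        hρ.iSup_eq _ hm (Filter.Eventually.of_forall hmono)
    _ ≤ c := iSup_le fun n => (hρ.mono _ _ (hf n) (hm n) (Filter.Eventually.of_forall fun x =>
        (iInf_le _ 0).trans_eq (by simp))).trans (hc n)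

/-- The functions in `L²` whose norm in a given Banach function space is at most `c`. -/
def l2Ball (S : HomogeneousSpace X) (ρ : (X → ℝ≥0∞) → ℝ≥0∞) (c : ℝ≥0∞) : Set (Lp ℝ 2 S.μ) :=
  {k | ρ (fun x => ‖k x‖ₑ) ≤ c}

lemma aemeasurable_enorm_Lp (k : Lp ℝ 2 S.μ) : AEMeasurable (fun x => ‖k x‖ₑ) S.μ :=
  (Lp.aestronglyMeasurable k).enorm

/-- A sequence convergent in `L²` has an almost everywhere convergent subsequence, to which the
Fatou property applies. -/
lemma IsBFS.isClosed_l2Ball {ρ : (X → ℝ≥0∞) → ℝ≥0∞} (hρ : S.IsBFS ρ) (c : ℝ≥0∞) :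
    IsClosed (S.l2Ball ρ c) := by
  refine IsSeqClosed.isClosed fun u k hu huk => ?_
  obtain ⟨ns, -, hns⟩ := (tendstoInMeasure_of_tendsto_Lp huk).exists_seq_tendsto_ae
  refine hρ.le_of_tendsto (f := fun n x => ‖u (ns n) x‖ₑ) (fun n => aemeasurable_enorm_Lp _)
    (aemeasurable_enorm_Lp k) ?_ (fun n => hu (ns n))
  filter_upwards [hns] with x hx
  exact hx.enorm

lemma IsBFS.convex_l2Ball {ρ : (X → ℝ≥0∞) → ℝ≥0∞} (hρ : S.IsBFS ρ) (c : ℝ≥0∞) :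
    Convex ℝ (S.l2Ball ρ c) := by
  intro u hu v hv a b ha hb hab
  have hle : ∀ᵐ x ∂S.μ, ‖(a • u + b • v : Lp ℝ 2 S.μ) x‖ₑ ≤
      (a.toNNReal : ℝ≥0∞) * ‖u x‖ₑ + (b.toNNReal : ℝ≥0∞) * ‖v x‖ₑ := by
    filter_upwards [Lp.coeFn_add (a • u) (b • v), Lp.coeFn_smul a u, Lp.coeFn_smul b v]
      with x h1 h2 h3
    rw [h1, Pi.add_apply, h2, h3]
    refine (enorm_add_le _ _).trans (le_of_eq ?_)
    rw [Pi.smul_apply, Pi.smul_apply, smul_eq_mul, smul_eq_mul, enorm_mul, enorm_mul,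
      Real.enorm_of_nonneg ha, Real.enorm_of_nonneg hb]
    rfl
  have hum := aemeasurable_enorm_Lp u
  have hvm := aemeasurable_enorm_Lp v
  calc ρ (fun x => ‖(a • u + b • v : Lp ℝ 2 S.μ) x‖ₑ)
      ≤ ρ (fun x => (a.toNNReal : ℝ≥0∞) * ‖u x‖ₑ + (b.toNNReal : ℝ≥0∞) * ‖v x‖ₑ) :=
        hρ.mono _ _ ((hum.const_mul _).add (hvm.const_mul _)) (aemeasurable_enorm_Lp _) hle
    _ ≤ a.toNNReal * ρ (fun x => ‖u x‖ₑ) + b.toNNReal * ρ (fun x => ‖v x‖ₑ) := by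
        refine (hρ.triangle _ _ (hum.const_mul _) (hvm.const_mul _)).trans_eq ?_
        rw [hρ.smul_eq _ _ hum, hρ.smul_eq _ _ hvm]
    _ ≤ a.toNNReal * c + b.toNNReal * c :=
        add_le_add (mul_le_mul_right hu _) (mul_le_mul_right hv _)
    _ = c := by
        rw [← add_mul, ← ENNReal.coe_add, ← Real.toNNReal_add ha hb, hab]
        simp

lemma IsBFS.zero_mem_l2Ball {ρ : (X → ℝ≥0∞) → ℝ≥0∞} (hρ : S.IsBFS ρ) (c : ℝ≥0∞) :
    (0 : Lp ℝ 2 S.μ) ∈ S.l2Ball ρ c := by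
  refine le_of_eq_of_le ((hρ.eq_zero_iff _ (aemeasurable_enorm_Lp 0)).2 ?_) zero_le
  filter_upwards [Lp.coeFn_zero ℝ 2 S.μ] with x hx
  rw [hx]
  simp

/-- The truncations of `k`, multiplied by the sign of `v`, are admissible test functions in `L²`,
and their inner products with `v` increase to the integral on the left. This removes both the sign
and the square integrability from the test functions. -/
lemma lintegral_enorm_mul_le_of_inner_le {ρ : (X → ℝ≥0∞) → ℝ≥0∞} (hρ : S.IsBFS ρ) [Nonempty X]
    {c : ℝ≥0∞} {v : Lp ℝ 2 S.μ} {β : ℝ} (hv : ∀ k ∈ S.l2Ball ρ c, inner ℝ v k ≤ β)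
    {k : X → ℝ≥0∞} (hk : AEMeasurable k S.μ) (hkc : ρ k ≤ c) :
    ∫⁻ x, ‖v x‖ₑ * k x ∂S.μ ≤ ENNReal.ofReal β := by
  obtain ⟨o⟩ := ‹Nonempty X›
  have hvm : Measurable v := (Lp.stronglyMeasurable v).measurable
  set e : X → ℝ := fun x => if 0 ≤ v x then 1 else -1 with he
  have hem : Measurable e :=
    Measurable.ite (measurableSet_le measurable_const hvm) measurable_const measurable_const
  have he1 : ∀ x, |e x| = 1 := by intro x; rw [he]; dsimp only; split_ifs <;> simp
  have hev : ∀ x, v x * e x = |v x| := by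
    intro x
    rw [he]
    dsimp only
    split_ifs with h
    · rw [abs_of_nonneg h, mul_one]
    · rw [abs_of_neg (not_le.1 h)]; ring
  have hn : ∀ n, ∫⁻ x, ‖v x‖ₑ * S.trunc o k n x ∂S.μ ≤ ENNReal.ofReal β := by
    intro n
    have hL := S.memLp_mul_trunc o hk n hem he1 2
    set κ := hL.toLp _ with hκ
    have hκx : κ =ᵐ[S.μ] fun x => e x * (S.trunc o k n x).toReal := hL.coeFn_toLp
    have hmem : κ ∈ S.l2Ball ρ c := by
      refine le_trans (hρ.mono _ _ hk (aemeasurable_enorm_Lp κ) ?_) hkc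
      filter_upwards [hκx] with x hx
      rw [hx, enorm_mul, Real.enorm_eq_ofReal_abs (e x), he1, Real.enorm_of_nonneg ENNReal.toReal_nonneg,
        ENNReal.ofReal_toReal (S.trunc_ne_top o k n x)]
      simpa using S.trunc_le o k n x
    have hxy : ∀ᵐ x ∂S.μ, inner ℝ (v x) (κ x) = |v x| * (S.trunc o k n x).toReal := by
      filter_upwards [hκx] with x hx
      rw [hx, ← hev, RCLike.inner_apply, conj_trivial]
      ring
    refine le_trans (le_of_eq ?_) (ENNReal.ofReal_le_ofReal (hv κ hmem))
    rw [L2.inner_def, ofReal_integral_eq_lintegral_ofReal (L2.integrable_inner v κ)]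
    · refine lintegral_congr_ae ?_
      filter_upwards [hxy] with x hx
      rw [hx, ENNReal.ofReal_mul (abs_nonneg _), ENNReal.ofReal_toReal (S.trunc_ne_top o k n x),
        Real.enorm_eq_ofReal_abs]
    · filter_upwards [hxy] with x hx
      rw [hx]
      exact mul_nonneg (abs_nonneg _) ENNReal.toReal_nonneg
  calc ∫⁻ x, ‖v x‖ₑ * k x ∂S.μ = ∫⁻ x, ⨆ n, ‖v x‖ₑ * S.trunc o k n x ∂S.μ := by
        refine lintegral_congr fun x => ?_
        rw [← ENNReal.mul_iSup, iSup_trunc]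
    _ = ⨆ n, ∫⁻ x, ‖v x‖ₑ * S.trunc o k n x ∂S.μ := by
        refine lintegral_iSup' (fun n => (aemeasurable_enorm_Lp v).fun_mul
          (S.aemeasurable_trunc o hk n)) (Filter.Eventually.of_forall fun x a b hab => ?_)
        exact mul_le_mul_right (S.trunc_mono o k x hab) _
    _ ≤ _ := iSup_le hn

/-- The Lorentz--Luxemburg theorem: a Banach function norm is determined by its dual norm. -/
lemma IsBFS.le_of_forall_lintegral_le {ρ : (X → ℝ≥0∞) → ℝ≥0∞} (hρ : S.IsBFS ρ)
    {G : X → ℝ≥0∞} (hG : AEMeasurable G S.μ) {c : ℝ≥0}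
    (h : ∀ k, AEMeasurable k S.μ → ∫⁻ x, G x * k x ∂S.μ ≤ c * S.dual ρ k) : ρ G ≤ c := by
  rcases isEmpty_or_nonempty X with hX | hX
  · refine le_of_eq_of_le ((hρ.eq_zero_iff G hG).2 ?_) zero_le
    exact Filter.Eventually.of_forall fun x => hX.elim x
  have o := hX.some
  by_contra hcon
  rw [not_le] at hcon
  have hsup : ρ G = ⨆ n, ρ (S.trunc o G n) := by
    rw [← hρ.iSup_eq _ (S.aemeasurable_trunc o hG)
      (Filter.Eventually.of_forall (S.trunc_mono o G))]
    congr 1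
    funext x
    exact (S.iSup_trunc o G x).symm
  rw [hsup] at hcon
  obtain ⟨n, hn⟩ := lt_iSup_iff.1 hcon
  have hL : MemLp (fun x => (S.trunc o G n x).toReal) 2 S.μ := by
    simpa using S.memLp_mul_trunc o hG n (e := fun _ => 1) measurable_const (by simp) 2
  set H := hL.toLp _ with hH
  have hHx : ∀ᵐ x ∂S.μ, ‖H x‖ₑ = S.trunc o G n x := by
    filter_upwards [hL.coeFn_toLp] with x hx
    rw [hx, Real.enorm_of_nonneg ENNReal.toReal_nonneg,
      ENNReal.ofReal_toReal (S.trunc_ne_top o G n x)]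
  have hHC : H ∉ S.l2Ball ρ c := by
    intro hmem
    refine absurd hn (not_lt.2 ((hρ.mono _ _ (aemeasurable_enorm_Lp H)
      (S.aemeasurable_trunc o hG n) ?_).trans hmem))
    filter_upwards [hHx] with x hx
    exact hx.ge
  have hconv := hρ.convex_l2Ball (c : ℝ≥0∞)
  -- Separation is obtained from the nearest point in Hilbert space: a truncation of `G` outside the
  -- closed convex set differs from its projection by a vector `v` that separates it strictly from
  -- the set.
  obtain ⟨P, hPC, hP⟩ := exists_norm_eq_iInf_of_complete_convex ⟨0, hρ.zero_mem_l2Ball (c : ℝ≥0∞)⟩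
    (hρ.isClosed_l2Ball (c : ℝ≥0∞)).isComplete hconv H
  have hproj := (norm_eq_iInf_iff_real_inner_le_zero hconv hPC).1 hP
  set v := H - P with hv
  have hvk : ∀ k ∈ S.l2Ball ρ c, inner ℝ v k ≤ inner ℝ v P := by
    intro k hk
    have := hproj k hk
    rw [inner_sub_right] at this
    linarith
  have hβ : 0 ≤ inner ℝ v P := by simpa using hvk 0 (hρ.zero_mem_l2Ball _)
  have hv0 : v ≠ 0 := by
    intro h0
    rw [hv, sub_eq_zero] at h0
    exact hHC (h0 ▸ hPC)
  have hvH : inner ℝ v P < inner ℝ v H := by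
    have h1 : 0 < inner ℝ v v := by
      rw [real_inner_self_eq_norm_sq]
      have := norm_pos_iff.2 hv0
      positivity
    have h2 : inner ℝ v v = inner ℝ v H - inner ℝ v P := by rw [← inner_sub_right]
    linarith
  have hvm := aemeasurable_enorm_Lp v
  -- The separating vector thus has small dual norm, so the assumed inequality tested on `|v|`
  -- contradicts the strict separation from `H`.
  have hdual : c * S.dual ρ (fun x => ‖v x‖ₑ) ≤ ENNReal.ofReal (inner ℝ v P) := by
    rw [dual]
    simp only [ENNReal.mul_iSup]
    refine iSup_le fun g => iSup_le fun hg => iSup_le fun hg1 => ?_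
    have h1 := lintegral_enorm_mul_le_of_inner_le hρ hvk (hg.const_mul (c : ℝ≥0∞)) (by
      rw [hρ.smul_eq c g hg]
      exact mul_le_of_le_one_right' hg1)
    refine le_trans (le_of_eq ?_) h1
    rw [← lintegral_const_mul'' _ (hvm.fun_mul hg)]
    exact lintegral_congr fun x => by ring
  have hlast : ENNReal.ofReal (inner ℝ v H) ≤ ENNReal.ofReal (inner ℝ v P) := by
    calc ENNReal.ofReal (inner ℝ v H) ≤ ‖inner ℝ v H‖ₑ := Real.ofReal_le_enorm _
      _ ≤ ∫⁻ x, ‖inner ℝ (v x) (H x)‖ₑ ∂S.μ := by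
          rw [L2.inner_def]
          exact enorm_integral_le_lintegral_enorm _
      _ ≤ ∫⁻ x, G x * ‖v x‖ₑ ∂S.μ := by
          refine lintegral_mono_ae ?_
          filter_upwards [hHx] with x hx
          rw [RCLike.inner_apply, conj_trivial, enorm_mul, hx]
          exact mul_le_mul_left (S.trunc_le o G n x) _
      _ ≤ _ := (h _ hvm).trans hdual
  exact absurd ((ENNReal.ofReal_le_ofReal_iff hβ).1 hlast) (not_le.2 hvH)

end HomogeneousSpace

/-! ### The Köthe dual and the iteration of `M` on it. -/

namespace HomogeneousSpace

variable {X : Type*} [MeasurableSpace X] {S : HomogeneousSpace X}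

lemma dual_mono_ae (ρ : (X → ℝ≥0∞) → ℝ≥0∞) {f g : X → ℝ≥0∞} (h : ∀ᵐ x ∂S.μ, f x ≤ g x) :
    S.dual ρ f ≤ S.dual ρ g := by
  refine iSup_mono fun k => iSup_mono fun _ => iSup_mono fun _ => lintegral_mono_ae ?_
  filter_upwards [h] with x hx
  exact mul_le_mul_left hx _

lemma dual_const_mul (ρ : (X → ℝ≥0∞) → ℝ≥0∞) {f : X → ℝ≥0∞} (hf : AEMeasurable f S.μ)
    (c : ℝ≥0∞) : S.dual ρ (fun x => c * f x) = c * S.dual ρ f := by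
  simp only [dual, ENNReal.mul_iSup]
  congr! 6 with g hg h
  rw [← lintegral_const_mul'' _ (hf.fun_mul hg)]
  simp only [mul_assoc]

lemma dual_tsum_le (ρ : (X → ℝ≥0∞) → ℝ≥0∞) {f : ℕ → X → ℝ≥0∞}
    (hf : ∀ k, AEMeasurable (f k) S.μ) :
    S.dual ρ (fun x => ∑' k, f k x) ≤ ∑' k, S.dual ρ (f k) := by
  refine iSup_le fun g => iSup_le fun hg => iSup_le fun hg1 => ?_
  simp_rw [← ENNReal.tsum_mul_right]
  rw [lintegral_tsum fun k => (hf k).fun_mul hg]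
  exact ENNReal.tsum_le_tsum fun k =>
    le_iSup_of_le g <| le_iSup_of_le hg <| le_iSup_of_le hg1 le_rfl

/-- Hölder's inequality for a Banach function space and its Köthe dual. -/
lemma IsBFS.lintegral_mul_le {ρ : (X → ℝ≥0∞) → ℝ≥0∞} (hρ : S.IsBFS ρ) {f g : X → ℝ≥0∞}
    (hf : AEMeasurable f S.μ) (hg : AEMeasurable g S.μ) (hgt : ρ g < ∞) :
    ∫⁻ x, f x * g x ∂S.μ ≤ S.dual ρ f * ρ g := by
  rcases eq_or_ne (ρ g) 0 with h0 | h0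
  · have h := (hρ.eq_zero_iff g hg).1 h0
    rw [(lintegral_eq_zero_iff' (hf.fun_mul hg)).2]
    · exact zero_le
    · filter_upwards [h] with x hx
      simp [hx]
  · have hc : (((ρ g).toNNReal⁻¹ : ℝ≥0) : ℝ≥0∞) = (ρ g)⁻¹ := by
      rw [ENNReal.coe_inv (by simp [ENNReal.toNNReal_eq_zero_iff, h0, hgt.ne]),
        ENNReal.coe_toNNReal hgt.ne]
    have h1 : ∫⁻ x, f x * ((ρ g)⁻¹ * g x) ∂S.μ ≤ S.dual ρ f := by
      refine le_iSup_of_le (fun x => (ρ g)⁻¹ * g x) <| le_iSup_of_le (hg.const_mul _) <|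
        le_iSup_of_le ?_ le_rfl
      rw [← hc, hρ.smul_eq _ _ hg, hc, ENNReal.inv_mul_cancel h0 hgt.ne]
    have h2 : ∫⁻ x, f x * ((ρ g)⁻¹ * g x) ∂S.μ = (ρ g)⁻¹ * ∫⁻ x, f x * g x ∂S.μ := by
      rw [← lintegral_const_mul'' _ (hf.fun_mul hg)]
      exact lintegral_congr fun x => by ring
    rw [h2] at h1
    calc _ = ((ρ g)⁻¹ * ∫⁻ x, f x * g x ∂S.μ) * ρ g := by
          rw [mul_comm, ← mul_assoc, ENNReal.mul_inv_cancel h0 hgt.ne, one_mul]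
      _ ≤ _ := mul_le_mul_left h1 _

lemma lintegral_mul_indicator_one {B : Set X} (hB : MeasurableSet B) (f : X → ℝ≥0∞) :
    ∫⁻ x, f x * B.indicator (fun _ => 1) x ∂S.μ = ∫⁻ x in B, f x ∂S.μ := by
  rw [← lintegral_indicator hB]
  refine lintegral_congr fun x => ?_
  by_cases hx : x ∈ B <;> simp [hx]

lemma IsBFS.setLIntegral_le_dual_mul {ρ : (X → ℝ≥0∞) → ℝ≥0∞} (hρ : S.IsBFS ρ) {B : Set X}
    (hB : MeasurableSet B) (hBt : S.μ B < ∞) {f : X → ℝ≥0∞} (hf : AEMeasurable f S.μ) :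
    ∫⁻ x in B, f x ∂S.μ ≤ S.dual ρ f * ρ (B.indicator fun _ => 1) := by
  rw [← lintegral_mul_indicator_one hB]
  exact hρ.lintegral_mul_le hf (measurable_const.indicator hB).aemeasurable
    (hρ.indicator_lt_top B hB hBt)

lemma IsBFS.dual_indicator_lt_top {ρ : (X → ℝ≥0∞) → ℝ≥0∞} (hρ : S.IsBFS ρ) {B : Set X}
    (hB : MeasurableSet B) (hBt : S.μ B < ∞) : S.dual ρ (B.indicator fun _ => 1) < ∞ := by
  obtain ⟨C, hC⟩ := hρ.setLIntegral_le B hB hBt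
  refine lt_of_le_of_lt (b := (C : ℝ≥0∞)) ?_ ENNReal.coe_lt_top
  refine iSup_le fun g => iSup_le fun hg => iSup_le fun hg1 => ?_
  simp_rw [mul_comm _ (g _)]
  rw [lintegral_mul_indicator_one hB]
  exact (hC g hg).trans (mul_le_of_le_one_right' hg1)

lemma IsBFS.dual_indicator_ne_zero {ρ : (X → ℝ≥0∞) → ℝ≥0∞} (hρ : S.IsBFS ρ) {B : Set X}
    (hB : MeasurableSet B) (hBt : S.μ B < ∞) (hB0 : S.μ B ≠ 0) :
    S.dual ρ (B.indicator fun _ => 1) ≠ 0 := by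
  intro h
  have h1 := hρ.setLIntegral_le_dual_mul hB hBt
    (f := B.indicator fun _ => 1) (measurable_const.indicator hB).aemeasurable
  rw [h, zero_mul, lintegral_indicator hB, Measure.restrict_restrict hB, Set.inter_self] at h1
  simp [hB0] at h1

/-- The infimum defining the operator norm is itself an admissible constant. Functions of norm zero
are treated apart because the argument divides by the norm. -/
lemma maximal_le_maximalNorm_mul {ρ : (X → ℝ≥0∞) → ℝ≥0∞} (hρ : S.maximalNorm ρ < ∞)
    {f : X → ℝ≥0∞} (hf : AEMeasurable f S.μ) (hft : ρ f < ∞) :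
    ρ (S.maximal f) ≤ S.maximalNorm ρ * ρ f := by
  rcases eq_or_ne (ρ f) 0 with h0 | h0
  · obtain ⟨c, hc, -⟩ := sInf_lt_iff.1 hρ
    simpa [h0] using hc f hf hft
  · rw [← ENNReal.div_le_iff h0 hft.ne]
    refine le_sInf fun c hc => ?_
    rw [ENNReal.div_le_iff h0 hft.ne]
    exact hc f hf hft

/-- The indicator of a ball is dominated by its own maximal function, and its dual norm is positive
and finite. Consequently the `A₁` constant `2‖M‖` is at least 2, as the explicit strong type
constant requires. -/
lemma one_le_maximalNorm_dual [Nonempty X] {ρ : (X → ℝ≥0∞) → ℝ≥0∞} (hρ : S.IsBFS ρ)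
    (hM : S.MaximalBounded (S.dual ρ)) : 1 ≤ S.maximalNorm (S.dual ρ) := by
  obtain ⟨o⟩ := ‹Nonempty X›
  have hB := S.measurableSet_ball' o 1
  have hBt := (S.measure_ball_ne_top o 1).lt_top
  have hB0 := S.measure_ball_ne_zero o one_pos
  have h0 := hρ.dual_indicator_ne_zero hB hBt hB0
  have ht := hρ.dual_indicator_lt_top hB hBt
  have h1 := maximal_le_maximalNorm_mul hM.2
    (f := (S.ball o 1).indicator fun _ => 1) (measurable_const.indicator hB).aemeasurable ht
  have h2 : ∀ x, (S.ball o 1).indicator (fun _ => (1 : ℝ≥0∞)) x ≤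
      S.maximal ((S.ball o 1).indicator fun _ => 1) x := by
    intro x
    by_cases hx : x ∈ S.ball o 1
    · refine le_trans (le_of_eq ?_) (S.avg_le_maximal _ one_pos hx)
      rw [avg, lintegral_indicator hB, Measure.restrict_restrict hB, Set.inter_self]
      simp [hx, ENNReal.inv_mul_cancel hB0 hBt.ne]
    · simp [hx]
  have h3 := (dual_mono_ae (S := S) ρ (Filter.Eventually.of_forall h2)).trans h1
  rw [← ENNReal.mul_le_mul_iff_left h0 ht.ne, one_mul]
  exact h3

/-- The Rubio de Francia iteration in the dual of a Banach function space. -/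
lemma exists_A1_majorant_dual [Nonempty X] {ρ : (X → ℝ≥0∞) → ℝ≥0∞} (hρ : S.IsBFS ρ)
    (hM : S.MaximalBounded (S.dual ρ)) {h : X → ℝ≥0∞} (hh : AEMeasurable h S.μ)
    (hht : S.dual ρ h < ∞) (hh0 : ¬ ∀ᵐ x ∂S.μ, h x = 0) :
    ∃ w, S.IsWeight w ∧ S.A1With w (2 * S.maximalNorm (S.dual ρ)) ∧ (∀ x, h x ≤ w x) ∧
      S.dual ρ w ≤ 2 * S.dual ρ h := by
  set m := S.maximalNorm (S.dual ρ) with hm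
  have hm1 : 1 ≤ m := S.one_le_maximalNorm_dual hρ hM
  have hm0 : m ≠ 0 := (one_pos.trans_le hm1).ne'
  have hmt : m ≠ ∞ := hM.2.ne
  set g : ℕ → X → ℝ≥0∞ := fun k => S.maximal^[k] h with hg
  have hg0 : g 0 = h := rfl
  have hgs : ∀ k, g (k + 1) = S.maximal (g k) :=
    fun k => Function.iterate_succ_apply' S.maximal k h
  -- Measurability and finite norm are carried through the induction together: `M` is known to
  -- produce a measurable function only from an element of the space.
  have hgk : ∀ k, AEMeasurable (g k) S.μ ∧ S.dual ρ (g k) ≤ m ^ k * S.dual ρ h := by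
    intro k
    induction k with
    | zero => exact ⟨hh, by simp [hg0]⟩
    | succ k ih =>
      have ht := ih.2.trans_lt (ENNReal.mul_lt_top (ENNReal.pow_lt_top hmt.lt_top) hht)
      rw [hgs, pow_succ', mul_assoc]
      exact ⟨hM.1 _ ih.1 ht, (maximal_le_maximalNorm_mul hM.2 ih.1 ht).trans
        (mul_le_mul_right ih.2 _)⟩
  set c : ℝ≥0∞ := (2 * m)⁻¹ with hc
  have hcm : 2 * m * c = 1 := ENNReal.mul_inv_cancel (mul_ne_zero two_ne_zero hm0)
    (ENNReal.mul_ne_top (by norm_num) hmt)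
  have hcm' : c * m = 2⁻¹ := by
    rw [hc, ENNReal.mul_inv (Or.inl two_ne_zero) (Or.inl (by norm_num)), mul_assoc,
      ENNReal.inv_mul_cancel hm0 hmt, mul_one]
  have hcg : ∀ k, AEMeasurable (fun x => c ^ k * g k x) S.μ := fun k => (hgk k).1.const_mul _
  set w : X → ℝ≥0∞ := fun x => ∑' k, c ^ k * g k x with hw
  have hwm : AEMeasurable w S.μ := AEMeasurable.tsum hcg
  have hle : ∀ x, h x ≤ w x := fun x => le_trans (by simp [hg0]) (ENNReal.le_tsum 0)
  have hwA : S.A1With w (2 * m) := by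
    refine Filter.Eventually.of_forall fun x => ?_
    calc _ ≤ ∑' k, S.maximal (fun y => c ^ k * g k y) x := S.maximal_tsum_le hcg x
      _ = ∑' k, (2 * m) * (c ^ (k + 1) * g (k + 1) x) := by
          congr! 2 with k
          rw [S.maximal_const_mul (hgk k).1, hgs, pow_succ']
          calc _ = 1 * (c ^ k * S.maximal (g k) x) := by rw [one_mul]
            _ = _ := by rw [← hcm]; ring
      _ = (2 * m) * ∑' k, c ^ (k + 1) * g (k + 1) x := ENNReal.tsum_mul_left
      _ ≤ (2 * m) * w x := mul_le_mul_right (ENNReal.tsum_comp_le_tsum_of_injective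
          (add_left_injective 1) fun k => c ^ k * g k x) _
  have hwd : S.dual ρ w ≤ 2 * S.dual ρ h := by
    calc _ ≤ ∑' k, S.dual ρ (fun x => c ^ k * g k x) := dual_tsum_le ρ hcg
      _ ≤ ∑' k : ℕ, 2⁻¹ ^ k * S.dual ρ h := by
          refine ENNReal.tsum_le_tsum fun k => ?_
          rw [dual_const_mul ρ (hgk k).1, ← hcm', mul_pow, mul_assoc]
          exact mul_le_mul_right (hgk k).2 _
      _ = 2 * S.dual ρ h := by
          rw [ENNReal.tsum_mul_right, ENNReal.tsum_geometric, ENNReal.one_sub_inv_two, inv_inv]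
  have hw0 : ∀ᵐ x ∂S.μ, w x ≠ 0 := hwA.ae_ne_zero hwm fun hcon => hh0
    (hcon.mono fun x hx => le_antisymm ((hle x).trans hx.le) zero_le)
  refine ⟨w, ⟨hwm, hw0.mono fun x hx => pos_iff_ne_zero.2 hx, fun x r => ?_⟩, hwA, hle, hwd⟩
  have hB := S.measurableSet_ball' x r
  have hBt := (S.measure_ball_ne_top x r).lt_top
  -- Local integrability comes from pairing with the indicator of the ball, whose norm in the
  -- original space is finite.
  exact (hρ.setLIntegral_le_dual_mul hB hBt hwm).trans_lt (ENNReal.mul_lt_top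
    (hwd.trans_lt (ENNReal.mul_lt_top (by norm_num) hht)) (hρ.indicator_lt_top _ hB hBt))

end HomogeneousSpace

/-! ### Extrapolation to Banach function spaces. -/

lemma convexify_one_div_rpow {X : Type*} (ρ : (X → ℝ≥0∞) → ℝ≥0∞) {q : ℝ} (hq : 0 < q)
    (g : X → ℝ≥0∞) : convexify ρ (1 / q) (fun x => g x ^ q) = ρ g ^ q := by
  rw [convexify, one_div_one_div]
  congr 2
  funext x
  rw [← ENNReal.rpow_mul, mul_one_div_cancel hq.ne', ENNReal.rpow_one]

theorem theorem3p2 {X : Type*} [MeasurableSpace X] (S : HomogeneousSpace X)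
    (F : Set ((X → ℝ≥0∞) × (X → ℝ≥0∞)))
    (hF : ∀ φ ∈ F, AEMeasurable φ.1 S.μ ∧ AEMeasurable φ.2 S.μ)
    (p₀ q₀ : ℝ) (hp₀ : 1 ≤ p₀) (hq₀ : 1 ≤ q₀)
    (C : ℝ) (hC : 0 < C) (N : ℝ → ℝ)
    (hNpos : ∀ t, 1 ≤ t → 0 < N t) (hNmono : MonotoneOn N (Set.Ici 1))
    (hweighted : ∀ w ∈ S.Ap (1 + q₀ * (1 - 1 / p₀)), ∀ φ ∈ F,
      (∫⁻ x, φ.2 x ^ q₀ * w x ∂S.μ) ^ (1 / q₀) ≤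
        ENNReal.ofReal (C * N (S.apConst (1 + q₀ * (1 - 1 / p₀)) w).toReal) *
          (∫⁻ x, φ.1 x ^ p₀ * w x ^ (p₀ / q₀) ∂S.μ) ^ (1 / p₀))
    (E Ebar : (X → ℝ≥0∞) → ℝ≥0∞) (hE : S.IsBFS E) (hEbar : S.IsBFS Ebar)
    (p q : ℝ) (hp : 1 < p) (hq : 1 < q) (hpq : 1 / p - 1 / q = 1 / p₀ - 1 / q₀)
    (hEbarq : S.IsBFS (convexify Ebar (1 / q))) (hEp : S.IsBFS (convexify E (1 / p)))
    (hdual : ∀ f, AEMeasurable f S.μ →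
      S.dual (convexify Ebar (1 / q)) f = convexify (S.dual (convexify E (1 / p))) (p / q) f)
    (hM : S.MaximalBounded (S.dual (convexify Ebar (1 / q)))) :
    ∀ φ ∈ F, Ebar φ.2 < ∞ →
      Ebar φ.2 ≤ ENNReal.ofReal (4 * Kbar C N S.cbar p₀ q₀ p q
        (S.maximalNorm (S.dual (convexify Ebar (1 / q)))).toReal) * E φ.1 := by
  rintro ⟨f, g⟩ hφ hgt
  obtain ⟨hf, hg⟩ := hF _ hφ
  simp only at hf hg hgt ⊢
  rcases isEmpty_or_nonempty X with hX | hX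
  · refine le_of_eq_of_le ((hEbar.eq_zero_iff g hg).2 ?_) zero_le
    exact Filter.Eventually.of_forall fun x => hX.elim x
  have hp0 : 0 < p := by linarith
  have hq0 : 0 < q := by linarith
  set Z := convexify Ebar (1 / q) with hZ
  have hm1 := HomogeneousSpace.one_le_maximalNorm_dual hEbarq hM
  obtain ⟨m, hm⟩ := ENNReal.lt_iff_exists_coe.1 hM.2
  replace hm := hm.1.symm
  have hm1' : 1 ≤ m := by rw [← hm] at hm1; exact_mod_cast hm1
  rw [← hm, ENNReal.coe_toReal]
  set K := Kbar C N S.cbar p₀ q₀ p q m with hK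
  have hZg : Z (fun x => g x ^ q) = Ebar g ^ q := convexify_one_div_rpow Ebar hq0 g
  have hZgt : Z (fun x => g x ^ q) < ∞ := by
    rw [hZg]
    exact ENNReal.rpow_lt_top_of_nonneg hq0.le hgt.ne
  have hgq : AEMeasurable (fun x => g x ^ q) S.μ := hg.pow_const q
  have key : ∀ h, AEMeasurable h S.μ → S.dual Z h < ∞ → (¬ ∀ᵐ x ∂S.μ, h x = 0) → 0 < K ∧
      (E f < ∞ → ∫⁻ x, g x ^ q * h x ∂S.μ ≤ (ENNReal.ofReal (4 * K) * E f) ^ q * S.dual Z h) := by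
    intro h hh hht hh0
    obtain ⟨w, hw, hwA, hhw, hwd⟩ := HomogeneousSpace.exists_A1_majorant_dual hEbarq hM hh hht hh0
    have hwt : S.dual Z w < ∞ := hwd.trans_lt (ENNReal.mul_lt_top (by norm_num) hht)
    -- This is where finiteness of `‖g‖_Ē` enters: extrapolation upwards divides by a power of this
    -- integral.
    have hJt : ∫⁻ x, g x ^ q * w x ∂S.μ ≠ ∞ := by
      simp_rw [mul_comm _ (w _)]
      exact ((hEbarq.lintegral_mul_le hw.aemeasurable hgq hZgt).trans_lt
        (ENNReal.mul_lt_top hwt hZgt)).ne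
    rw [← hm] at hwA
    obtain ⟨hKpos, hJ⟩ := HomogeneousSpace.extrapolate hp₀ hq₀ hp hq hpq hC hNpos hNmono hf hg
      (fun w hw => hweighted w hw _ hφ) hm1' hw hwA hJt
    refine ⟨hKpos, fun hft => ?_⟩
    -- Hölder's inequality in `E^{1/p}` produces the dual norm of `w^{p/q}`. By the assumed equality
    -- of dual norms, its power `1/p` is the power `1/q` of the norm of `w` in the dual of `Z`.
    have hI : (∫⁻ x, f x ^ p * w x ^ (p / q) ∂S.μ) ^ (1 / p) ≤ S.dual Z w ^ (1 / q) * E f := by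
      have h1 : convexify E (1 / p) (fun x => f x ^ p) = E f ^ p := convexify_one_div_rpow E hp0 f
      have h2 := hEp.lintegral_mul_le (hw.aemeasurable.pow_const (p / q)) (hf.pow_const p) (by
        rw [h1]
        exact ENNReal.rpow_lt_top_of_nonneg hp0.le hft.ne)
      rw [h1] at h2
      rw [hdual w hw.aemeasurable, convexify, ← ENNReal.rpow_mul,
        show 1 / (p / q) * (1 / q) = 1 / p by field_simp]
      simp_rw [mul_comm (f _ ^ p)]
      refine (ENNReal.rpow_le_rpow h2 (by positivity)).trans_eq ?_
      rw [ENNReal.mul_rpow_of_nonneg _ _ (by positivity), ← ENNReal.rpow_mul,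
        mul_one_div_cancel hp0.ne', ENNReal.rpow_one]
    calc ∫⁻ x, g x ^ q * h x ∂S.μ ≤ ∫⁻ x, g x ^ q * w x ∂S.μ :=
          lintegral_mono fun x => mul_le_mul_right (hhw x) _
      _ = ((∫⁻ x, g x ^ q * w x ∂S.μ) ^ (1 / q)) ^ q := by
          rw [← ENNReal.rpow_mul, one_div_mul_cancel hq0.ne', ENNReal.rpow_one]
      _ ≤ (2 * ENNReal.ofReal K * (S.dual Z w ^ (1 / q) * E f)) ^ q :=
          ENNReal.rpow_le_rpow (hJ.trans (mul_le_mul_right hI _)) hq0.le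
      _ = (2 * ENNReal.ofReal K * E f) ^ q * S.dual Z w := by
          rw [mul_left_comm, mul_comm, ENNReal.mul_rpow_of_nonneg _ _ hq0.le, ← ENNReal.rpow_mul,
            one_div_mul_cancel hq0.ne', ENNReal.rpow_one]
      _ ≤ (2 * ENNReal.ofReal K * E f) ^ q * (2 ^ q * S.dual Z h) := by
          -- The majorant costs a factor 2 in the dual norm. Bounding it by `2^q` lets it join the
          -- `q`-th power, where `2 · 2 = 4`.
          refine mul_le_mul_right (hwd.trans (mul_le_mul_left ?_ _)) _
          calc (2 : ℝ≥0∞) = 2 ^ (1 : ℝ) := (ENNReal.rpow_one _).symm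
            _ ≤ 2 ^ q := ENNReal.rpow_le_rpow_of_exponent_le (by norm_num) hq.le
      _ = (ENNReal.ofReal (4 * K) * E f) ^ q * S.dual Z h := by
          rw [← mul_assoc, ← ENNReal.mul_rpow_of_nonneg _ _ hq0.le,
            ENNReal.ofReal_mul (by norm_num), ENNReal.ofReal_ofNat]
          ring_nf
  -- For infinite `‖f‖_E` the claim is trivial once the constant is known to be positive. Positivity
  -- is obtained by running the argument on the indicator of a ball.
  rcases eq_or_ne (E f) ∞ with hft | hft
  · obtain ⟨o⟩ := hX
    have hB := S.measurableSet_ball' o 1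
    have hBt := (S.measure_ball_ne_top o 1).lt_top
    have hd0 := hEbarq.dual_indicator_ne_zero hB hBt (S.measure_ball_ne_zero o one_pos)
    have hK0 := (key _ (measurable_const.indicator hB).aemeasurable
      (hEbarq.dual_indicator_lt_top hB hBt) fun hcon => hd0 (le_antisymm ?_ zero_le)).1
    · rw [hft, ENNReal.mul_top (by simpa using hK0)]
      exact le_top
    · refine (HomogeneousSpace.dual_mono_ae (g := fun _ => 0) Z (hcon.mono fun x hx => hx.le)).trans_eq ?_
      simp [HomogeneousSpace.dual]
  · set L := ENNReal.ofReal (4 * K) * E f with hL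
    have hLt : L ^ q ≠ ∞ := ENNReal.rpow_ne_top_of_nonneg hq0.le
      (ENNReal.mul_ne_top ENNReal.ofReal_ne_top hft)
    rw [← ENNReal.rpow_le_rpow_iff hq0, ← hZg]
    -- The slack `ε` keeps the constant positive, so that its product with an infinite dual norm is
    -- infinite even when `L = 0`.
    refine ENNReal.le_of_forall_pos_le_add fun ε hε _ => ?_
    lift L ^ q to ℝ≥0 using hLt with l hl
    rw [← ENNReal.coe_add]
    refine hEbarq.le_of_forall_lintegral_le hgq fun h hh => ?_
    by_cases hh0 : ∀ᵐ x ∂S.μ, h x = 0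
    · rw [(lintegral_eq_zero_iff' (hgq.fun_mul hh)).2]
      · exact zero_le
      · filter_upwards [hh0] with x hx
        simp [hx]
    rcases eq_or_ne (S.dual Z h) ∞ with hht | hht
    · rw [hht, ENNReal.mul_top (ENNReal.coe_ne_zero.2 (hε.trans_le (le_add_of_nonneg_left zero_le)).ne')]
      exact le_top
    · refine ((key h hh hht.lt_top hh0).2 (lt_top_iff_ne_top.2 hft)).trans ?_
      exact mul_le_mul_left (by exact_mod_cast le_add_of_nonneg_right hε.le) _
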